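/- Let $\mathcal H$ be a separable complex Hilbert space and let $T=T^*\ge 0$ be a (possibly unbounded) self-adjoint operator in $\mathcal H$ with spectral measure $E_T$. Let $W^{2,2}_T(\mathbb R_+,\mathcal H)$ be the space of all $f\in W^{2,2}(\mathbb R_+,\mathcal H)$ with $f(x)\in\operatorname{dom}T$ for a.e. $x$ and $Tf\in L^2(\mathbb R_+,\mathcal H)$, with the norm $$\|f\|_{W^{2,2}_T}^2=\int_0^\infty\bigl(\|f''(x)\|^2+\|f(x)\|^2+\|Tf(x)\|^2\bigr)\,dx ,$$ and put $\mathcal A f:=-f''+Tf$ for $f\in W^{2,2}_T(\mathbb R_+,\mathcal H)$. Let $A$ be the minimal operator in $L^2(\mathbb R_+,\mathcal H)$, i.e. the closure of the restriction of $\mathcal A$ to the linear span of all functions $\varphi(x)h$ with $h\in\operatorname{dom}T$, $\varphi\in W^{2,2}(\mathbb R_+)$, $\varphi(0)=\varphi'(0)=0$. For a densely defined closed nonnegative symmetric operator $S$ let $S^F$ be its Friedrichs extension (the restriction of $S^*$ to the vectors in $\operatorname{dom}S^*$ that lie in the domain of the closure of the form $(Su,u)$) and let $S^K$ be its Krein extension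 (the nonnegative self-adjoint extension with $(\widetilde S+x)^{-1}\le(S^K+x)^{-1}$ for every $x>0$ and every nonnegative self-adjoint extension $\widetilde S$ of $S$). Let $A^N$ be the operator associated with the form $\int_0^\infty(\|f'\|^2+\|\sqrt T f\|^2)\,dx$ on $W^{1,2}_{\sqrt T}(\mathbb R_+,\mathcal H)=\{f\in W^{1,2}(\mathbb R_+,\mathcal H): \sqrt T f\in L^2(\mathbb R_+,\mathcal H)\}$. For $n\ge1$ let $\mathcal H_n:=\operatorname{ran}E_T([n-1,n))$, let $T_n:=TE_T([n-1,n))$, a bounded operator in $\mathcal H_n$, let $S_n f:=-f''+T_nf$ on $\operatorname{dom}S_n=\{f\in W^{2,2}(\mathbb R_+,\mathcal H_n): f(0)=f'(0)=0\}$ in $L^2(\mathbb R_+,\mathcal H_n)$, and let $S_n^N$ be defined by $T_n$ in the same way as $A^N$ by $T$. Then the following holds. (i) $L^2(\mathbb R_+,\mathcal H)=\bigoplus_{n\ge1}L^2(\mathbb R_+,\mathcal H_n)$, the Krein extensions $A^K$ and $S_n^K$ exist, and $$A=\bigoplus_{n=1}^\infty S_n,\qquad A^F=\bigoplus_{n=1}^\infty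 S_n^F,\qquad A^K=\bigoplus_{n=1}^\infty S_n^K,\qquad A^N=\bigoplus_{n=1}^\infty S_n^N .$$ (ii) $\operatorname{dom}(A^F)=\{f\in W^{2,2}_T(\mathbb R_+,\mathcal H): f(0)=0\}$. This is a closed subspace of $W^{2,2}_T(\mathbb R_+,\mathcal H)$, and on it the graph norm of $A^F$ is equivalent to the norm of $W^{2,2}_T$: $$\|f\|_{W^{2,2}_T}^2\le\|A^Ff\|^2+\|f\|^2\le2\|f\|_{W^{2,2}_T}^2 .$$ (iii) $\operatorname{dom}(A^N)=\{f\in W^{2,2}_T(\mathbb R_+,\mathcal H): f'(0)=0\}$. This is a closed subspace of $W^{2,2}_T(\mathbb R_+,\mathcal H)$, and on it $$\|f\|_{W^{2,2}_T}^2\le\|A^Nf\|^2+\|f\|^2\le2\|f\|_{W^{2,2}_T}^2 .$$ Moreover, $A^F$ is the Dirichlet realization $\mathcal A\upharpoonright\{f\in W^{2,2}_T(\mathbb R_+,\mathcal H): f(0)=0\}$, $A^N$ is the Neumann realization $\mathcal A\upharpoonright\{f\in W^{2,2}_T(\mathbb R_+,\mathcal H): f'(0)=0\}$, and both are self-adjoint.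 -/

import Mathlib

open MeasureTheory Filter Topology Set
open scoped InnerProductSpace ENNReal

noncomputable section

namespace SturmLiouville

/-! ### Unbounded operators in a Hilbert space -/

section Abstract

variable {E : Type*} [NormedAddCommGroup E] [InnerProductSpace ℂ E]

/-- `A ≥ 0`, i.e. `(A u, u) ≥ 0` on `dom A` (used for symmetric operators, where `(A u, u)` is
real). -/
def IsNonneg (A : E →ₗ.[ℂ] E) : Prop :=
  ∀ u : A.domain, 0 ≤ (⟪(u : E), A u⟫_ℂ).re

/-- The kernel of a partially defined operator, as a subspace of the ambient space. -/
def pker {F : Type*} [AddCommGroup F] [Module ℂ F] (A : E →ₗ.[ℂ] F) : Submodule ℂ E :=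
  (LinearMap.ker A.toFun).map A.domain.subtype

/-- The part of `T` in the subspace `K`: `u ∈ K ∩ dom T` with `T u ∈ K` is mapped to `T u`. -/
def part (T : E →ₗ.[ℂ] E) (K : Submodule ℂ E) : K →ₗ.[ℂ] K :=
  (T.graph.comap (K.subtype.prodMap K.subtype)).toLinearPMap

/-- `S` is a nonnegative self-adjoint square root of `T`: `S = S* ≥ 0` and `S² = T`, domains
included. -/
structure IsNonnegSqrt [CompleteSpace E] (S T : E →ₗ.[ℂ] E) : Prop where
  selfAdjoint : IsSelfAdjoint S
  nonneg : IsNonneg S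
  sq : ∀ u v : E, (u, v) ∈ T.graph ↔ ∃ w : E, (u, w) ∈ S.graph ∧ (w, v) ∈ S.graph

open scoped Classical in
/-- `√T`, the nonnegative self-adjoint square root of `T = T* ≥ 0`. -/
def opSqrt [CompleteSpace E] (T : E →ₗ.[ℂ] E) : E →ₗ.[ℂ] E :=
  if h : ∃ S, IsNonnegSqrt S T then h.choose else T

/-- The operator associated with a sesquilinear form `t` with domain `D`: `f` is mapped to `g` iff
`f ∈ D` and `t[k, f] = (k, g)` for all `k ∈ D` (inner products are conjugate linear in the first
variable). -/
def formOperator (D : Submodule ℂ E) (t : D →ₗ⋆[ℂ] D →ₗ[ℂ] ℂ) : E →ₗ.[ℂ] E :=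
  Submodule.toLinearPMap
    { carrier := {p : E × E | ∃ hf : p.1 ∈ D, ∀ k : D, t k ⟨p.1, hf⟩ = ⟪(k : E), p.2⟫_ℂ}
      zero_mem' := ⟨D.zero_mem, fun k => by
        have : (⟨(0 : E × E).1, D.zero_mem⟩ : D) = 0 := rfl
        rw [this]; simp⟩
      add_mem' := by
        rintro p q ⟨hp, hp'⟩ ⟨hq, hq'⟩
        refine ⟨D.add_mem hp hq, fun k => ?_⟩
        have : (⟨(p + q).1, D.add_mem hp hq⟩ : D) = ⟨p.1, hp⟩ + ⟨q.1, hq⟩ := rfl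
        rw [this, map_add, hp', hq', Prod.snd_add, inner_add_right]
      smul_mem' := by
        rintro c p ⟨hp, hp'⟩
        refine ⟨D.smul_mem c hp, fun k => ?_⟩
        have : (⟨(c • p).1, D.smul_mem c hp⟩ : D) = c • ⟨p.1, hp⟩ := rfl
        rw [this, map_smul, hp', Prod.smul_snd, inner_smul_right, smul_eq_mul] }

/-- `f` belongs to the domain of the closure of the quadratic form `u ↦ (A u, u)`, `u ∈ dom A`:
it is the limit of a sequence in `dom A` that is Cauchy with respect to the form. -/
def InFormDomain (A : E →ₗ.[ℂ] E) (f : E) : Prop :=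
  ∃ u : ℕ → A.domain, Tendsto (fun n => (u n : E)) atTop (𝓝 f) ∧
    Tendsto (fun p : ℕ × ℕ => (⟪((u p.1 - u p.2 : A.domain) : E), A (u p.1 - u p.2)⟫_ℂ).re)
      atTop (𝓝 0)

/-- The domain of the closure of the form `u ↦ (A u, u)`. For `A ≥ 0` the elements described by
`InFormDomain` already form a subspace, see `mem_formDomain_iff`; the span only makes the
definition total. -/
def formDomain (A : E →ₗ.[ℂ] E) : Submodule ℂ E :=
  Submodule.span ℂ {f | InFormDomain A f}

theorem IsNonneg.quad_add_le {A : E →ₗ.[ℂ] E} (hA : IsNonneg A) (u v : A.domain) :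
    (⟪((u + v : A.domain) : E), A (u + v)⟫_ℂ).re ≤
      2 * (⟪(u : E), A u⟫_ℂ).re + 2 * (⟪(v : E), A v⟫_ℂ).re := by
  have h := hA (u - v)
  rw [A.map_sub] at h
  rw [A.map_add]
  simp only [Submodule.coe_sub, Submodule.coe_add, inner_sub_left, inner_sub_right,
    inner_add_left, inner_add_right, Complex.add_re, Complex.sub_re] at h ⊢
  linarith

theorem mem_formDomain_iff {A : E →ₗ.[ℂ] E} (hA : IsNonneg A) {f : E} :
    f ∈ formDomain A ↔ InFormDomain A f := by
  refine ⟨fun hf => ?_, fun hf => Submodule.subset_span hf⟩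
  refine Submodule.span_induction (p := fun x _ => InFormDomain A x) (fun x hx => hx) ?_ ?_ ?_ hf
  · refine ⟨fun _ => 0, by simp, ?_⟩
    simp
  · rintro x y _ _ ⟨u, hu, hu'⟩ ⟨v, hv, hv'⟩
    refine ⟨fun n => u n + v n, by simpa using hu.add hv, ?_⟩
    have h2 := (hu'.const_mul 2).add (hv'.const_mul 2)
    rw [mul_zero, add_zero] at h2
    refine squeeze_zero (fun p => hA _) (fun p => ?_) h2
    have := hA.quad_add_le (u p.1 - u p.2) (v p.1 - v p.2)
    rwa [show u p.1 - u p.2 + (v p.1 - v p.2) = u p.1 + v p.1 - (u p.2 + v p.2) by abel] at this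
  · rintro c x _ ⟨u, hu, hu'⟩
    refine ⟨fun n => c • u n, by simpa using hu.const_smul c, ?_⟩
    have h2 := hu'.const_mul (Complex.normSq c)
    rw [mul_zero] at h2
    refine h2.congr fun p => ?_
    rw [← smul_sub, A.map_smul, Submodule.coe_smul, inner_smul_left, inner_smul_right,
      ← mul_assoc, ← Complex.normSq_eq_conj_mul_self, Complex.re_ofReal_mul]

/-- The Friedrichs extension of a nonnegative symmetric operator `A`: the restriction of `A*` to
the vectors in the domain of the closure of the form `u ↦ (A u, u)`. -/
def friedrichs [CompleteSpace E] (A : E →ₗ.[ℂ] E) : E →ₗ.[ℂ] E :=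
  A.adjoint.domRestrict (formDomain A)

/-- `B` is a nonnegative self-adjoint extension of `A`. -/
structure IsNonnegSAExtension [CompleteSpace E] (A B : E →ₗ.[ℂ] E) : Prop where
  le : A ≤ B
  selfAdjoint : IsSelfAdjoint B
  nonneg : IsNonneg B

/-- `B` is the Krein extension of `A`, the smallest nonnegative self-adjoint extension:
`(C + x)⁻¹ ≤ (B + x)⁻¹` for all `x > 0` and all nonnegative self-adjoint extensions `C` of `A`.
Here `u = (B + x)⁻¹ g` is written as `(u, g - x u) ∈ graph B`, and similarly for `C`. -/
structure IsKreinExtension [CompleteSpace E] (A B : E →ₗ.[ℂ] E) : Prop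
    extends IsNonnegSAExtension A B where
  smallest : ∀ C : E →ₗ.[ℂ] E, IsNonnegSAExtension A C → ∀ x : ℝ, 0 < x → ∀ g u v : E,
    (u, g - (x : ℂ) • u) ∈ B.graph → (v, g - (x : ℂ) • v) ∈ C.graph →
      (⟪v, g⟫_ℂ).re ≤ (⟪u, g⟫_ℂ).re

open scoped Classical in
/-- The Krein extension of a nonnegative symmetric operator `A`. -/
def krein [CompleteSpace E] (A : E →ₗ.[ℂ] E) : E →ₗ.[ℂ] E :=
  if h : ∃ B, IsKreinExtension A B then h.choose else A

/-- The orthogonal sum `⨁ Sᵢ` in `E` of operators `Sᵢ` in Hilbert spaces `Gᵢ` that are embedded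
into `E` as pairwise orthogonal subspaces by isometries `Jᵢ`: the vector `f = ∑ Jᵢ uᵢ` with
`uᵢ ∈ dom Sᵢ` is in the domain iff `g = ∑ Jᵢ (Sᵢ uᵢ)` converges, and it is mapped to `g`. -/
def directSum {ι : Type*} {G : ι → Type*} [∀ i, NormedAddCommGroup (G i)]
    [∀ i, InnerProductSpace ℂ (G i)] (J : ∀ i, G i →ₗᵢ[ℂ] E) (S : ∀ i, G i →ₗ.[ℂ] G i) :
    E →ₗ.[ℂ] E :=
  Submodule.toLinearPMap
    { carrier := {p : E × E | ∃ u v : ∀ i, G i, (∀ i, (u i, v i) ∈ (S i).graph) ∧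
        HasSum (fun i => J i (u i)) p.1 ∧ HasSum (fun i => J i (v i)) p.2}
      zero_mem' := ⟨0, 0, fun i => (S i).graph.zero_mem, by simp, by simp⟩
      add_mem' := by
        rintro p q ⟨u, v, h, hu, hv⟩ ⟨u', v', h', hu', hv'⟩
        refine ⟨u + u', v + v', fun i => (S i).graph.add_mem (h i) (h' i), ?_, ?_⟩
        · simpa using hu.add hu'
        · simpa using hv.add hv'
      smul_mem' := by
        rintro c p ⟨u, v, h, hu, hv⟩
        refine ⟨c • u, c • v, fun i => (S i).graph.smul_mem c (h i), ?_, ?_⟩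
        · simpa using hu.const_smul c
        · simpa using hv.const_smul c }

end Abstract

/-! ### The spectral measure of a self-adjoint operator -/

section Spectral

variable {H : Type*} [NormedAddCommGroup H] [InnerProductSpace ℂ H] [CompleteSpace H]

variable (H) in
/-- A projection-valued measure on the Borel sets of the real line. -/
structure ProjMeasure where
  /-- The projection of a Borel set. -/
  proj : Set ℝ → H →L[ℂ] H
  isStarProjection : ∀ B, MeasurableSet B → IsStarProjection (proj B)
  univ : proj Set.univ = 1
  iUnion : ∀ B : ℕ → Set ℝ, (∀ i, MeasurableSet (B i)) → Pairwise (Function.onFun Disjoint B) →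
    ∀ h : H, HasSum (fun i => proj (B i) h) (proj (⋃ i, B i) h)

/-- The scalar measure `B ↦ (E(B) h, h)`. -/
def ProjMeasure.scalar (P : ProjMeasure H) (h : H) : Measure ℝ :=
  Measure.ofMeasurable (fun B _ => ENNReal.ofReal (⟪h, P.proj B h⟫_ℂ).re)
    (by
      have h1 := P.iUnion (fun _ => ∅) (fun _ => MeasurableSet.empty)
        (fun _ _ _ => by simp [Function.onFun]) h
      have h2 : P.proj ∅ h = 0 := tendsto_nhds_unique tendsto_const_nhds
        h1.summable.tendsto_atTop_zero
      simp [h2])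
    (by
      intro B hB hd
      have h1 := P.iUnion B hB hd h
      have h2 : HasSum (fun i => (⟪h, P.proj (B i) h⟫_ℂ).re) (⟪h, P.proj (⋃ i, B i) h⟫_ℂ).re :=
        ((Complex.reCLM.hasSum ((innerSL ℂ h).hasSum h1)))
      rw [← h2.tsum_eq, ENNReal.ofReal_tsum_of_nonneg _ h2.summable]
      intro i
      have hp := P.isStarProjection (B i) (hB i)
      have h3 : P.proj (B i) h = P.proj (B i) (P.proj (B i) h) := by
        conv_lhs => rw [← hp.isIdempotentElem.eq]
        rfl
      have h4 := (ContinuousLinearMap.isSelfAdjoint_iff_isSymmetric.mp hp.isSelfAdjoint) h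
        (P.proj (B i) h)
      simp only [ContinuousLinearMap.coe_coe] at h4
      rw [h3, ← h4]
      exact inner_self_nonneg (𝕜 := ℂ))

/-- `P` is the spectral measure of `T`, i.e. `T = ∫ l dP(l)`: the domain of `T` consists of the `h`
with `∫ l² d(P(l) h, h) < ∞`, and `(T h, h) = ∫ l d(P(l) h, h)` for those `h`. -/
structure IsSpectralMeasure (P : ProjMeasure H) (T : H →ₗ.[ℂ] H) : Prop where
  mem_domain : ∀ h : H, h ∈ T.domain ↔ ∫⁻ l, ENNReal.ofReal (l ^ 2) ∂(P.scalar h) < ∞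
  inner_apply : ∀ h : T.domain, ⟪(h : H), T h⟫_ℂ = ((∫ l, l ∂(P.scalar (h : H)) : ℝ) : ℂ)

open scoped Classical in
variable (H) in
/-- The spectral measure of the zero operator, used as a default value. -/
def diracProjMeasure : ProjMeasure H where
  proj B := if (0 : ℝ) ∈ B then 1 else 0
  isStarProjection B _ := by
    by_cases hB : (0 : ℝ) ∈ B
    · simp only [hB, if_true]; exact IsStarProjection.one _
    · simp only [hB, if_false]; exact IsStarProjection.zero _
  univ := by simp
  iUnion B _ hd h := by
    by_cases h0 : ∃ j, (0 : ℝ) ∈ B j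
    · obtain ⟨j, hj⟩ := h0
      have hU : (0 : ℝ) ∈ ⋃ i, B i := Set.mem_iUnion.mpr ⟨j, hj⟩
      have := hasSum_single (f := fun i => (if (0 : ℝ) ∈ B i then (1 : H →L[ℂ] H) else 0) h) j
        (fun i hij => by
          have : (0 : ℝ) ∉ B i := fun hi => Set.disjoint_left.mp (hd hij) hi hj
          simp [this])
      simpa [hj, hU] using this
    · have hU : (0 : ℝ) ∉ ⋃ i, B i := by simpa using h0
      have h0' : ∀ i, (0 : ℝ) ∉ B i := by simpa using h0
      simp [h0', hU]

open scoped Classical in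
/-- The spectral measure `E_T` of a self-adjoint operator `T`. -/
def spectralMeasure (T : H →ₗ.[ℂ] H) : ProjMeasure H :=
  if h : ∃ P, IsSpectralMeasure P T then h.choose else diracProjMeasure H

/-- The subspace `ran E_T([n, n + 1))`, `n = 0, 1, 2, …`. -/
def specSubspace (T : H →ₗ.[ℂ] H) (n : ℕ) : Submodule ℂ H :=
  LinearMap.range ((spectralMeasure T).proj (Set.Ico (n : ℝ) (n + 1))).toLinearMap

instance (T : H →ₗ.[ℂ] H) (n : ℕ) : CompleteSpace (specSubspace T n) := by
  have h := ((spectralMeasure T).isStarProjection (Set.Ico (n : ℝ) (n + 1))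
    measurableSet_Ico).isIdempotentElem
  exact (ContinuousLinearMap.IsIdempotentElem.isClosed_range h).completeSpace_coe

/-- The operator `T E_T([n, n + 1))`, considered in the Hilbert space `ran E_T([n, n + 1))`. -/
def specPart (T : H →ₗ.[ℂ] H) (n : ℕ) : specSubspace T n →ₗ.[ℂ] specSubspace T n :=
  part T (specSubspace T n)

end Spectral

/-! ### Vector-valued Sobolev spaces on the half-line -/

section Sobolev

set_option linter.unusedSectionVars false

variable (H : Type*) [NormedAddCommGroup H] [InnerProductSpace ℂ H]

/-- The Hilbert space `L²(ℝ₊, H)`. -/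
abbrev L2 : Type _ := Lp H 2 (volume.restrict (Set.Ioi (0 : ℝ)))

variable {H}

/-- `f` is (almost everywhere equal to) the locally absolutely continuous function on `[0, ∞)` with
derivative `g` and value `a` at `0`. -/
def HasL2Deriv (f g : L2 H) (a : H) : Prop :=
  ∀ᵐ x ∂(volume.restrict (Set.Ioi (0 : ℝ))), f x = a + ∫ t in (0 : ℝ)..x, g t

theorem intervalIntegrable_L2 (g : L2 H) {x : ℝ} (hx : 0 < x) :
    IntervalIntegrable g volume 0 x := by
  rw [intervalIntegrable_iff_integrableOn_Ioc_of_le hx.le]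
  have h1 : MemLp g 2 (volume.restrict (Set.Ioc 0 x)) :=
    (Lp.memLp g).mono_measure (Measure.restrict_mono Set.Ioc_subset_Ioi_self le_rfl)
  exact h1.integrable (by norm_num)

theorem HasL2Deriv.zero : HasL2Deriv (0 : L2 H) 0 0 := by
  filter_upwards [Lp.coeFn_zero H 2 (volume.restrict (Set.Ioi (0 : ℝ))),
    ae_restrict_mem measurableSet_Ioi] with x hx hx0
  have : ∫ t in (0 : ℝ)..x, (0 : L2 H) t = ∫ t in (0 : ℝ)..x, (0 : H) := by
    rw [intervalIntegral.integral_of_le (le_of_lt hx0),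
      intervalIntegral.integral_of_le (le_of_lt hx0)]
    exact integral_congr_ae (ae_restrict_of_ae_restrict_of_subset Set.Ioc_subset_Ioi_self
      (Lp.coeFn_zero H 2 _))
  rw [hx, this]; simp

theorem HasL2Deriv.add {f g f' g' : L2 H} {a a' : H} (h : HasL2Deriv f g a)
    (h' : HasL2Deriv f' g' a') : HasL2Deriv (f + f') (g + g') (a + a') := by
  filter_upwards [h, h', Lp.coeFn_add f f', ae_restrict_mem measurableSet_Ioi]
    with x hx hx' hadd hx0
  have : ∫ t in (0 : ℝ)..x, (g + g' : L2 H) t = ∫ t in (0 : ℝ)..x, (g t + g' t) := by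
    rw [intervalIntegral.integral_of_le (le_of_lt hx0),
      intervalIntegral.integral_of_le (le_of_lt hx0)]
    exact integral_congr_ae (ae_restrict_of_ae_restrict_of_subset Set.Ioc_subset_Ioi_self
      (Lp.coeFn_add g g'))
  rw [hadd, this, Pi.add_apply, hx, hx', intervalIntegral.integral_add
    (intervalIntegrable_L2 g hx0) (intervalIntegrable_L2 g' hx0)]
  abel

theorem HasL2Deriv.smul {f g : L2 H} {a : H} (c : ℂ) (h : HasL2Deriv f g a) :
    HasL2Deriv (c • f) (c • g) (c • a) := by
  filter_upwards [h, Lp.coeFn_smul c f, ae_restrict_mem measurableSet_Ioi] with x hx hsmul hx0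
  have : ∫ t in (0 : ℝ)..x, (c • g : L2 H) t = ∫ t in (0 : ℝ)..x, c • g t := by
    rw [intervalIntegral.integral_of_le (le_of_lt hx0),
      intervalIntegral.integral_of_le (le_of_lt hx0)]
    exact integral_congr_ae (ae_restrict_of_ae_restrict_of_subset Set.Ioc_subset_Ioi_self
      (Lp.coeFn_smul c g))
  rw [hsmul, this, Pi.smul_apply, hx, intervalIntegral.integral_smul, smul_add]

variable (H)

/-- The graph of `f ↦ f'` on `W^{1,2}(ℝ₊, H)`. -/
def derivGraph : Submodule ℂ (L2 H × L2 H) where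
  carrier := {p | ∃ a, HasL2Deriv p.1 p.2 a}
  zero_mem' := ⟨0, .zero⟩
  add_mem' := by rintro _ _ ⟨a, h⟩ ⟨b, h'⟩; exact ⟨_, h.add h'⟩
  smul_mem' := by rintro c _ ⟨a, h⟩; exact ⟨_, h.smul c⟩

/-- The graph of `f ↦ f(0)` on `W^{1,2}(ℝ₊, H)`. -/
def traceGraph : Submodule ℂ (L2 H × H) where
  carrier := {p | ∃ g, HasL2Deriv p.1 g p.2}
  zero_mem' := ⟨0, .zero⟩
  add_mem' := by rintro _ _ ⟨a, h⟩ ⟨b, h'⟩; exact ⟨_, h.add h'⟩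
  smul_mem' := by rintro c _ ⟨a, h⟩; exact ⟨_, h.smul c⟩

/-- `f ↦ f'` in `L²(ℝ₊, H)`, with domain `W^{1,2}(ℝ₊, H)`. -/
def deriv1 : L2 H →ₗ.[ℂ] L2 H := (derivGraph H).toLinearPMap

/-- `f ↦ f''` in `L²(ℝ₊, H)`, with domain `W^{2,2}(ℝ₊, H)`. -/
def deriv2 : L2 H →ₗ.[ℂ] L2 H :=
  Submodule.toLinearPMap
    { carrier := {p | ∃ h, (p.1, h) ∈ derivGraph H ∧ (h, p.2) ∈ derivGraph H}
      zero_mem' := ⟨0, (derivGraph H).zero_mem, (derivGraph H).zero_mem⟩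
      add_mem' := by
        rintro p q ⟨h, h1, h2⟩ ⟨k, k1, k2⟩
        exact ⟨h + k, (derivGraph H).add_mem h1 k1, (derivGraph H).add_mem h2 k2⟩
      smul_mem' := by
        rintro c p ⟨h, h1, h2⟩
        exact ⟨c • h, (derivGraph H).smul_mem c h1, (derivGraph H).smul_mem c h2⟩ }

/-- `f ↦ f(0)`, with domain `W^{1,2}(ℝ₊, H)`. -/
def trace0 : L2 H →ₗ.[ℂ] H := (traceGraph H).toLinearPMap

/-- `f ↦ f'(0)`, with domain `W^{2,2}(ℝ₊, H)`. -/
def trace1 : L2 H →ₗ.[ℂ] H :=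
  Submodule.toLinearPMap
    { carrier := {p | ∃ h, (p.1, h) ∈ derivGraph H ∧ (h, p.2) ∈ traceGraph H}
      zero_mem' := ⟨0, (derivGraph H).zero_mem, (traceGraph H).zero_mem⟩
      add_mem' := by
        rintro p q ⟨h, h1, h2⟩ ⟨k, k1, k2⟩
        exact ⟨h + k, (derivGraph H).add_mem h1 k1, (traceGraph H).add_mem h2 k2⟩
      smul_mem' := by
        rintro c p ⟨h, h1, h2⟩
        exact ⟨c • h, (derivGraph H).smul_mem c h1, (traceGraph H).smul_mem c h2⟩ }

variable {H}

/-- `f ↦ T f(·)` in `L²(ℝ₊, H)`, whose domain `L²(ℝ₊, H₁(T))` consists of the `f ∈ L²(ℝ₊, H)` with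
`f(x) ∈ dom T` for almost all `x` and `T f(·) ∈ L²(ℝ₊, H)`. -/
def potential (T : H →ₗ.[ℂ] H) : L2 H →ₗ.[ℂ] L2 H :=
  Submodule.toLinearPMap
    { carrier := {p | ∀ᵐ x ∂(volume.restrict (Set.Ioi (0 : ℝ))), (p.1 x, p.2 x) ∈ T.graph}
      zero_mem' := by
        change ∀ᵐ x ∂(volume.restrict (Set.Ioi (0 : ℝ))),
          ((0 : L2 H) x, (0 : L2 H) x) ∈ T.graph
        filter_upwards [Lp.coeFn_zero H 2 (volume.restrict (Set.Ioi (0 : ℝ)))] with x hx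
        rw [hx]; exact T.graph.zero_mem
      add_mem' := by
        intro p q hp hq
        change ∀ᵐ x ∂(volume.restrict (Set.Ioi (0 : ℝ))),
          ((p.1 + q.1 : L2 H) x, (p.2 + q.2 : L2 H) x) ∈ T.graph
        filter_upwards [hp, hq, Lp.coeFn_add p.1 q.1, Lp.coeFn_add p.2 q.2] with x h1 h2 h3 h4
        rw [h3, h4]; exact T.graph.add_mem h1 h2
      smul_mem' := by
        intro c p hp
        change ∀ᵐ x ∂(volume.restrict (Set.Ioi (0 : ℝ))),
          ((c • p.1 : L2 H) x, (c • p.2 : L2 H) x) ∈ T.graph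
        filter_upwards [hp, Lp.coeFn_smul c p.1, Lp.coeFn_smul c p.2] with x h1 h3 h4
        rw [h3, h4]; exact T.graph.smul_mem c h1 }

/-- `W^{1,2}_T(ℝ₊, H) = W^{1,2}(ℝ₊, H) ∩ L²(ℝ₊, H₁(T))`. -/
def W12 (T : H →ₗ.[ℂ] H) : Submodule ℂ (L2 H) := (deriv1 H).domain ⊓ (potential T).domain

/-- `W^{2,2}_T(ℝ₊, H) = W^{2,2}(ℝ₊, H) ∩ L²(ℝ₊, H₁(T))`. -/
def W22 (T : H →ₗ.[ℂ] H) : Submodule ℂ (L2 H) := (deriv2 H).domain ⊓ (potential T).domain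

/-- The norm of `W^{2,2}_T(ℝ₊, H)`, `‖f‖² = ∫ (‖f''‖² + ‖f‖² + ‖T f‖²) dx`. -/
def normW22 (T : H →ₗ.[ℂ] H) (f : W22 T) : ℝ :=
  √(‖deriv2 H ⟨f, f.2.1⟩‖ ^ 2 + ‖(f : L2 H)‖ ^ 2 + ‖potential T ⟨f, f.2.2⟩‖ ^ 2)

/-- The embedding of `L²(ℝ₊, K)` into `L²(ℝ₊, H)` for a subspace `K` of `H`. -/
def inclL2 (K : Submodule ℂ H) : L2 K →ₗᵢ[ℂ] L2 H where
  toLinearMap := (K.subtypeL.compLpL 2 (volume.restrict (Set.Ioi (0 : ℝ)))).toLinearMap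
  norm_map' f := by
    change ‖K.subtypeL.compLpL 2 (volume.restrict (Set.Ioi (0 : ℝ))) f‖ = ‖f‖
    rw [Lp.norm_def, Lp.norm_def]
    congr 1
    refine eLpNorm_congr_norm_ae ?_
    filter_upwards [K.subtypeL.coeFn_compLpL f] with x hx
    rw [hx]; rfl

end Sobolev

/-! ### The Sturm-Liouville operators generated by `-d²/dx² + T` -/

section Realizations

variable {H : Type*} [NormedAddCommGroup H] [InnerProductSpace ℂ H]

/-- The differential expression `-f'' + T f` on `W^{2,2}_T(ℝ₊, H)`. -/
def slExpr (T : H →ₗ.[ℂ] H) : L2 H →ₗ.[ℂ] L2 H := -deriv2 H + potential T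

/-- The linear span of the functions `φ(x) h`, where `φ` is a scalar function in `W^{2,2}(ℝ₊)` with
`φ(0) = φ'(0) = 0` and `h ∈ dom T`. -/
def coreD0 (T : H →ₗ.[ℂ] H) : Submodule ℂ (L2 H) :=
  Submodule.span ℂ {f | ∃ φ ∈ (deriv2 ℂ).domain ⊓ pker (trace0 ℂ) ⊓ pker (trace1 ℂ),
    ∃ h ∈ T.domain, ∀ᵐ x ∂(volume.restrict (Set.Ioi (0 : ℝ))), f x = φ x • h}

/-- The minimal operator: the closure of the restriction of `-d²/dx² + T` to `coreD0 T`. -/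
def minimalOp (T : H →ₗ.[ℂ] H) : L2 H →ₗ.[ℂ] L2 H :=
  ((slExpr T).domRestrict (coreD0 T)).closure

/-- `-d²/dx² + T` on `{f ∈ W^{2,2}_T(ℝ₊, H) : f(0) = f'(0) = 0}`. If `T` is bounded and everywhere
defined, then this domain is `{f ∈ W^{2,2}(ℝ₊, H) : f(0) = f'(0) = 0}`. -/
def minimalBdd (T : H →ₗ.[ℂ] H) : L2 H →ₗ.[ℂ] L2 H :=
  (slExpr T).domRestrict (pker (trace0 H) ⊓ pker (trace1 H))

/-- The Dirichlet realization: `-d²/dx² + T` on `{f ∈ W^{2,2}_T(ℝ₊, H) : f(0) = 0}`. -/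
def dirichlet (T : H →ₗ.[ℂ] H) : L2 H →ₗ.[ℂ] L2 H :=
  (slExpr T).domRestrict (pker (trace0 H))

/-- The realization `-d²/dx² + T` on `{f ∈ W^{2,2}_T(ℝ₊, H) : f'(0) = 0}`. -/
def neumann (T : H →ₗ.[ℂ] H) : L2 H →ₗ.[ℂ] L2 H :=
  (slExpr T).domRestrict (pker (trace1 H))

/-- The sesquilinear form `∫ ((k', f') + (S k, S f)) dx` on `W^{1,2}_S(ℝ₊, H)`. -/
def energyForm (S : H →ₗ.[ℂ] H) : W12 S →ₗ⋆[ℂ] W12 S →ₗ[ℂ] ℂ :=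
  LinearMap.mk₂'ₛₗ (starRingEnd ℂ) (RingHom.id ℂ)
    (fun k f => ⟪(deriv1 H) ⟨k, k.2.1⟩, (deriv1 H) ⟨f, f.2.1⟩⟫_ℂ +
      ⟪(potential S) ⟨k, k.2.2⟩, (potential S) ⟨f, f.2.2⟩⟫_ℂ)
    (fun k k' f => by
      have h1 := (deriv1 H).map_add ⟨k, k.2.1⟩ ⟨k', k'.2.1⟩
      have h2 := (potential S).map_add ⟨k, k.2.2⟩ ⟨k', k'.2.2⟩
      simp only [AddMemClass.mk_add_mk] at h1 h2
      simp only [Submodule.coe_add, h1, h2, inner_add_left]; ring)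
    (fun c k f => by
      have h1 := (deriv1 H).map_smul c ⟨k, k.2.1⟩
      have h2 := (potential S).map_smul c ⟨k, k.2.2⟩
      simp only [SetLike.mk_smul_mk] at h1 h2
      simp only [Submodule.coe_smul, h1, h2, inner_smul_left, smul_eq_mul]; ring)
    (fun k f f' => by
      have h1 := (deriv1 H).map_add ⟨f, f.2.1⟩ ⟨f', f'.2.1⟩
      have h2 := (potential S).map_add ⟨f, f.2.2⟩ ⟨f', f'.2.2⟩
      simp only [AddMemClass.mk_add_mk] at h1 h2
      simp only [Submodule.coe_add, h1, h2, inner_add_right]; ring)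
    (fun c k f => by
      have h1 := (deriv1 H).map_smul c ⟨f, f.2.1⟩
      have h2 := (potential S).map_smul c ⟨f, f.2.2⟩
      simp only [SetLike.mk_smul_mk] at h1 h2
      simp only [Submodule.coe_smul, h1, h2, inner_smul_right, smul_eq_mul, RingHom.id_apply]
      ring)

/-- The operator `A^N` associated with the form `∫ (‖f'‖² + ‖√T f‖²) dx` on
`W^{1,2}_{√T}(ℝ₊, H)`. -/
def neumannOp [CompleteSpace H] (T : H →ₗ.[ℂ] H) : L2 H →ₗ.[ℂ] L2 H :=
  formOperator (W12 (opSqrt T)) (energyForm (opSqrt T))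

end Realizations

end SturmLiouville

end

open SturmLiouville

open MeasureTheory Filter Topology Set
open scoped InnerProductSpace ENNReal

noncomputable section

namespace SturmLiouville


/-! ### Self-adjoint operators through their graphs -/

section Graphs

variable {E : Type*} [NormedAddCommGroup E] [InnerProductSpace ℂ E]

/-! The spectral projections of `T` onto the intervals [n, n+1) split `T` into bounded nonnegative
operators, and every operator in the statement is the orthogonal sum of its analogues with bounded
coefficient (`IsBddDecomposition`). Membership in the graph of an orthogonal sum is tested
componentwise (`mem_graph_directSum`), so the work lies in the bounded case and in the passage to
the sum.

Bounded coefficient R. The derivative with f(0) = 0 and the derivative without boundary condition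
are, up to sign, adjoint to each other, and 1 + G*G is onto for every closed G (von Neumann,
`exists_mem_adjoint`). This makes the Dirichlet and Neumann operators self-adjoint for R = 0, and a
general R is a bounded perturbation. With ρ = √R and Lf = f' + ρf, the operator L*L is a nonnegative
self-adjoint extension of the minimal operator; it is the Krein extension.

Extremality. Friedrichs and Krein extensions are both recognized by an approximation property,
`IsFormCore`. An extension B of A is the Friedrichs extension if each u in dom B is approximated by
w in dom A in norm and in the form of B; it is the Krein extension if A w approximates B u and the
form of u - w is small (`friedrichs_eq_of_isFormCore`, `isKreinExtension_of_isFormCore`). The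
property passes to orthogonal sums (`isFormCore_directSum`), so unbounded `T` needs no separate
argument. In the Krein case it says that the pairs (Lw, L*Lw) are dense in the graph of L*
(`mem_closure_factorCore`).

Gluing. If f(0) = 0 or f'(0) = 0, integration by parts gives Re(-f'', Rf) = Re(f', Rf') ≥ 0, hence
‖f''‖² + ‖Rf‖² ≤ ‖-f'' + Rf‖². No constant depends on R, so the derivatives of the components are
square summable and assemble to a function in the domain (`IsBddDecomposition.exists_hasSL`). The
same sign gives the lower graph norm estimate; the upper one is elementary, and the domains are
closed because self-adjoint operators have closed graphs.

The Neumann form. The Neumann realization is contained in the operator of the energy form, which is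
symmetric; a self-adjoint operator has no proper symmetric extension, so the two agree
(`formOperator_energyForm_eq`).

The splitting of `T` uses the spectral theorem, derived here from the continuous functional calculus
of (1 + T)⁻¹ and Riesz-Markov measures. Only the defining properties of the spectral measure and of
√T enter, and Krein extensions are unique, so the choices in the definitions do no harm. -/

/-- `(v, y) = (u, z)` for all `(u, v)`, `(y, z)` in the graph of `A`. -/
def IsSymm (A : E →ₗ.[ℂ] E) : Prop :=
  ∀ ⦃u v y z : E⦄, (u, v) ∈ A.graph → (y, z) ∈ A.graph → ⟪v, y⟫_ℂ = ⟪u, z⟫_ℂ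

theorem IsSymm.mono {A B : E →ₗ.[ℂ] E} (h : A ≤ B) (hB : IsSymm B) : IsSymm A :=
  fun _ _ _ _ h1 h2 => hB (LinearPMap.le_graph_of_le h h1) (LinearPMap.le_graph_of_le h h2)

theorem isNonneg_iff_graph {A : E →ₗ.[ℂ] E} :
    IsNonneg A ↔ ∀ u v : E, (u, v) ∈ A.graph → 0 ≤ (⟪u, v⟫_ℂ).re := by
  refine ⟨fun h u v huv => ?_, fun h u => h _ _ (A.mem_graph u)⟩
  obtain ⟨w, rfl, rfl⟩ := A.mem_graph_iff.mp huv
  exact h w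

theorem IsNonneg.mono {A B : E →ₗ.[ℂ] E} (h : A ≤ B) (hB : IsNonneg B) : IsNonneg A :=
  isNonneg_iff_graph.mpr fun u v huv =>
    isNonneg_iff_graph.mp hB u v (LinearPMap.le_graph_of_le h huv)

theorem mem_graph_domRestrict {F : Type*} [AddCommGroup F] [Module ℂ F] {A : E →ₗ.[ℂ] F}
    {D : Submodule ℂ E} {u : E} {v : F} :
    (u, v) ∈ (A.domRestrict D).graph ↔ u ∈ D ∧ (u, v) ∈ A.graph := by
  simp only [LinearPMap.mem_graph_iff]
  constructor
  · rintro ⟨y, rfl, rfl⟩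
    exact ⟨y.2.1, ⟨y, y.2.2⟩, rfl, (LinearPMap.domRestrict_apply rfl).symm⟩
  · rintro ⟨hu, y, rfl, rfl⟩
    exact ⟨⟨y, hu, y.2⟩, rfl, LinearPMap.domRestrict_apply rfl⟩

/-- The Cauchy-Schwarz inequality for the form of a nonnegative symmetric operator. -/
theorem IsNonneg.sq_re_inner_le {A : E →ₗ.[ℂ] E} (hA : IsNonneg A) (hs : IsSymm A)
    {u v y z : E} (h1 : (u, v) ∈ A.graph) (h2 : (y, z) ∈ A.graph) :
    (⟪u, z⟫_ℂ).re ^ 2 ≤ (⟪u, v⟫_ℂ).re * (⟪y, z⟫_ℂ).re := by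
  have key : ∀ t : ℝ, 0 ≤ (⟪u, v⟫_ℂ).re * (t * t) + (2 * (⟪u, z⟫_ℂ).re) * t + (⟪y, z⟫_ℂ).re := by
    intro t
    have h3 := isNonneg_iff_graph.mp hA _ _
      (A.graph.add_mem (A.graph.smul_mem (t : ℂ) h1) h2)
    have h4 : (⟪y, v⟫_ℂ).re = (⟪u, z⟫_ℂ).re := by
      rw [← hs h1 h2, ← inner_conj_symm, Complex.conj_re]
    simp only [Prod.smul_mk, inner_add_left, inner_add_right, inner_smul_left, inner_smul_right,
      Complex.conj_ofReal, Complex.add_re, Complex.re_ofReal_mul, h4] at h3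
    linarith
  have := discrim_le_zero key
  rw [discrim] at this
  nlinarith

/-- Pairing (A + x)u = g with u gives x‖u‖² ≤ Re(u, g). This bounds the inverse of A + x by 1/x. -/
theorem norm_le_of_mem_graph {A : E →ₗ.[ℂ] E} (hA : IsNonneg A) {x : ℝ} {u g : E}
    (h : (u, g - (x : ℂ) • u) ∈ A.graph) : x * ‖u‖ ≤ ‖g‖ := by
  have h1 := isNonneg_iff_graph.mp hA _ _ h
  rw [inner_sub_right, inner_smul_right, Complex.sub_re, Complex.re_ofReal_mul,
    show (⟪u, u⟫_ℂ).re = ‖u‖ ^ 2 from inner_self_eq_norm_sq (𝕜 := ℂ) u] at h1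
  have h2 : (⟪u, g⟫_ℂ).re ≤ ‖u‖ * ‖g‖ := re_inner_le_norm (𝕜 := ℂ) u g
  rcases (norm_nonneg u).eq_or_lt with h0 | h0
  · rw [← h0]; simp
  · nlinarith

/-- The graph of `A` is dense in the graph of `B` with respect to the form `(B u, u)` together with
the seminorm `‖a u + b B u‖`. -/
def IsFormCore (a b : ℂ) (A B : E →ₗ.[ℂ] E) : Prop :=
  ∀ ⦃u v : E⦄, (u, v) ∈ B.graph → ∀ ε : ℝ, 0 < ε → ∃ w z, (w, z) ∈ A.graph ∧
    ‖a • (u - w) + b • (v - z)‖ < ε ∧ (⟪u - w, v - z⟫_ℂ).re < ε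

theorem IsFormCore.exists_seq {a b : ℂ} {A B : E →ₗ.[ℂ] E} (h : IsFormCore a b A B) (hAB : A ≤ B)
    (hB : IsNonneg B) {u v : E} (huv : (u, v) ∈ B.graph) :
    ∃ w z : ℕ → E, (∀ n, (w n, z n) ∈ A.graph) ∧
      Tendsto (fun n => a • (u - w n) + b • (v - z n)) atTop (𝓝 0) ∧
      Tendsto (fun n => (⟪u - w n, v - z n⟫_ℂ).re) atTop (𝓝 0) := by
  choose w z hwz h1 h2 using fun n : ℕ => h huv (1 / ((n : ℝ) + 1)) Nat.one_div_pos_of_nat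
  refine ⟨w, z, hwz, ?_, ?_⟩
  · exact squeeze_zero_norm (fun n => (h1 n).le) tendsto_one_div_add_atTop_nhds_zero_nat
  · refine squeeze_zero (fun n => ?_) (fun n => (h2 n).le) tendsto_one_div_add_atTop_nhds_zero_nat
    exact isNonneg_iff_graph.mp hB _ _
      (B.graph.sub_mem huv (LinearPMap.le_graph_of_le hAB (hwz n)))

/-- Parallelogram identity, with the nonnegative form of the difference dropped. -/
theorem IsNonneg.re_inner_add_le {A : E →ₗ.[ℂ] E} (hA : IsNonneg A) {u v y z : E}
    (h1 : (u, v) ∈ A.graph) (h2 : (y, z) ∈ A.graph) :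
    (⟪u + y, v + z⟫_ℂ).re ≤ 2 * (⟪u, v⟫_ℂ).re + 2 * (⟪y, z⟫_ℂ).re := by
  have h := isNonneg_iff_graph.mp hA _ _ (A.graph.sub_mem h1 h2)
  simp only [inner_sub_left, inner_sub_right,
    inner_add_left, inner_add_right, Complex.add_re, Complex.sub_re] at h ⊢
  linarith

/-- The approximating sequence is Cauchy in the form, because w m - w n is the difference of the two
errors u - w n and u - w m, whose forms tend to 0. -/
theorem inFormDomain_of_isFormCore {A B : E →ₗ.[ℂ] E} (hAB : A ≤ B) (hB : IsNonneg B)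
    (h : IsFormCore 1 0 A B) {u : E} (hu : u ∈ B.domain) : InFormDomain A u := by
  have hg := B.mem_graph ⟨u, hu⟩
  obtain ⟨w, z, hwz, h1, h2⟩ := h.exists_seq hAB hB hg
  simp only [zero_smul, one_smul, add_zero] at h1
  set v := B ⟨u, hu⟩
  have hw : ∀ n, ∃ y : A.domain, (y : E) = w n ∧ A y = z n := fun n => A.mem_graph_iff.mp (hwz n)
  choose y hy1 hy2 using hw
  refine ⟨y, ?_, ?_⟩
  · have := (tendsto_const_nhds (x := u)).sub h1
    simpa [hy1] using this
  · have l1 := (h2.comp (tendsto_fst (g := (atTop : Filter ℕ)))).const_mul 2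
    have l2 := (h2.comp (tendsto_snd (f := (atTop : Filter ℕ)))).const_mul 2
    have l3 := l1.add l2
    rw [mul_zero, add_zero, prod_atTop_atTop_eq] at l3
    refine squeeze_zero (fun p => (hB.mono hAB) _) (fun p => ?_) l3
    have hd : ∀ n, (u - w n, v - z n) ∈ B.graph := fun n =>
      B.graph.sub_mem hg (LinearPMap.le_graph_of_le hAB (hwz n))
    obtain ⟨d1, e1, f1⟩ := B.mem_graph_iff.mp (hd p.1)
    obtain ⟨d2, e2, f2⟩ := B.mem_graph_iff.mp (hd p.2)
    have q := hB.quad_add_le d1 (-d2)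
    rw [B.map_add, B.map_neg] at q
    simp only [Submodule.coe_add, Submodule.coe_neg, e1, e2, f1, f2, inner_neg_neg] at q
    rw [A.map_sub, hy2, hy2]
    simp only [Submodule.coe_sub, hy1, Function.comp]
    convert q using 1
    -- The difference of the errors is the negative of the wanted difference; the form is even.
    rw [← inner_neg_neg]
    congr 2 <;> abel

variable [CompleteSpace E]

theorem mem_adjoint_graph_iff {A : E →ₗ.[ℂ] E} (hA : Dense (A.domain : Set E)) {y z : E} :
    (y, z) ∈ A.adjoint.graph ↔ ∀ u v, (u, v) ∈ A.graph → ⟪v, y⟫_ℂ = ⟪u, z⟫_ℂ := by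
  rw [LinearPMap.adjoint_graph_eq_graph_adjoint hA, Submodule.mem_adjoint_iff]
  simp [sub_eq_zero]

theorem isSymm_of_isSelfAdjoint {A : E →ₗ.[ℂ] E} (hA : IsSelfAdjoint A) : IsSymm A := by
  intro u v y z h1 h2
  rw [← LinearPMap.isSelfAdjoint_def.mp hA, mem_adjoint_graph_iff hA.dense_domain] at h2
  exact h2 u v h1

theorem mem_graph_of_isSelfAdjoint {A : E →ₗ.[ℂ] E} (hA : IsSelfAdjoint A) {y z : E}
    (h : ∀ u v, (u, v) ∈ A.graph → ⟪v, y⟫_ℂ = ⟪u, z⟫_ℂ) : (y, z) ∈ A.graph := by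
  rw [← LinearPMap.isSelfAdjoint_def.mp hA, mem_adjoint_graph_iff hA.dense_domain]
  exact h

theorem isSelfAdjoint_of_isSymm {A : E →ₗ.[ℂ] E} (hd : Dense (A.domain : Set E)) (hs : IsSymm A)
    (hm : ∀ y z, (∀ u v, (u, v) ∈ A.graph → ⟪v, y⟫_ℂ = ⟪u, z⟫_ℂ) → (y, z) ∈ A.graph) :
    IsSelfAdjoint A := by
  rw [LinearPMap.isSelfAdjoint_def]
  refine LinearPMap.eq_of_eq_graph ?_
  ext ⟨y, z⟩
  rw [mem_adjoint_graph_iff hd]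
  exact ⟨hm y z, fun h u v huv => hs huv h⟩

/-- A symmetric operator `A` such that `A + 1` is onto is self-adjoint. -/
theorem isSelfAdjoint_of_surjective {A : E →ₗ.[ℂ] E} (hs : IsSymm A)
    (hr : ∀ g, ∃ u, (u, g - u) ∈ A.graph) : IsSelfAdjoint A := by
  refine isSelfAdjoint_of_isSymm ?_ hs ?_
  · rw [Submodule.dense_iff_topologicalClosure_eq_top,
      Submodule.topologicalClosure_eq_top_iff, Submodule.eq_bot_iff]
    intro g hg
    obtain ⟨u, hu⟩ := hr g
    -- Here g is orthogonal to the domain and (A + 1)u = g. With (A + 1)w = u, symmetry turns (u, u)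
    -- into (g, w) = 0.
    have : u = 0 := by
      rw [← inner_self_eq_zero (𝕜 := ℂ)]
      obtain ⟨w, hw⟩ := hr u
      have h1 := hs hu hw
      have h2 : ⟪w, g⟫_ℂ = 0 := hg w (LinearPMap.mem_domain_of_mem_graph hw)
      have h3 : ⟪g, w⟫_ℂ = 0 := by rw [← inner_conj_symm, h2, map_zero]
      rw [inner_sub_left, inner_sub_right, h3] at h1
      linear_combination -h1
    rw [this, sub_zero] at hu
    exact A.graph_fst_eq_zero_snd hu rfl
  · intro y z h
    obtain ⟨u, hu⟩ := hr (y + z)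
    have : y = u := by
      -- The difference y - u is orthogonal to the range of A + 1, which is everything; test with
      -- the preimage w of y - u itself.
      rw [← sub_eq_zero, ← inner_self_eq_zero (𝕜 := ℂ)]
      obtain ⟨w, hw⟩ := hr (y - u)
      have h1 := h _ _ hw
      have h2 := hs hw hu
      simp only [inner_sub_left, inner_sub_right, inner_add_right] at h1 h2 ⊢
      linear_combination h1 - h2
    subst this
    simpa using hu

/-- A self-adjoint operator has no proper symmetric extension. -/
theorem eq_of_le_of_isSymm {A B : E →ₗ.[ℂ] E} (hA : IsSelfAdjoint A) (h : A ≤ B) (hB : IsSymm B) :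
    B = A := by
  refine le_antisymm (LinearPMap.le_of_le_graph ?_) h
  rintro ⟨y, z⟩ hy
  exact mem_graph_of_isSelfAdjoint hA fun u v huv => hB (LinearPMap.le_graph_of_le h huv) hy

theorem isClosed_graph_of_isSelfAdjoint {A : E →ₗ.[ℂ] E} (hA : IsSelfAdjoint A) :
    IsClosed (A.graph : Set (E × E)) := hA.isClosed

/-- If `A = A* ≥ 0` and `x > 0`, then `A + x` is onto. -/
theorem exists_resolvent {A : E →ₗ.[ℂ] E} (hA : IsSelfAdjoint A) (h0 : IsNonneg A) {x : ℝ}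
    (hx : 0 < x) (g : E) : ∃ u, (u, g - (x : ℂ) • u) ∈ A.graph := by
  let R : Submodule ℂ E := A.graph.map
    (LinearMap.snd ℂ E E + (x : ℂ) • LinearMap.fst ℂ E E)
  have memR : ∀ g, g ∈ R ↔ ∃ u, (u, g - (x : ℂ) • u) ∈ A.graph := by
    intro g
    constructor
    · rintro ⟨⟨u, v⟩, h, rfl⟩
      exact ⟨u, by simpa using h⟩
    · rintro ⟨u, hu⟩
      exact ⟨_, hu, by simp⟩
  -- The range is closed: by `norm_le_of_mem_graph`, convergent images have Cauchy preimages, and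
  -- the graph is closed.
  have hcl : IsClosed (R : Set E) := by
    refine isClosed_of_closure_subset fun g hg => ?_
    obtain ⟨s, hs, hsg⟩ := mem_closure_iff_seq_limit.mp hg
    choose u hu using fun n => (memR (s n)).mp (hs n)
    have hc : CauchySeq u := by
      rw [Metric.cauchySeq_iff]
      intro ε hε
      obtain ⟨N, hN⟩ := Metric.cauchySeq_iff.mp hsg.cauchySeq (x * ε) (by positivity)
      refine ⟨N, fun m hm n hn => ?_⟩
      have h1 := A.graph.sub_mem (hu m) (hu n)
      have h2 : (u m - u n, (s m - s n) - (x : ℂ) • (u m - u n)) ∈ A.graph := by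
        convert h1 using 1
        simp only [Prod.mk_sub_mk, smul_sub]; congr 1; abel
      have h3 := norm_le_of_mem_graph h0 h2
      have h4 := hN m hm n hn
      rw [dist_eq_norm] at h4 ⊢
      exact lt_of_mul_lt_mul_left (h3.trans_lt h4) hx.le
    obtain ⟨w, hw⟩ := cauchySeq_tendsto_of_complete hc
    refine (memR g).mpr ⟨w, ?_⟩
    refine (isClosed_graph_of_isSelfAdjoint hA).mem_of_tendsto
      (hw.prodMk_nhds (hsg.sub (hw.const_smul (x : ℂ)))) (Eventually.of_forall hu)
  have : CompleteSpace R := hcl.completeSpace_coe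
  -- A vector orthogonal to the range satisfies A y = -x y, and the same bound with g = 0 gives y =
  -- 0.
  have htop : R = ⊤ := by
    rw [← Submodule.orthogonal_eq_bot_iff, Submodule.eq_bot_iff]
    intro y hy
    have h1 : (y, (0 : E) - (x : ℂ) • y) ∈ A.graph := by
      refine mem_graph_of_isSelfAdjoint hA fun u v huv => ?_
      have h2 : ⟪v + (x : ℂ) • u, y⟫_ℂ = 0 := hy _ ((memR _).mpr ⟨u, by simpa using huv⟩)
      rw [inner_add_left, inner_smul_left, Complex.conj_ofReal] at h2
      rw [zero_sub, inner_neg_right, inner_smul_right]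
      linear_combination h2
    have h2 := norm_le_of_mem_graph h0 h1
    rw [norm_zero] at h2
    have h3 : ‖y‖ ≤ 0 := by nlinarith [norm_nonneg y]
    simpa using h3
  exact (memR g).mp (htop ▸ Submodule.mem_top)

/-- For a closed linear relation `G` every `g` is of the form `g = u + w` with `(u, v) ∈ G` and
`(v, w) ∈ G*`. -/
theorem exists_mem_adjoint {F : Type*} [NormedAddCommGroup F] [InnerProductSpace ℂ F]
    [CompleteSpace F] (G : Submodule ℂ (E × F)) (hG : IsClosed (G : Set (E × F))) (g : E) :
    ∃ u v, (u, v) ∈ G ∧ (v, g - u) ∈ G.adjoint := by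
  let G' : Submodule ℂ (WithLp 2 (E × F)) := G.comap (WithLp.linearEquiv 2 ℂ (E × F)).toLinearMap
  have hG' : IsClosed (G' : Set (WithLp 2 (E × F))) :=
    hG.preimage (WithLp.prod_continuous_ofLp 2 E F)
  have : CompleteSpace G' := hG'.completeSpace_coe
  -- Let (u, v) be the orthogonal projection of (g, 0) onto G. The remainder (g - u, -v) is
  -- orthogonal to G, which says that (v, g - u) lies in the adjoint relation.
  let p : WithLp 2 (E × F) := WithLp.toLp 2 (g, 0)
  have h1 : G'.starProjection p ∈ G' := Submodule.starProjection_apply_mem _ _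
  have h2 : p - G'.starProjection p ∈ G'ᗮ := Submodule.sub_starProjection_mem_orthogonal p
  refine ⟨(G'.starProjection p).fst, (G'.starProjection p).snd, h1, ?_⟩
  rw [Submodule.mem_adjoint_iff]
  intro a b hab
  have h3 := h2 (WithLp.toLp 2 (a, b)) hab
  rw [WithLp.prod_inner_apply] at h3
  simp only [p, WithLp.ofLp_sub, Prod.fst_sub, Prod.snd_sub, WithLp.ofLp_fst, WithLp.ofLp_snd] at h3
  simp only [zero_sub, inner_neg_right] at h3
  linear_combination -h3

/-! ### Friedrichs and Krein extensions -/

/-- A criterion for the Krein extension: if every `u ∈ dom B` is a limit of `w ∈ dom A` in the sense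
that `A w → B u` and `(B (u - w), u - w) → 0`, then `B` is the Krein extension of `A`. -/
theorem isKreinExtension_of_isFormCore {A B : E →ₗ.[ℂ] E} (hAB : IsNonnegSAExtension A B)
    (h : IsFormCore 0 1 A B) : IsKreinExtension A B where
  toIsNonnegSAExtension := hAB
  smallest := by
    intro C hC x hx g u v hu hv
    have hBs := isSymm_of_isSelfAdjoint hAB.selfAdjoint
    obtain ⟨w, z, hwz, h1, h2⟩ := h.exists_seq hAB.le hAB.nonneg hu
    set b := g - (x : ℂ) • u with hb
    set c := g - (x : ℂ) • v with hc
    simp only [zero_smul, one_smul, zero_add] at h1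
    have hz : Tendsto z atTop (𝓝 b) := by
      have := (tendsto_const_nhds (x := b)).sub h1
      simpa using this
    -- Cauchy-Schwarz for the form of C, applied to v and w n in dom A. On dom A the forms of B and
    -- C coincide, and the form of w n tends to that of u.
    have key : (⟪v, b⟫_ℂ).re ^ 2 ≤ (⟪v, c⟫_ℂ).re * (⟪u, b⟫_ℂ).re := by
      have l1 : Tendsto (fun n => (⟪v, z n⟫_ℂ).re ^ 2) atTop (𝓝 ((⟪v, b⟫_ℂ).re ^ 2)) :=
        ((Complex.continuous_re.tendsto _).comp (tendsto_const_nhds.inner hz)).pow 2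
      have l2 : Tendsto (fun n => (⟪w n, z n⟫_ℂ).re) atTop (𝓝 (⟪u, b⟫_ℂ).re) := by
        have l3 : Tendsto (fun n => (⟪u, z n⟫_ℂ).re) atTop (𝓝 (⟪u, b⟫_ℂ).re) :=
          (Complex.continuous_re.tendsto _).comp (tendsto_const_nhds.inner hz)
        have l4 := (h2.sub_const (⟪u, b⟫_ℂ).re).add (l3.const_mul 2)
        rw [show 0 - (⟪u, b⟫_ℂ).re + 2 * (⟪u, b⟫_ℂ).re = (⟪u, b⟫_ℂ).re by ring] at l4
        refine l4.congr fun n => ?_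
        have l5 : (⟪w n, b⟫_ℂ).re = (⟪u, z n⟫_ℂ).re := by
          rw [← hBs (LinearPMap.le_graph_of_le hAB.le (hwz n)) hu, ← inner_conj_symm,
            Complex.conj_re]
        simp only [inner_sub_left, inner_sub_right, Complex.sub_re, l5]
        ring
      refine le_of_tendsto_of_tendsto' l1 (l2.const_mul _) fun n => ?_
      exact hC.nonneg.sq_re_inner_le (isSymm_of_isSelfAdjoint hC.selfAdjoint) hv
        (LinearPMap.le_graph_of_le hC.le (hwz n))
    have p0 : 0 ≤ (⟪v, c⟫_ℂ).re := isNonneg_iff_graph.mp hC.nonneg _ _ hv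
    have q0 : 0 ≤ (⟪u, b⟫_ℂ).re := isNonneg_iff_graph.mp hAB.nonneg _ _ hu
    have e1 : (⟪v, g⟫_ℂ).re = (⟪v, c⟫_ℂ).re + x * ‖v‖ ^ 2 := by
      rw [show g = c + (x : ℂ) • v by rw [hc]; abel, inner_add_right, inner_smul_right,
        Complex.add_re, Complex.re_ofReal_mul,
        show (⟪v, v⟫_ℂ).re = ‖v‖ ^ 2 from inner_self_eq_norm_sq (𝕜 := ℂ) v]
    have e2 : (⟪u, g⟫_ℂ).re = (⟪u, b⟫_ℂ).re + x * ‖u‖ ^ 2 := by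
      rw [show g = b + (x : ℂ) • u by rw [hb]; abel, inner_add_right, inner_smul_right,
        Complex.add_re, Complex.re_ofReal_mul,
        show (⟪u, u⟫_ℂ).re = ‖u‖ ^ 2 from inner_self_eq_norm_sq (𝕜 := ℂ) u]
    have e3 : (⟪v, g⟫_ℂ).re = (⟪v, b⟫_ℂ).re + x * (⟪v, u⟫_ℂ).re := by
      rw [show g = b + (x : ℂ) • u by rw [hb]; abel, inner_add_right, inner_smul_right,
        Complex.add_re, Complex.re_ofReal_mul]
    have e4 : (⟪v, u⟫_ℂ).re ≤ ‖v‖ * ‖u‖ := re_inner_le_norm (𝕜 := ℂ) v u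
    have e5 : 2 * (⟪v, b⟫_ℂ).re ≤ (⟪v, c⟫_ℂ).re + (⟪u, b⟫_ℂ).re := by
      refine abs_le_of_sq_le_sq' ?_ (by positivity) |>.2
      nlinarith [sq_nonneg ((⟪v, c⟫_ℂ).re - (⟪u, b⟫_ℂ).re)]
    -- Adding 2Re(v, b) ≤ Re(v, c) + Re(u, b) and 2x Re(v, u) ≤ x‖v‖² + x‖u‖² gives 2Re(v, g) ≤
    -- Re(v, g) + Re(u, g).
    nlinarith [mul_nonneg hx.le (sq_nonneg (‖v‖ - ‖u‖)), mul_le_mul_of_nonneg_left e4 hx.le]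

/-- Minimality in both directions makes the quadratic forms of the two resolvents at x = 1 equal;
polarization then identifies the resolvents. -/
theorem IsKreinExtension.le_of {A B C : E →ₗ.[ℂ] E} (hB : IsKreinExtension A B)
    (hC : IsKreinExtension A C) : B ≤ C := by
  refine LinearPMap.le_of_le_graph ?_
  rintro ⟨u, b⟩ hu
  have key : ∀ g u v, (u, g - u) ∈ B.graph → (v, g - v) ∈ C.graph →
      (⟪u - v, g⟫_ℂ).re = 0 := by
    intro g u v h1 h2
    have h3 := hB.smallest C hC.toIsNonnegSAExtension 1 one_pos g u v (by simpa using h1)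
      (by simpa using h2)
    have h4 := hC.smallest B hB.toIsNonnegSAExtension 1 one_pos g v u (by simpa using h2)
      (by simpa using h1)
    rw [inner_sub_left, Complex.sub_re]
    linarith
  have hBs := isSymm_of_isSelfAdjoint hB.selfAdjoint
  have hCs := isSymm_of_isSelfAdjoint hC.selfAdjoint
  obtain ⟨v, hv⟩ := exists_resolvent hC.selfAdjoint hC.nonneg one_pos (u + b)
  obtain ⟨u', hu'⟩ := exists_resolvent hB.selfAdjoint hB.nonneg one_pos (u - v)
  obtain ⟨v', hv'⟩ := exists_resolvent hC.selfAdjoint hC.nonneg one_pos (u - v)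
  simp only [Complex.ofReal_one, one_smul] at hv hu' hv'
  have hu1 : (u, u + b - u) ∈ B.graph := by simpa using hu
  have k1 := key _ _ _ hu1 hv
  have k2 := key _ _ _ hu' hv'
  -- If D is the difference of the resolvents, then u - v = D(u + b). Polarizing at u + b and u - v
  -- yields Re(D(u + b), u - v) = 0, that is, ‖u - v‖² = 0.
  have k3 := key (u + b + (u - v)) (u + u') (v + v')
    (by convert B.graph.add_mem hu1 hu' using 1; ext <;> simp; abel)
    (by convert C.graph.add_mem hv hv' using 1; ext <;> simp; abel)
  have s1 := congrArg Complex.re (hBs hu1 hu')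
  have s2 := congrArg Complex.re (hCs hv hv')
  have c : ∀ x y : E, (⟪x, y⟫_ℂ).re = (⟪y, x⟫_ℂ).re := fun x y => by
    rw [← inner_conj_symm, Complex.conj_re]
  have h0 : (⟪u - v, u - v⟫_ℂ).re = 0 := by
    simp only [inner_sub_left, inner_sub_right, inner_add_left, inner_add_right, Complex.sub_re,
      Complex.add_re] at k1 k2 k3 s1 s2 ⊢
    linarith [c u u', c v v', c b u', c v u, c u v', c b v', c v u', c v' u]
  have h1 : ‖u - v‖ ^ 2 = 0 := by rw [← h0]; exact (inner_self_eq_norm_sq (𝕜 := ℂ) (u - v)).symm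
  have h2 : u = v := by simpa [sub_eq_zero] using h1
  subst h2
  simpa using hv

/-- Uniqueness makes the choice in `krein` immaterial. -/
theorem krein_eq {A B : E →ₗ.[ℂ] E} (h : IsKreinExtension A B) : krein A = B := by
  have h' : ∃ B, IsKreinExtension A B := ⟨B, h⟩
  rw [krein, dif_pos h']
  exact le_antisymm (h'.choose_spec.le_of h) (h.le_of h'.choose_spec)

/-- A criterion for the Friedrichs extension. -/
theorem friedrichs_eq_of_isFormCore {A B : E →ₗ.[ℂ] E} (hAB : IsNonnegSAExtension A B)
    (h : IsFormCore 1 0 A B) : friedrichs A = B := by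
  have hdom : ∀ u ∈ B.domain, InFormDomain A u := fun u hu =>
    inFormDomain_of_isFormCore hAB.le hAB.nonneg h hu
  have hA0 := hAB.nonneg.mono hAB.le
  have hBs := isSymm_of_isSelfAdjoint hAB.selfAdjoint
  have hd : Dense (A.domain : Set E) := by
    refine dense_closure.mp (hAB.selfAdjoint.dense_domain.mono fun u hu => ?_)
    obtain ⟨w, hw, -⟩ := hdom u hu
    exact mem_closure_of_tendsto hw (Eventually.of_forall fun n => (w n).2)
  have hle : ∀ u v, (u, v) ∈ B.graph → (u, v) ∈ A.adjoint.graph := fun u v huv =>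
    (mem_adjoint_graph_iff hd).mpr fun _ _ hy => hBs (LinearPMap.le_graph_of_le hAB.le hy) huv
  refine LinearPMap.eq_of_eq_graph ?_
  ext ⟨f, g⟩
  rw [friedrichs, mem_graph_domRestrict, mem_formDomain_iff hA0]
  refine ⟨?_, fun hf => ⟨hdom f (LinearPMap.mem_domain_of_mem_graph hf), hle f g hf⟩⟩
  rintro ⟨hf, hfg⟩
  obtain ⟨u, hu⟩ := exists_resolvent hAB.selfAdjoint hAB.nonneg one_pos (f + g)
  simp only [Complex.ofReal_one, one_smul] at hu
  -- With (B + 1)u = f + g, the difference d = f - u satisfies A* d = -d and lies in the domain of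
  -- the closed form of A. It remains to see that such d vanish.
  suffices hfu : f = u by
    subst hfu
    simpa using hu
  have hd1 : (f - u, -(f - u)) ∈ A.adjoint.graph := by
    convert A.adjoint.graph.sub_mem hfg (hle _ _ hu) using 1
    ext <;> simp; abel
  have hd2 : InFormDomain A (f - u) := by
    rw [← mem_formDomain_iff hA0] at hf ⊢
    refine Submodule.sub_mem _ hf ((mem_formDomain_iff hA0).mpr ?_)
    exact hdom u (LinearPMap.mem_domain_of_mem_graph hu)
  rw [← sub_eq_zero]
  set d := f - u
  obtain ⟨w, hw, hq⟩ := hd2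
  have hAs : IsSymm A := hBs.mono hAB.le
  have hd3 : ∀ y : A.domain, ⟪A y, d⟫_ℂ = -⟪(y : E), d⟫_ℂ := fun y => by
    rw [(mem_adjoint_graph_iff hd).mp hd1 _ _ (A.mem_graph y), inner_neg_right]
  have hmain : ∀ ε : ℝ, 0 < ε → ‖d‖ ^ 2 ≤ ε := by
    intro ε hε
    -- Since (w n, d) = -(A (w n), d) is the limit over m of -(A (w n), w m), it suffices to bound
    -- the latter. Twice its real part is at most the form of w n - w m, the forms of w n and w m
    -- being nonnegative; hence the factor 2.
    have ev : ∀ᶠ p : ℕ × ℕ in atTop,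
        (⟪((w p.1 - w p.2 : A.domain) : E), A (w p.1 - w p.2)⟫_ℂ).re < 2 * ε :=
      hq.eventually (gt_mem_nhds (by positivity))
    rw [eventually_atTop_prod_self'] at ev
    obtain ⟨N, hN⟩ := ev
    have lim1 : Tendsto (fun n => (⟪(w n : E), d⟫_ℂ).re) atTop (𝓝 (‖d‖ ^ 2)) := by
      rw [show ‖d‖ ^ 2 = (⟪d, d⟫_ℂ).re from (inner_self_eq_norm_sq (𝕜 := ℂ) d).symm]
      exact (Complex.continuous_re.tendsto _).comp (hw.inner tendsto_const_nhds)
    refine le_of_tendsto lim1 ((eventually_ge_atTop N).mono fun n hn => ?_)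
    have lim2 : Tendsto (fun m => -(⟪A (w n), (w m : E)⟫_ℂ).re) atTop
        (𝓝 (-(⟪A (w n), d⟫_ℂ).re)) :=
      ((Complex.continuous_re.tendsto _).comp (tendsto_const_nhds.inner hw)).neg
    rw [hd3, Complex.neg_re, neg_neg] at lim2
    refine le_of_tendsto lim2 ((eventually_ge_atTop N).mono fun m hm => ?_)
    have h1 := hN n hn m hm
    have h2 := hA0 (w n)
    have h3 := hA0 (w m)
    have h4 := congrArg Complex.re (hAs (A.mem_graph (w n)) (A.mem_graph (w m)))
    have h5 : (⟪(w m : E), A (w n)⟫_ℂ).re = (⟪A (w n), (w m : E)⟫_ℂ).re := by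
      rw [← inner_conj_symm, Complex.conj_re]
    rw [A.map_sub] at h1
    simp only [Submodule.coe_sub, inner_sub_left, inner_sub_right, Complex.sub_re] at h1
    linarith
  have : ‖d‖ ^ 2 ≤ 0 := le_of_forall_gt_imp_ge_of_dense fun ε hε => hmain ε hε
  simpa using this

end Graphs


/-! ### Orthogonal sums -/

section DirectSum

variable {E : Type*} [NormedAddCommGroup E] [InnerProductSpace ℂ E] [CompleteSpace E]
  {ι : Type*} {G : ι → Type*} [∀ i, NormedAddCommGroup (G i)]
  [∀ i, InnerProductSpace ℂ (G i)] [∀ i, CompleteSpace (G i)]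
  (J : ∀ i, G i →ₗᵢ[ℂ] E)

/-- The component of `f` in the `i`-th summand. -/
def coord (i : ι) : E →L[ℂ] G i := ContinuousLinearMap.adjoint (J i).toContinuousLinearMap

variable {J}

theorem inner_coord_right (i : ι) (x : G i) (f : E) : ⟪x, coord J i f⟫_ℂ = ⟪J i x, f⟫_ℂ :=
  ContinuousLinearMap.adjoint_inner_right _ _ _

theorem inner_coord_left (i : ι) (x : G i) (f : E) : ⟪coord J i f, x⟫_ℂ = ⟪f, J i x⟫_ℂ :=
  ContinuousLinearMap.adjoint_inner_left _ _ _

theorem coord_self (i : ι) (x : G i) : coord J i (J i x) = x := by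
  refine ext_inner_left ℂ fun y => ?_
  rw [inner_coord_right, (J i).inner_map_map]

theorem coord_of_ne (hJ : OrthogonalFamily ℂ G J) {i j : ι} (hij : i ≠ j) (x : G i) :
    coord J j (J i x) = 0 := by
  refine ext_inner_left ℂ fun y => ?_
  rw [inner_coord_right, hJ hij.symm, inner_zero_right]

theorem coord_of_hasSum (hJ : OrthogonalFamily ℂ G J) {u : ∀ i, G i} {f : E}
    (h : HasSum (fun i => J i (u i)) f) (i : ι) : coord J i f = u i := by
  have h1 := (coord J i).hasSum h
  refine h1.unique ?_
  convert hasSum_single i fun j hj => ?_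
  · exact (coord_self i (u i)).symm
  · exact coord_of_ne hJ hj _

theorem hasSum_coord (hJ : IsHilbertSum ℂ G J) (f : E) :
    HasSum (fun i => J i (coord J i f)) f := by
  obtain ⟨w, rfl⟩ := hJ.surjective_isometry f
  have h := hJ.OrthogonalFamily.hasSum_linearIsometry w
  convert h using 3 with i
  exact coord_of_hasSum hJ.OrthogonalFamily h i

theorem coord_ext (hJ : IsHilbertSum ℂ G J) {f g : E} (h : ∀ i, coord J i f = coord J i g) :
    f = g := by
  refine (hasSum_coord hJ f).unique ?_
  simp_rw [h]
  exact hasSum_coord hJ g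

theorem hasSum_inner_coord (hJ : IsHilbertSum ℂ G J) (f g : E) :
    HasSum (fun i => ⟪coord J i f, coord J i g⟫_ℂ) ⟪f, g⟫_ℂ := by
  have h := (innerSL ℂ f).hasSum (hasSum_coord hJ g)
  simp only [innerSL_apply_apply, ← inner_coord_left] at h
  exact h

theorem hasSum_norm_sq_coord (hJ : IsHilbertSum ℂ G J) (f : E) :
    HasSum (fun i => ‖coord J i f‖ ^ 2) (‖f‖ ^ 2) := by
  have h := Complex.reCLM.hasSum (hasSum_inner_coord hJ f f)
  simp only [Complex.reCLM_apply] at h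
  convert h using 2 with i
  · exact (inner_self_eq_norm_sq (𝕜 := ℂ) (coord J i f)).symm
  · exact (inner_self_eq_norm_sq (𝕜 := ℂ) f).symm

theorem exists_coord_eq (hJ : OrthogonalFamily ℂ G J) {u : ∀ i, G i}
    (h : Summable fun i => ‖u i‖ ^ 2) : ∃ f, HasSum (fun i => J i (u i)) f ∧
      ∀ i, coord J i f = u i := by
  obtain ⟨f, hf⟩ := (hJ.summable_iff_norm_sq_summable u).mpr h
  exact ⟨f, hf, coord_of_hasSum hJ hf⟩

variable {S B : ∀ i, G i →ₗ.[ℂ] G i}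

/-- Both series in the definition are the coordinate expansions of f and g, which converge
automatically, so no summability condition is left. -/
theorem mem_graph_directSum (hJ : IsHilbertSum ℂ G J) {f g : E} :
    (f, g) ∈ (directSum J S).graph ↔ ∀ i, (coord J i f, coord J i g) ∈ (S i).graph := by
  rw [directSum, Submodule.toLinearPMap_graph_eq]
  · constructor
    · rintro ⟨u, v, h, hu, hv⟩ i
      rw [coord_of_hasSum hJ.OrthogonalFamily hu, coord_of_hasSum hJ.OrthogonalFamily hv]
      exact h i
    · intro h
      exact ⟨fun i => coord J i f, fun i => coord J i g, h, hasSum_coord hJ f, hasSum_coord hJ g⟩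
  · rintro ⟨f, g⟩ ⟨u, v, h, hu, hv⟩ (rfl : f = 0)
    refine coord_ext hJ fun i => ?_
    have h1 := coord_of_hasSum hJ.OrthogonalFamily hu i
    have h2 := coord_of_hasSum hJ.OrthogonalFamily hv i
    rw [map_zero] at h1 ⊢
    rw [h2]
    exact (S i).graph_fst_eq_zero_snd (h i) h1.symm

theorem eq_directSum_of_graph (hJ : IsHilbertSum ℂ G J) {A : E →ₗ.[ℂ] E}
    (h : ∀ f g, (f, g) ∈ A.graph ↔ ∀ i, (coord J i f, coord J i g) ∈ (S i).graph) :
    A = directSum J S := by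
  refine LinearPMap.eq_of_eq_graph ?_
  ext ⟨f, g⟩
  rw [h, mem_graph_directSum hJ]

theorem map_mem_graph_directSum (hJ : IsHilbertSum ℂ G J) {i : ι} {u v : G i}
    (h : (u, v) ∈ (S i).graph) : (J i u, J i v) ∈ (directSum J S).graph := by
  rw [mem_graph_directSum hJ]
  intro j
  by_cases hij : i = j
  · subst hij
    rwa [coord_self, coord_self]
  · rw [coord_of_ne hJ.OrthogonalFamily hij, coord_of_ne hJ.OrthogonalFamily hij]
    exact (S j).graph.zero_mem

theorem directSum_mono (hJ : IsHilbertSum ℂ G J) (h : ∀ i, S i ≤ B i) :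
    directSum J S ≤ directSum J B := by
  refine LinearPMap.le_of_le_graph ?_
  rintro ⟨f, g⟩ hf
  rw [mem_graph_directSum hJ] at hf ⊢
  exact fun i => LinearPMap.le_graph_of_le (h i) (hf i)

theorem isNonneg_directSum (hJ : IsHilbertSum ℂ G J) (h : ∀ i, IsNonneg (S i)) :
    IsNonneg (directSum J S) := by
  rw [isNonneg_iff_graph]
  intro u v huv
  rw [mem_graph_directSum hJ] at huv
  have h1 := Complex.reCLM.hasSum (hasSum_inner_coord hJ u v)
  exact h1.nonneg fun i => isNonneg_iff_graph.mp (h i) _ _ (huv i)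

/-- For density and for maximality it is enough to test against vectors supported in one summand. -/
theorem isSelfAdjoint_directSum (hJ : IsHilbertSum ℂ G J) (h : ∀ i, IsSelfAdjoint (S i)) :
    IsSelfAdjoint (directSum J S) := by
  refine isSelfAdjoint_of_isSymm ?_ ?_ ?_
  · rw [Submodule.dense_iff_topologicalClosure_eq_top,
      Submodule.topologicalClosure_eq_top_iff, Submodule.eq_bot_iff]
    intro g hg
    refine coord_ext hJ fun i => ?_
    rw [map_zero]
    refine (h i).dense_domain.eq_zero_of_inner_right ℂ fun x hx => ?_
    rw [inner_coord_right]
    exact hg _ (LinearPMap.mem_domain_of_mem_graph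
      (map_mem_graph_directSum hJ ((S i).mem_graph ⟨x, hx⟩)))
  · intro u v y z h1 h2
    rw [mem_graph_directSum hJ] at h1 h2
    refine (hasSum_inner_coord hJ v y).unique ?_
    convert hasSum_inner_coord hJ u z using 2 with i
    exact isSymm_of_isSelfAdjoint (h i) (h1 i) (h2 i)
  · intro y z hyz
    rw [mem_graph_directSum hJ]
    refine fun i => mem_graph_of_isSelfAdjoint (h i) fun u v huv => ?_
    rw [inner_coord_right, inner_coord_right]
    exact hyz _ _ (map_mem_graph_directSum hJ huv)

/-- Truncation to finitely many summands costs little in norm and in form, because the expansions of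
u and v converge; the truncation is then approximated one summand at a time. -/
theorem isFormCore_directSum (hJ : IsHilbertSum ℂ G J) {a b : ℂ} (hle : ∀ i, S i ≤ B i)
    (hB : ∀ i, IsNonneg (B i)) (h : ∀ i, IsFormCore a b (S i) (B i)) :
    IsFormCore a b (directSum J S) (directSum J B) := by
  classical
  have hB' := isNonneg_directSum hJ hB
  have hle' := directSum_mono hJ hle
  let P : ℝ → E → E → Prop := fun ε u v => ∃ w z, (w, z) ∈ (directSum J S).graph ∧
    ‖a • (u - w) + b • (v - z)‖ < ε ∧ (⟪u - w, v - z⟫_ℂ).re < ε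
  -- The form of a sum is at most twice the sum of the forms, so ε / 4 for each term leaves ε.
  have hadd : ∀ ε u v y z, 0 < ε → (u, v) ∈ (directSum J B).graph →
      (y, z) ∈ (directSum J B).graph → P (ε / 4) u v → P (ε / 4) y z → P ε (u + y) (v + z) := by
    rintro ε u v y z hε h1 h2 ⟨w, x, hw, n1, q1⟩ ⟨w', x', hw', n2, q2⟩
    refine ⟨w + w', x + x', Submodule.add_mem _ hw hw', ?_, ?_⟩
    · have e : a • (u + y - (w + w')) + b • (v + z - (x + x')) =
          (a • (u - w) + b • (v - x)) + (a • (y - w') + b • (z - x')) := by module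
      rw [e]
      exact (norm_add_le _ _).trans_lt (by linarith)
    · have := hB'.re_inner_add_le
        (Submodule.sub_mem _ h1 (LinearPMap.le_graph_of_le hle' hw))
        (Submodule.sub_mem _ h2 (LinearPMap.le_graph_of_le hle' hw'))
      rw [add_sub_add_comm, add_sub_add_comm]
      linarith
  intro u v huv
  have hfin : ∀ s : Finset ι, (∑ i ∈ s, J i (coord J i u), ∑ i ∈ s, J i (coord J i v)) ∈
      (directSum J B).graph ∧
      ∀ ε, 0 < ε → P ε (∑ i ∈ s, J i (coord J i u)) (∑ i ∈ s, J i (coord J i v)) := by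
    intro s
    induction s using Finset.induction_on with
    | empty =>
      refine ⟨by simp, fun ε hε => ⟨0, 0, ?_, ?_, ?_⟩⟩
      · exact Submodule.zero_mem _
      · simpa using hε
      · simpa using hε
    | insert i s hi ih =>
      have hi' := (mem_graph_directSum hJ).mp huv i
      have hm := map_mem_graph_directSum hJ hi'
      rw [Finset.sum_insert hi, Finset.sum_insert hi]
      refine ⟨Submodule.add_mem _ hm ih.1, fun ε hε => hadd _ _ _ _ _ hε hm ih.1 ?_
        (ih.2 _ (by positivity))⟩
      obtain ⟨w, z, hw, n1, q1⟩ := h i hi' (ε / 4) (by positivity)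
      refine ⟨J i w, J i z, map_mem_graph_directSum hJ hw, ?_, ?_⟩
      · rw [← map_sub, ← map_sub, ← map_smul, ← map_smul, ← map_add, (J i).norm_map]
        exact n1
      · rw [← map_sub, ← map_sub, (J i).inner_map_map]
        exact q1
  intro ε hε
  have l1 : Tendsto (fun s : Finset ι => u - ∑ i ∈ s, J i (coord J i u)) atTop (𝓝 0) := by
    have := (tendsto_const_nhds (x := u)).sub (hasSum_coord hJ u)
    simpa using this
  have l2 : Tendsto (fun s : Finset ι => v - ∑ i ∈ s, J i (coord J i v)) atTop (𝓝 0) := by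
    have := (tendsto_const_nhds (x := v)).sub (hasSum_coord hJ v)
    simpa using this
  have l3 := ((l1.const_smul a).add (l2.const_smul b)).norm
  have l4 := (Complex.continuous_re.tendsto _).comp (l1.inner l2 (𝕜 := ℂ))
  simp only [smul_zero, add_zero, norm_zero, inner_zero_left, Complex.zero_re] at l3 l4
  obtain ⟨s, hs1, hs2⟩ := ((l3.eventually (gt_mem_nhds (show 0 < ε / 4 by positivity))).and
    (l4.eventually (gt_mem_nhds (show 0 < ε / 4 by positivity)))).exists
  -- The tail is approximated by the zero vector, the head by the finite sum.
  have := hadd ε _ _ _ _ hε (Submodule.sub_mem _ huv (hfin s).1) (hfin s).1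
    ⟨0, 0, Submodule.zero_mem _, by simpa using hs1,
      by rw [sub_zero, sub_zero]; exact hs2⟩
    ((hfin s).2 _ (by positivity))
  rwa [sub_add_cancel, sub_add_cancel] at this

end DirectSum


/-! ### Calculus in `W^{1,2}(ℝ₊, K)` -/

section Calculus

set_option linter.unusedSectionVars false

variable {K : Type*} [NormedAddCommGroup K] [InnerProductSpace ℂ K]

/-- Extension by zero allows the continuity of primitives on the whole line to be used. -/
theorem intervalIntegrable_indicator_L2 (g : L2 K) (x y : ℝ) :
    IntervalIntegrable ((Ioi (0 : ℝ)).indicator g) volume x y := by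
  rw [intervalIntegrable_iff, IntegrableOn, integrable_indicator_iff measurableSet_Ioi,
    IntegrableOn, Measure.restrict_restrict measurableSet_Ioi]
  have : IsFiniteMeasure (volume.restrict (Ioi 0 ∩ uIoc x y)) := ⟨by
    rw [Measure.restrict_apply_univ]
    exact (measure_mono inter_subset_right).trans_lt measure_Ioc_lt_top⟩
  exact ((Lp.memLp g).mono_measure (Measure.restrict_mono inter_subset_left le_rfl)).integrable
    (by norm_num)

theorem primitive_eq_indicator (g : ℝ → K) {x : ℝ} (hx : 0 ≤ x) :
    ∫ t in (0 : ℝ)..x, g t = ∫ t in (0 : ℝ)..x, (Ioi (0 : ℝ)).indicator g t := by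
  rw [intervalIntegral.integral_of_le hx, intervalIntegral.integral_of_le hx]
  refine setIntegral_congr_fun measurableSet_Ioc fun t ht => ?_
  exact (indicator_of_mem (show t ∈ Ioi (0 : ℝ) from ht.1) g).symm

theorem continuousOn_primitive (g : L2 K) :
    ContinuousOn (fun x => ∫ t in (0 : ℝ)..x, g t) (Ici 0) :=
  (intervalIntegral.continuous_primitive (intervalIntegrable_indicator_L2 g) 0).continuousOn.congr
    fun _ hx => primitive_eq_indicator g hx

/-- Lebesgue differentiation on the bounded intervals [0, n + 1]. -/
theorem ae_eq_zero_of_primitive [CompleteSpace K] {g : ℝ → K}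
    (hg : ∀ x, 0 < x → IntervalIntegrable g volume 0 x)
    (h : ∀ x, 0 < x → ∫ t in (0 : ℝ)..x, g t = 0) :
    g =ᵐ[volume.restrict (Ioi (0 : ℝ))] 0 := by
  rw [Filter.EventuallyEq, ae_restrict_iff' measurableSet_Ioi]
  have h1 : ∀ᵐ x : ℝ, ∀ n : ℕ, x ∈ uIcc 0 ((n : ℝ) + 1) → ∀ c ∈ uIcc 0 ((n : ℝ) + 1),
      HasDerivAt (fun x => ∫ (t : ℝ) in c..x, g t) (g x) x :=
    ae_all_iff.mpr fun n => (hg _ (by positivity)).ae_hasDerivAt_integral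
  filter_upwards [h1] with x hx hx0
  have hx0' : 0 < x := hx0
  obtain ⟨n, hn⟩ := exists_nat_gt x
  have h2 := hx n (by rw [uIcc_of_le (by positivity)]; exact ⟨hx0'.le, by linarith⟩) 0
    left_mem_uIcc
  have h3 : HasDerivAt (fun _ : ℝ => (0 : K)) (g x) x := by
    refine h2.congr_of_eventuallyEq ?_
    filter_upwards [Ioi_mem_nhds hx0'] with y hy
    exact (h y hy).symm
  exact h3.unique (hasDerivAt_const x 0)

/-- The continuous representative vanishes almost everywhere, hence everywhere on [0, ∞), including
at 0; then its derivative vanishes too. -/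
theorem HasL2Deriv.unique [CompleteSpace K] {g : L2 K} {a : K} (h : HasL2Deriv 0 g a) :
    g = 0 ∧ a = 0 := by
  have h1 : EqOn (fun x => a + ∫ t in (0 : ℝ)..x, g t) (fun _ => 0) (Ici 0) := by
    refine Measure.eqOn_of_ae_eq (μ := volume) ?_ (continuousOn_const.add (continuousOn_primitive g))
      continuousOn_const (by rw [interior_Ici, closure_Ioi])
    rw [← restrict_Ioi_eq_restrict_Ici]
    filter_upwards [h, Lp.coeFn_zero K 2 (volume.restrict (Ioi (0 : ℝ)))] with x hx hx0
    rw [← hx, hx0]; rfl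
  have ha : a = 0 := by simpa using h1 (mem_Ici.mpr (le_refl (0 : ℝ)))
  refine ⟨?_, ha⟩
  rw [Lp.eq_zero_iff_ae_eq_zero]
  refine ae_eq_zero_of_primitive (fun x hx => intervalIntegrable_L2 g hx) fun x hx => ?_
  simpa [ha] using h1 (show x ∈ Ici 0 from hx.le)

/-- Integration by parts on a bounded interval. -/
theorem integral_inner_primitive [CompleteSpace K] {g h : ℝ → K} {M : ℝ}
    (hg : IntegrableOn g (Ioc 0 M)) (hh : IntegrableOn h (Ioc 0 M)) :
    (∫ x in Ioc 0 M, ⟪∫ t in (0 : ℝ)..x, g t, h x⟫_ℂ) +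
      (∫ x in Ioc 0 M, ⟪g x, ∫ t in (0 : ℝ)..x, h t⟫_ℂ) =
    ⟪∫ x in Ioc 0 M, g x, ∫ x in Ioc 0 M, h x⟫_ℂ := by
  set μ := volume.restrict (Ioc 0 M) with hμ
  -- Fubini on the square (0, M]²: the two integrals are those of (g(s), h(t)) over s ≤ t and over t
  -- < s.
  have hInt : Integrable (fun p : ℝ × ℝ => ⟪g p.1, h p.2⟫_ℂ) (μ.prod μ) := by
    refine Integrable.mono' (hg.norm.mul_prod hh.norm) ?_ (Eventually.of_forall fun p => ?_)
    · exact (hg.aestronglyMeasurable.comp_fst).inner (hh.aestronglyMeasurable.comp_snd)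
    · exact norm_inner_le_norm _ _
  have hm : MeasurableSet {p : ℝ × ℝ | p.1 ≤ p.2} := measurableSet_le measurable_fst measurable_snd
  have hprim : ∀ f : ℝ → K, ∀ x ∈ Ioc 0 M, ∫ t in (0 : ℝ)..x, f t = ∫ t in Iic x, f t ∂μ := by
    intro f x hx
    rw [intervalIntegral.integral_of_le hx.1.le, hμ, Measure.restrict_restrict measurableSet_Iic]
    congr 2
    ext t
    simp only [mem_Ioc, mem_inter_iff, mem_Iic]
    constructor
    · rintro ⟨h1, h2⟩; exact ⟨h2, h1, h2.trans hx.2⟩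
    · rintro ⟨h1, h2, h3⟩; exact ⟨h2, h1⟩
  have hprim' : ∀ f : ℝ → K, ∀ x ∈ Ioc 0 M, ∫ t in (0 : ℝ)..x, f t = ∫ t in Iio x, f t ∂μ := by
    intro f x hx
    rw [hprim f x hx]
    exact setIntegral_congr_set Iio_ae_eq_Iic.symm
  have e1 : (∫ x, ⟪∫ t in (0 : ℝ)..x, g t, h x⟫_ℂ ∂μ) =
      ∫ p in {p : ℝ × ℝ | p.1 ≤ p.2}, ⟪g p.1, h p.2⟫_ℂ ∂(μ.prod μ) := by
    rw [← integral_indicator hm, integral_prod_symm _ (hInt.indicator hm)]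
    refine setIntegral_congr_fun measurableSet_Ioc fun x hx => ?_
    rw [hprim g x hx, ← inner_conj_symm, ← integral_inner (Integrable.restrict (μ := μ) hg),
      ← integral_conj,
      ← integral_indicator measurableSet_Iic]
    refine integral_congr_ae (Eventually.of_forall fun t => ?_)
    by_cases ht : t ≤ x
    · simp [indicator, ht]
    · simp [indicator, ht]
  have e2 : (∫ x, ⟪g x, ∫ t in (0 : ℝ)..x, h t⟫_ℂ ∂μ) =
      ∫ p in {p : ℝ × ℝ | p.1 ≤ p.2}ᶜ, ⟪g p.1, h p.2⟫_ℂ ∂(μ.prod μ) := by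
    rw [← integral_indicator hm.compl, integral_prod _ (hInt.indicator hm.compl)]
    refine setIntegral_congr_fun measurableSet_Ioc fun x hx => ?_
    rw [hprim' h x hx, ← integral_inner (Integrable.restrict (μ := μ) hh), ← integral_indicator measurableSet_Iio]
    refine integral_congr_ae (Eventually.of_forall fun t => ?_)
    by_cases ht : t < x
    · simp [indicator, ht]
    · simp [indicator, ht]
  rw [e1, e2, integral_add_compl hm hInt, integral_prod _ hInt]
  have e3 : ∀ x, ∫ y, ⟪g x, h y⟫_ℂ ∂μ = ⟪g x, ∫ y, h y ∂μ⟫_ℂ := fun x => integral_inner hh (g x)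
  simp_rw [e3]
  rw [← inner_conj_symm, ← integral_inner hg, ← integral_conj]
  simp_rw [inner_conj_symm]
  rfl

theorem integrableOn_L2 (g : L2 K) (M : ℝ) : IntegrableOn g (Ioc 0 M) := by
  have h1 : MemLp g 2 (volume.restrict (Set.Ioc 0 M)) :=
    (Lp.memLp g).mono_measure (Measure.restrict_mono Set.Ioc_subset_Ioi_self le_rfl)
  exact h1.integrable (by norm_num)

/-- Integration by parts in `W^{1,2}(ℝ₊, K)`. -/
theorem HasL2Deriv.inner_add [CompleteSpace K] {f f' k k' : L2 K} {a b : K}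
    (hf : HasL2Deriv f f' a) (hk : HasL2Deriv k k' b) :
    ⟪f', k⟫_ℂ + ⟪f, k'⟫_ℂ = -⟪a, b⟫_ℂ := by
  let F : ℝ → K := fun x => a + ∫ t in (0 : ℝ)..x, f' t
  let G : ℝ → K := fun x => b + ∫ t in (0 : ℝ)..x, k' t
  have hInt : IntegrableOn (fun x => ⟪f' x, k x⟫_ℂ + ⟪f x, k' x⟫_ℂ) (Ioi 0) :=
    (L2.integrable_inner f' k).add (L2.integrable_inner f k')
  have hM : ∀ M : ℝ, 0 < M → ∫ x in (0 : ℝ)..M, (⟪f' x, k x⟫_ℂ + ⟪f x, k' x⟫_ℂ) =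
      ⟪F M, G M⟫_ℂ - ⟪a, b⟫_ℂ := by
    intro M hM
    have hf' := integrableOn_L2 f' M
    have hk' := integrableOn_L2 k' M
    have i1 : IntegrableOn (fun x => ⟪f' x, k x⟫_ℂ) (Ioc 0 M) :=
      IntegrableOn.mono_set (L2.integrable_inner f' k) Ioc_subset_Ioi_self
    have i2 : IntegrableOn (fun x => ⟪f x, k' x⟫_ℂ) (Ioc 0 M) :=
      IntegrableOn.mono_set (L2.integrable_inner f k') Ioc_subset_Ioi_self
    have j1 : Integrable (fun x => ⟪f' x, b⟫_ℂ) (volume.restrict (Ioc 0 M)) := hf'.inner_const b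
    have j2 : Integrable (fun x => ⟪a, k' x⟫_ℂ) (volume.restrict (Ioc 0 M)) := hk'.const_inner a
    have ae1 : (fun x => ⟪f' x, k x⟫_ℂ) =ᵐ[volume.restrict (Ioc 0 M)]
        fun x => ⟪f' x, b⟫_ℂ + ⟪f' x, ∫ t in (0 : ℝ)..x, k' t⟫_ℂ := by
      filter_upwards [ae_restrict_of_ae_restrict_of_subset Ioc_subset_Ioi_self hk] with x hx
      rw [hx, inner_add_right]
    have ae2 : (fun x => ⟪f x, k' x⟫_ℂ) =ᵐ[volume.restrict (Ioc 0 M)]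
        fun x => ⟪a, k' x⟫_ℂ + ⟪∫ t in (0 : ℝ)..x, f' t, k' x⟫_ℂ := by
      filter_upwards [ae_restrict_of_ae_restrict_of_subset Ioc_subset_Ioi_self hf] with x hx
      rw [hx, inner_add_left]
    have k1 : Integrable (fun x => ⟪f' x, ∫ t in (0 : ℝ)..x, k' t⟫_ℂ)
        (volume.restrict (Ioc 0 M)) := by
      have := ((integrable_congr ae1).mp i1).sub j1
      exact this.congr (Eventually.of_forall fun x => by simp)
    have k2 : Integrable (fun x => ⟪∫ t in (0 : ℝ)..x, f' t, k' x⟫_ℂ)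
        (volume.restrict (Ioc 0 M)) := by
      have := ((integrable_congr ae2).mp i2).sub j2
      exact this.congr (Eventually.of_forall fun x => by simp)
    have p := integral_inner_primitive hf' hk'
    rw [intervalIntegral.integral_of_le hM.le, integral_add i1 i2, integral_congr_ae ae1,
      integral_congr_ae ae2, integral_add j1 k1, integral_add j2 k2, integral_inner hk' a]
    have e1 : ∫ x in Ioc 0 M, ⟪f' x, b⟫_ℂ = ⟪∫ x in Ioc 0 M, f' x, b⟫_ℂ := by
      rw [← inner_conj_symm, ← integral_inner hf', ← integral_conj]
      simp
    rw [e1]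
    simp only [F, G, intervalIntegral.integral_of_le hM.le, inner_add_left, inner_add_right]
    linear_combination p
  have hlim : Tendsto (fun M => ⟪F M, G M⟫_ℂ) atTop
      (𝓝 ((∫ x in Ioi (0 : ℝ), (⟪f' x, k x⟫_ℂ + ⟪f x, k' x⟫_ℂ)) + ⟪a, b⟫_ℂ)) := by
    have h1 := (intervalIntegral_tendsto_integral_Ioi 0 hInt tendsto_id).add_const ⟪a, b⟫_ℂ
    refine h1.congr' ?_
    filter_upwards [eventually_gt_atTop 0] with M h0
    rw [id, hM M h0, sub_add_cancel]
  have hFG : IntegrableOn (fun x => ⟪F x, G x⟫_ℂ) (Ioi 0) := by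
    refine (L2.integrable_inner f k).congr ?_
    filter_upwards [hf, hk] with x h1 h2
    rw [h1, h2]
  -- The boundary term at M converges as M → ∞ and is integrable in M, so its limit is 0.
  have h0 : (∫ x in Ioi (0 : ℝ), (⟪f' x, k x⟫_ℂ + ⟪f x, k' x⟫_ℂ)) + ⟪a, b⟫_ℂ = 0 := by
    refine IntegrableAtFilter.eq_zero_of_tendsto (μ := volume) ⟨Ioi 0, Ioi_mem_atTop 0, hFG⟩ ?_ hlim
    intro s hs
    obtain ⟨c, hc⟩ := mem_atTop_sets.mp hs
    exact measure_mono_top (fun x hx => hc x hx) (Real.volume_Ici (a := c))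
  rw [integral_add (L2.integrable_inner f' k) (L2.integrable_inner f k'), ← L2.inner_def,
    ← L2.inner_def] at h0
  linear_combination h0

end Calculus


/-! ### The fundamental lemma of the calculus of variations on the half-line. -/

section Duality

set_option linter.unusedSectionVars false

variable {K : Type*} [NormedAddCommGroup K] [InnerProductSpace ℂ K]

theorem memLp_indicator_of_continuousOn {F : ℝ → K} (hF : ContinuousOn F (Ici 0)) (M : ℝ) :
    MemLp ((Ioc 0 M).indicator F) 2 (volume.restrict (Ioi (0 : ℝ))) := by
  rw [memLp_indicator_iff_restrict measurableSet_Ioc, Measure.restrict_restrict measurableSet_Ioc,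
    inter_eq_left.mpr Ioc_subset_Ioi_self]
  have hc : ContinuousOn F (Icc 0 M) := hF.mono Icc_subset_Ici_self
  obtain ⟨C, hC⟩ := isCompact_Icc.exists_bound_of_continuousOn hc
  refine MemLp.of_bound ((hc.mono Ioc_subset_Icc_self).aestronglyMeasurable measurableSet_Ioc) C ?_
  filter_upwards [ae_restrict_mem measurableSet_Ioc] with x hx
  exact hC x (Ioc_subset_Icc_self hx)

/-- A primitive of an `L²` function with bounded support and vanishing mean is in `W^{1,2}`. -/
theorem exists_hasL2Deriv_of_integral_eq_zero (ψ : L2 K) {M : ℝ} (hM : 0 < M)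
    (hψ : ∀ᵐ t ∂(volume.restrict (Ioi (0 : ℝ))), M < t → ψ t = 0)
    (h0 : ∫ t in (0 : ℝ)..M, ψ t = 0) :
    ∃ w : L2 K, HasL2Deriv w ψ 0 ∧ w =ᵐ[volume.restrict (Ioi (0 : ℝ))]
      (Ioc 0 M).indicator fun x => ∫ t in (0 : ℝ)..x, ψ t := by
  have hm := memLp_indicator_of_continuousOn (continuousOn_primitive ψ) M
  refine ⟨hm.toLp _, ?_, hm.coeFn_toLp⟩
  filter_upwards [hm.coeFn_toLp, ae_restrict_mem measurableSet_Ioi] with x hx hx0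
  rw [hx, zero_add]
  by_cases hxM : x ≤ M
  · rw [indicator_of_mem (show x ∈ Ioc 0 M from ⟨hx0, hxM⟩)]
  · rw [indicator_of_notMem (fun h => hxM h.2)]
    push Not at hxM
    have hi := intervalIntegrable_L2 ψ hM
    have hi' := intervalIntegrable_L2 ψ (show 0 < x from hx0)
    rw [← intervalIntegral.integral_add_adjacent_intervals hi (hi.symm.trans hi'), h0, zero_add,
      intervalIntegral.integral_of_le hxM.le]
    symm
    refine setIntegral_eq_zero_of_ae_eq_zero ?_
    have h1 := (ae_restrict_iff' measurableSet_Ioi).mp hψ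
    filter_upwards [h1] with t ht ht'
    exact ht (hM.trans ht'.1) ht'.1

variable [CompleteSpace K]

theorem inner_indicatorConstLp_L2 {x : ℝ} (hx : 0 < x) (c : K) (f : L2 K)
    (h : volume.restrict (Ioi (0 : ℝ)) (Ioc 0 x) ≠ ∞) :
    ⟪indicatorConstLp 2 measurableSet_Ioc h c, f⟫_ℂ = ⟪c, ∫ t in (0 : ℝ)..x, f t⟫_ℂ := by
  rw [L2.inner_indicatorConstLp_eq_inner_setIntegral, Measure.restrict_restrict measurableSet_Ioc,
    inter_eq_left.mpr Ioc_subset_Ioi_self, intervalIntegral.integral_of_le hx.le]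

/-- The fundamental lemma of the calculus of variations in `L²(ℝ₊, K)`. -/
theorem exists_hasL2Deriv_of_inner {f g : L2 K}
    (h : ∀ w w' : L2 K, HasL2Deriv w w' 0 → ⟪w', f⟫_ℂ = -⟪w, g⟫_ℂ) : ∃ a, HasL2Deriv f g a := by
  let G : ℝ → K := fun x => ∫ t in (0 : ℝ)..x, g t
  have hGc : ContinuousOn G (Ici 0) := continuousOn_primitive g
  have hGi : ∀ x, 0 < x → IntervalIntegrable G volume 0 x := fun x hx =>
    (hGc.mono (by rw [uIcc_of_le hx.le]; exact Icc_subset_Ici_self)).intervalIntegrable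
  -- The integral of f - G over (0, x] is x times its integral over (0, 1], so f - G is constant.
  have key : ∀ x : ℝ, 0 < x → (∫ t in (0 : ℝ)..x, f t) - (x : ℂ) • ∫ t in (0 : ℝ)..1, f t =
      (∫ t in (0 : ℝ)..x, G t) - (x : ℂ) • ∫ t in (0 : ℝ)..1, G t := by
    intro x hx
    refine ext_inner_left ℂ fun c => ?_
    have hfin : ∀ y : ℝ, volume.restrict (Ioi (0 : ℝ)) (Ioc 0 y) ≠ ∞ := fun y =>
      ((Measure.restrict_apply_le _ _).trans_lt measure_Ioc_lt_top).ne
    set M := max x 1 with hMdef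
    have hM : 0 < M := lt_max_of_lt_left hx
    set I : ℝ → L2 K := fun y => indicatorConstLp 2 measurableSet_Ioc (hfin y) c with hI
    -- This step function has bounded support and mean zero, so its primitive is an admissible test
    -- function.
    set ψ : L2 K := I x - (x : ℂ) • I 1 with hψdef
    have hψi : ∀ u : L2 K, ⟪ψ, u⟫_ℂ =
        ⟪c, (∫ t in (0 : ℝ)..x, u t) - (x : ℂ) • ∫ t in (0 : ℝ)..1, u t⟫_ℂ := by
      intro u
      rw [hψdef, inner_sub_left, inner_smul_left, inner_indicatorConstLp_L2 hx,
        inner_indicatorConstLp_L2 one_pos, inner_sub_right, inner_smul_right, Complex.conj_ofReal]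
    have hψae : ψ =ᵐ[volume.restrict (Ioi (0 : ℝ))] fun t =>
        (Ioc 0 x).indicator (fun _ => c) t - (x : ℂ) • (Ioc 0 1).indicator (fun _ => c) t := by
      filter_upwards [Lp.coeFn_sub (I x) ((x : ℂ) • I 1), Lp.coeFn_smul (x : ℂ) (I 1),
        indicatorConstLp_coeFn (p := 2) (hs := measurableSet_Ioc) (hμs := hfin x) (c := c),
        indicatorConstLp_coeFn (p := 2) (hs := measurableSet_Ioc) (hμs := hfin 1) (c := c)]
        with t h1 h2 h3 h4
      rw [hψdef, h1, Pi.sub_apply, h2, Pi.smul_apply]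
      exact congrArg₂ _ h3 (congrArg _ h4)
    have hψ0 : ∀ᵐ t ∂(volume.restrict (Ioi (0 : ℝ))), M < t → ψ t = 0 := by
      filter_upwards [hψae] with t ht htM
      rw [ht, indicator_of_notMem, indicator_of_notMem, smul_zero, sub_zero]
      · exact fun h => absurd (h.2.trans (le_max_right x 1)) (not_le.mpr htM)
      · exact fun h => absurd (h.2.trans (le_max_left x 1)) (not_le.mpr htM)
    have hψint : ∫ t in (0 : ℝ)..M, ψ t = 0 := by
      have hi : ∀ y, Integrable ((Ioc 0 y).indicator (fun _ : ℝ => c))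
          (volume.restrict (Ioc 0 M)) := fun y => (integrable_const c).indicator measurableSet_Ioc
      have hv : ∀ y, 0 ≤ y → y ≤ M →
          ∫ t in Ioc 0 M, (Ioc 0 y).indicator (fun _ : ℝ => c) t = (y : ℂ) • c := by
        intro y hy hyM
        rw [integral_indicator measurableSet_Ioc, Measure.restrict_restrict measurableSet_Ioc,
          inter_eq_left.mpr (Ioc_subset_Ioc_right hyM), setIntegral_const]
        simp [Measure.real, hy]
      rw [intervalIntegral.integral_of_le hM.le, integral_congr_ae
        (ae_restrict_of_ae_restrict_of_subset Ioc_subset_Ioi_self hψae),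
        integral_sub (hi x) (by exact Integrable.smul (x : ℂ) (hi 1)), integral_smul, hv x hx.le (le_max_left _ _),
        hv 1 zero_le_one (le_max_right _ _)]
      simp
    obtain ⟨w, hw, hw'⟩ := exists_hasL2Deriv_of_integral_eq_zero ψ hM hψ0 hψint
    -- The primitive G need not be square integrable; it is cut off beyond M, where ψ vanishes.
    have hGm := memLp_indicator_of_continuousOn hGc M
    have hres : volume.restrict (Ioc 0 M) = (volume.restrict (Ioi (0 : ℝ))).restrict (Ioc 0 M) := by
      rw [Measure.restrict_restrict measurableSet_Ioc, inter_eq_left.mpr Ioc_subset_Ioi_self]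
    have e1 : ⟪w, g⟫_ℂ = ∫ t in Ioc 0 M, ⟪∫ s in (0 : ℝ)..t, ψ s, g t⟫_ℂ := by
      rw [L2.inner_def, hres, ← integral_indicator measurableSet_Ioc]
      refine integral_congr_ae ?_
      filter_upwards [hw'] with t ht
      rw [ht]
      by_cases h : t ∈ Ioc 0 M
      · simp [indicator_of_mem h]
      · simp [indicator_of_notMem h]
    have e2 : ⟪ψ, hGm.toLp _⟫_ℂ = ∫ t in Ioc 0 M, ⟪ψ t, ∫ s in (0 : ℝ)..t, g s⟫_ℂ := by
      rw [L2.inner_def, hres, ← integral_indicator measurableSet_Ioc]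
      refine integral_congr_ae ?_
      filter_upwards [hGm.coeFn_toLp] with t ht
      rw [ht]
      by_cases h : t ∈ Ioc 0 M
      · simp [indicator_of_mem h, G]
      · simp [indicator_of_notMem h]
    have e3 := integral_inner_primitive (integrableOn_L2 ψ M) (integrableOn_L2 g M)
    rw [← e1, ← e2, ← intervalIntegral.integral_of_le hM.le, hψint, inner_zero_left] at e3
    have e4 := h w ψ hw
    have e5 : ∀ y, 0 < y → y ≤ M → ∫ t in (0 : ℝ)..y, hGm.toLp _ t = ∫ t in (0 : ℝ)..y, G t := by
      intro y hy hyM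
      rw [intervalIntegral.integral_of_le hy.le, intervalIntegral.integral_of_le hy.le]
      refine integral_congr_ae ?_
      filter_upwards [ae_restrict_of_ae_restrict_of_subset Ioc_subset_Ioi_self hGm.coeFn_toLp,
        ae_restrict_mem measurableSet_Ioc] with t ht ht'
      rw [ht, indicator_of_mem (Ioc_subset_Ioc_right hyM ht')]
    have e6 := hψi (hGm.toLp _)
    rw [e5 x hx (le_max_left _ _), e5 1 one_pos (le_max_right _ _)] at e6
    rw [← hψi f, ← e6]
    linear_combination e4 - e3
  refine ⟨(∫ t in (0 : ℝ)..1, f t) - ∫ t in (0 : ℝ)..1, G t, ?_⟩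
  set m := (∫ t in (0 : ℝ)..1, f t) - ∫ t in (0 : ℝ)..1, G t with hm
  have h1 : (fun t => f t - G t - m) =ᵐ[volume.restrict (Ioi (0 : ℝ))] 0 := by
    have i1 : ∀ x, 0 < x → IntervalIntegrable (fun t => f t - G t) volume 0 x := fun x hx =>
      (intervalIntegrable_L2 f hx).sub (hGi x hx)
    refine ae_eq_zero_of_primitive (fun x hx => (i1 x hx).sub intervalIntegrable_const)
      fun x hx => ?_
    rw [intervalIntegral.integral_sub (i1 x hx) intervalIntegrable_const,
      intervalIntegral.integral_sub (intervalIntegrable_L2 f hx) (hGi x hx),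
      intervalIntegral.integral_const, sub_zero, hm]
    have := key x hx
    rw [← Complex.coe_smul, smul_sub, sub_eq_zero]
    rw [sub_eq_iff_eq_add] at this
    rw [this]; abel
  filter_upwards [h1] with x hx
  have hx' : f x - G x - m = 0 := hx
  rw [sub_sub, sub_eq_zero] at hx'
  rw [hx', add_comm]

end Duality


/-! ### Adjoints and closedness of the first derivative; the maximal second derivative. -/

section Derivatives

set_option linter.unusedSectionVars false

variable {K : Type*} [NormedAddCommGroup K] [InnerProductSpace ℂ K]

theorem HasL2Deriv.neg {f g : L2 K} {a : K} (h : HasL2Deriv f g a) :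
    HasL2Deriv (-f) (-g) (-a) := by
  simpa using h.smul (-1)

theorem HasL2Deriv.sub {f g f' g' : L2 K} {a a' : K} (h : HasL2Deriv f g a)
    (hk : HasL2Deriv f' g' a') : HasL2Deriv (f - f') (g - g') (a - a') := by
  simpa only [sub_eq_add_neg] using h.add hk.neg

/-- Bounded operators commute with differentiation. -/
theorem HasL2Deriv.compLpL [CompleteSpace K] {K' : Type*} [NormedAddCommGroup K']
    [InnerProductSpace ℂ K'] [CompleteSpace K'] (R : K →L[ℂ] K') {f g : L2 K} {a : K}
    (h : HasL2Deriv f g a) : HasL2Deriv (R.compLpL 2 _ f) (R.compLpL 2 _ g) (R a) := by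
  filter_upwards [h, R.coeFn_compLpL f, ae_restrict_mem measurableSet_Ioi] with x hx hR hx0
  have : ∫ t in (0 : ℝ)..x, (R.compLpL 2 (volume.restrict (Ioi (0 : ℝ))) g) t =
      ∫ t in (0 : ℝ)..x, R (g t) := by
    rw [intervalIntegral.integral_of_le (le_of_lt hx0),
      intervalIntegral.integral_of_le (le_of_lt hx0)]
    exact integral_congr_ae (ae_restrict_of_ae_restrict_of_subset Ioc_subset_Ioi_self
      (R.coeFn_compLpL g))
  rw [hR, this, hx, map_add, R.intervalIntegral_comp_comm (intervalIntegrable_L2 g hx0)]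

variable [CompleteSpace K]

theorem HasL2Deriv.unique_of_eq {f g g' : L2 K} {a a' : K} (h : HasL2Deriv f g a)
    (h' : HasL2Deriv f g' a') : g = g' ∧ a = a' := by
  have := h.sub h'
  rw [sub_self] at this
  simpa [sub_eq_zero] using this.unique

variable (K) in
/-- The graph of `f ↦ f'` on `{f ∈ W^{1,2}(ℝ₊, K) : f(0) = 0}`. -/
def derivGraph0 : Submodule ℂ (L2 K × L2 K) where
  carrier := {p | HasL2Deriv p.1 p.2 0}
  zero_mem' := .zero
  add_mem' := by intro p q hp hq; simpa using HasL2Deriv.add hp hq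
  smul_mem' := by intro c p hp; simpa using HasL2Deriv.smul c hp

theorem mem_derivGraph0 {f g : L2 K} : (f, g) ∈ derivGraph0 K ↔ HasL2Deriv f g 0 := Iff.rfl

theorem mem_derivGraph {f g : L2 K} : (f, g) ∈ derivGraph K ↔ ∃ a, HasL2Deriv f g a := Iff.rfl

/-- One direction is the fundamental lemma, the other integration by parts, whose boundary term
vanishes. -/
theorem mem_adjoint_derivGraph0 {f g : L2 K} :
    (f, g) ∈ (derivGraph0 K).adjoint ↔ ∃ a, HasL2Deriv f (-g) a := by
  rw [Submodule.mem_adjoint_iff]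
  constructor
  · intro h
    refine exists_hasL2Deriv_of_inner fun w w' hw => ?_
    rw [inner_neg_right, neg_neg]
    exact sub_eq_zero.mp (h w w' hw)
  · rintro ⟨a, ha⟩ w w' hw
    have := (mem_derivGraph0.mp hw).inner_add ha
    rw [inner_neg_right, inner_zero_left, neg_zero] at this
    linear_combination this

/-! The functions `x ↦ e^{-x} c`. -/

theorem memLp_exp_smul (c : K) :
    MemLp (fun t : ℝ => Real.exp (-t) • c) 2 (volume.restrict (Ioi (0 : ℝ))) := by
  have hm : AEStronglyMeasurable (fun t : ℝ => Real.exp (-t) • c)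
      (volume.restrict (Ioi (0 : ℝ))) := by
    refine Continuous.aestronglyMeasurable ?_
    fun_prop
  rw [memLp_two_iff_integrable_sq_norm hm]
  have h := (exp_neg_integrableOn_Ioi 0 (b := 2) two_pos).mul_const (‖c‖ ^ 2)
  refine Integrable.congr h (Eventually.of_forall fun t => ?_)
  simp only [norm_smul, Real.norm_eq_abs, Real.abs_exp, mul_pow, ← Real.exp_nat_mul]
  congr 2
  push_cast; ring

/-- The function `x ↦ e^{-x} c`. -/
def expL2 (c : K) : L2 K := (memLp_exp_smul c).toLp _

theorem hasL2Deriv_expL2 (c : K) : HasL2Deriv (expL2 c) (-expL2 c) c := by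
  filter_upwards [(memLp_exp_smul c).coeFn_toLp, ae_restrict_mem measurableSet_Ioi] with x hx hx0
  have h1 : ∫ t in (0 : ℝ)..x, (-expL2 c : L2 K) t =
      ∫ t in (0 : ℝ)..x, (-Real.exp (-t)) • c := by
    rw [intervalIntegral.integral_of_le (le_of_lt hx0),
      intervalIntegral.integral_of_le (le_of_lt hx0)]
    refine integral_congr_ae (ae_restrict_of_ae_restrict_of_subset Ioc_subset_Ioi_self ?_)
    filter_upwards [(memLp_exp_smul c).coeFn_toLp, Lp.coeFn_neg (expL2 c)] with t h1 h2
    rw [h2, Pi.neg_apply, expL2, h1, neg_smul]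
  have h2 : ∀ t ∈ uIcc 0 x, HasDerivAt (fun t : ℝ => Real.exp (-t) • c) ((-Real.exp (-t)) • c) t := by
    intro t _
    have := ((Real.hasDerivAt_exp (-t)).comp t (hasDerivAt_neg t)).smul_const c
    simpa using this
  rw [h1, intervalIntegral.integral_eq_sub_of_hasDerivAt h2
    (Continuous.intervalIntegrable (by fun_prop) _ _), expL2, hx]
  simp

/-- Integration by parts: each factor is minus its own derivative. -/
theorem inner_expL2 (c d : K) : ⟪expL2 c, expL2 d⟫_ℂ = ⟪c, d⟫_ℂ / 2 := by
  have := (hasL2Deriv_expL2 c).inner_add (hasL2Deriv_expL2 d)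
  rw [inner_neg_left, inner_neg_right] at this
  linear_combination -this / 2

variable (K) in
/-- `c ↦ e^{-x} c` as a bounded operator. -/
def expCLM : K →L[ℂ] L2 K :=
  LinearMap.mkContinuous
    { toFun := expL2
      map_add' := fun c d => by
        rw [expL2, expL2, expL2, ← MemLp.toLp_add]
        congr 1; funext t; exact smul_add _ _ _
      map_smul' := fun r c => by
        rw [expL2, expL2, RingHom.id_apply, ← MemLp.toLp_const_smul]
        congr 1; funext t; exact smul_comm _ _ _ } 1 (fun c => by
    change ‖expL2 c‖ ≤ 1 * ‖c‖
    have h := congrArg Complex.re (inner_expL2 c c)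
    have h1 : ‖expL2 c‖ ^ 2 = (⟪expL2 c, expL2 c⟫_ℂ).re :=
      (inner_self_eq_norm_sq (𝕜 := ℂ) (expL2 c)).symm
    have h2 : ‖c‖ ^ 2 = (⟪c, c⟫_ℂ).re := (inner_self_eq_norm_sq (𝕜 := ℂ) c).symm
    have h3 : (⟪c, c⟫_ℂ / 2).re = (⟪c, c⟫_ℂ).re / 2 := by simp
    rw [h3] at h
    refine abs_le_of_sq_le_sq' ?_ (by positivity) |>.2
    nlinarith [sq_nonneg ‖c‖])

theorem expCLM_apply (c : K) : expCLM K c = expL2 c := rfl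

/-- Testing with functions that do not vanish at 0 detects the boundary value a of f: the test
function e^{-x} a yields (a, a) = 0. -/
theorem mem_adjoint_derivGraph {f g : L2 K} :
    (f, g) ∈ (derivGraph K).adjoint ↔ HasL2Deriv f (-g) 0 := by
  constructor
  · intro h
    rw [Submodule.mem_adjoint_iff] at h
    have h0 : (f, g) ∈ (derivGraph0 K).adjoint := by
      rw [Submodule.mem_adjoint_iff]
      exact fun w w' hw => h w w' ⟨0, hw⟩
    obtain ⟨a, ha⟩ := mem_adjoint_derivGraph0.mp h0
    have h1 : ⟪-expL2 a, f⟫_ℂ - ⟪expL2 a, g⟫_ℂ = 0 := h _ _ ⟨a, hasL2Deriv_expL2 a⟩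
    have h2 := (hasL2Deriv_expL2 a).inner_add ha
    rw [inner_neg_right (expL2 a) g] at h2
    have h3 : ⟪a, a⟫_ℂ = 0 := by linear_combination h2 - h1
    rwa [inner_self_eq_zero.mp h3] at ha
  · intro ha
    rw [Submodule.mem_adjoint_iff]
    rintro w w' ⟨b, hw⟩
    have := hw.inner_add ha
    rw [inner_neg_right, inner_zero_right, neg_zero] at this
    linear_combination this

theorem isClosed_adjoint {E F : Type*} [NormedAddCommGroup E] [InnerProductSpace ℂ E]
    [NormedAddCommGroup F] [InnerProductSpace ℂ F] (G : Submodule ℂ (E × F)) :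
    IsClosed (G.adjoint : Set (F × E)) := by
  have : (G.adjoint : Set (F × E)) =
      ⋂ p : G, {x : F × E | ⟪p.1.2, x.1⟫_ℂ - ⟪p.1.1, x.2⟫_ℂ = 0} := by
    ext x
    simp only [SetLike.mem_coe, Submodule.mem_adjoint_iff, mem_iInter, mem_ofPred_eq,
      Subtype.forall, Prod.forall]
  rw [this]
  refine isClosed_iInter fun p => isClosed_eq ?_ continuous_const
  fun_prop

theorem isClosed_derivGraph : IsClosed (derivGraph K : Set (L2 K × L2 K)) := by
  have : (derivGraph K : Set (L2 K × L2 K)) =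
      (fun p => (p.1, -p.2)) ⁻¹' ((derivGraph0 K).adjoint : Set (L2 K × L2 K)) := by
    ext ⟨f, g⟩
    simp only [SetLike.mem_coe, mem_preimage, mem_adjoint_derivGraph0, neg_neg]
    exact mem_derivGraph
  rw [this]
  exact (isClosed_adjoint _).preimage (by fun_prop)

theorem isClosed_derivGraph0 : IsClosed (derivGraph0 K : Set (L2 K × L2 K)) := by
  have : (derivGraph0 K : Set (L2 K × L2 K)) =
      (fun p => (p.1, -p.2)) ⁻¹' ((derivGraph K).adjoint : Set (L2 K × L2 K)) := by
    ext ⟨f, g⟩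
    simp only [SetLike.mem_coe, mem_preimage, mem_adjoint_derivGraph, neg_neg]
    exact mem_derivGraph0
  rw [this]
  exact (isClosed_adjoint _).preimage (by fun_prop)

/-- `W^{2,2}(ℝ₊, K)` is the domain of the adjoint of `d²/dx²` on the functions with
`f(0) = f'(0) = 0`. -/
theorem exists_hasL2Deriv_two_of_inner {f g : L2 K}
    (h : ∀ w w' w'' : L2 K, HasL2Deriv w w' 0 → HasL2Deriv w' w'' 0 → ⟪w'', f⟫_ℂ = ⟪w, g⟫_ℂ) :
    ∃ f' a b, HasL2Deriv f f' a ∧ HasL2Deriv f' g b := by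
  -- The equation -u'' + u = r with u(0) = 0 is solvable, by von Neumann's theorem for the
  -- derivative with zero boundary value.
  have solve : ∀ r : L2 K, ∃ u u' b, HasL2Deriv u u' 0 ∧ HasL2Deriv u' (u - r) b := by
    intro r
    obtain ⟨u, v, h1, h2⟩ := exists_mem_adjoint (derivGraph0 K) isClosed_derivGraph0 r
    obtain ⟨b, hb⟩ := mem_adjoint_derivGraph0.mp h2
    exact ⟨u, v, b, h1, by rwa [neg_sub] at hb⟩
  -- This u accounts for the inhomogeneity: k = f - u is orthogonal to every w'' - w, and it must be
  -- shown that k = e^{-x} c.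
  obtain ⟨u, u', b, hu, hu'⟩ := solve (f - g)
  have hk : ∀ w w' w'' : L2 K, HasL2Deriv w w' 0 → HasL2Deriv w' w'' 0 →
      ⟪w'' - w, f - u⟫_ℂ = 0 := by
    intro w w' w'' h1 h2
    have e1 := h w w' w'' h1 h2
    have e2 := h2.inner_add hu
    have e3 := h1.inner_add hu'
    simp only [inner_sub_left, inner_sub_right, inner_zero_left, neg_zero] at e1 e2 e3 ⊢
    linear_combination e1 - e2 + e3
  set k := f - u with hkdef
  -- The factor 2 compensates the 1/2 in `inner_expL2`, so that e^{-x} c is the projection of k onto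
  -- the exponentials.
  set c : K := (2 : ℂ) • ContinuousLinearMap.adjoint (expCLM K) k with hc
  have hr : ∀ d : K, ⟪expL2 d, k - expL2 c⟫_ℂ = 0 := by
    intro d
    rw [inner_sub_right, inner_expL2, hc, inner_smul_right, ContinuousLinearMap.adjoint_inner_right,
      expCLM_apply]
    ring
  set r := k - expL2 c with hrdef
  obtain ⟨y, y', b', hy, hy'⟩ := solve r
  -- Orthogonality of r to e^{-x} b' forces y'(0) = 0. Hence y is an admissible w, and y'' - y = -r
  -- gives (r, k) = 0, whence r = 0.
  have hb' : b' = 0 := by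
    have e1 := (hasL2Deriv_expL2 b').inner_add hy
    have e2 := (hasL2Deriv_expL2 b').inner_add hy'
    have e3 := hr b'
    rw [inner_neg_left, inner_zero_right, neg_zero] at e1
    rw [inner_neg_left, inner_sub_right] at e2
    rw [← inner_self_eq_zero (𝕜 := ℂ)]
    linear_combination e1 + e2 + e3
  subst hb'
  have e1 := hk y y' (y - r) hy hy'
  have e2 : ⟪r, r⟫_ℂ = 0 := by
    have e3 := hr c
    have e4 : ⟪r, expL2 c⟫_ℂ = 0 := by rw [← inner_conj_symm, e3, map_zero]
    rw [sub_sub_cancel_left, inner_neg_left] at e1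
    rw [hrdef, inner_sub_right, ← hrdef, e4]
    linear_combination -e1
  have e3 : k = expL2 c := by
    rw [← sub_eq_zero]; exact inner_self_eq_zero.mp e2
  have hf : f = u + expL2 c := by rw [← e3, hkdef]; abel
  refine ⟨u' + -expL2 c, 0 + c, b + -c, ?_, ?_⟩
  · rw [hf]
    exact hu.add (hasL2Deriv_expL2 c)
  · convert hu'.add (hasL2Deriv_expL2 c).neg using 1
    rw [neg_neg, ← e3, hkdef]; abel

end Derivatives


/-! ### Graphs of the differential operators -/

section SLGraphs

variable {K : Type*} [NormedAddCommGroup K] [InnerProductSpace ℂ K]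

theorem mem_pker {F : Type*} [AddCommGroup F] [Module ℂ F] {A : K →ₗ.[ℂ] F} {u : K} :
    u ∈ pker A ↔ (u, 0) ∈ A.graph := by
  simp only [pker, Submodule.mem_map, LinearMap.mem_ker, LinearPMap.mem_graph_iff]
  constructor
  · rintro ⟨y, hy, rfl⟩; exact ⟨y, rfl, hy⟩
  · rintro ⟨y, rfl, hy⟩; exact ⟨y, hy, rfl⟩

theorem mem_graph_potential {T : K →ₗ.[ℂ] K} {f g : L2 K} :
    (f, g) ∈ (potential T).graph ↔
      ∀ᵐ x ∂(volume.restrict (Ioi (0 : ℝ))), (f x, g x) ∈ T.graph := by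
  rw [potential, Submodule.toLinearPMap_graph_eq]
  · rfl
  · rintro ⟨f, g⟩ h (rfl : f = 0)
    change g = 0
    rw [Lp.eq_zero_iff_ae_eq_zero]
    have h' : ∀ᵐ x ∂(volume.restrict (Ioi (0 : ℝ))), ((0 : L2 K) x, g x) ∈ T.graph := h
    filter_upwards [h', Lp.coeFn_zero K 2 (volume.restrict (Ioi (0 : ℝ)))] with x hx h0
    exact T.graph_fst_eq_zero_snd hx h0

variable [CompleteSpace K]

theorem mem_graph_deriv1 {f g : L2 K} :
    (f, g) ∈ (deriv1 K).graph ↔ ∃ a, HasL2Deriv f g a := by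
  rw [deriv1, Submodule.toLinearPMap_graph_eq]
  · rfl
  · rintro ⟨f, g⟩ ⟨a, h⟩ (rfl : f = 0)
    exact (HasL2Deriv.unique h).1

theorem mem_graph_trace0 {f : L2 K} {a : K} :
    (f, a) ∈ (trace0 K).graph ↔ ∃ g, HasL2Deriv f g a := by
  rw [trace0, Submodule.toLinearPMap_graph_eq]
  · rfl
  · rintro ⟨f, g⟩ ⟨a, h⟩ (rfl : f = 0)
    exact (HasL2Deriv.unique h).2

theorem mem_graph_deriv2 {f g : L2 K} :
    (f, g) ∈ (deriv2 K).graph ↔ ∃ f' a b, HasL2Deriv f f' a ∧ HasL2Deriv f' g b := by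
  rw [deriv2, Submodule.toLinearPMap_graph_eq]
  · constructor
    · rintro ⟨h, ⟨a, ha⟩, ⟨b, hb⟩⟩; exact ⟨h, a, b, ha, hb⟩
    · rintro ⟨h, a, b, ha, hb⟩; exact ⟨h, ⟨a, ha⟩, ⟨b, hb⟩⟩
  · rintro ⟨f, g⟩ ⟨h, ⟨a, ha⟩, ⟨b, hb⟩⟩ (rfl : f = 0)
    have h0 := (HasL2Deriv.unique ha).1
    dsimp only at h0 hb
    subst h0
    exact (HasL2Deriv.unique hb).1

theorem mem_graph_trace1 {f : L2 K} {b : K} :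
    (f, b) ∈ (trace1 K).graph ↔ ∃ f' f'' a, HasL2Deriv f f' a ∧ HasL2Deriv f' f'' b := by
  rw [trace1, Submodule.toLinearPMap_graph_eq]
  · constructor
    · rintro ⟨h, ⟨a, ha⟩, ⟨g, hb⟩⟩; exact ⟨h, g, a, ha, hb⟩
    · rintro ⟨h, g, a, ha, hb⟩; exact ⟨h, ⟨a, ha⟩, ⟨g, hb⟩⟩
  · rintro ⟨f, b⟩ ⟨h, ⟨a, ha⟩, ⟨g, hb⟩⟩ (rfl : f = 0)
    have h0 := (HasL2Deriv.unique ha).1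
    dsimp only at h0 hb
    subst h0
    exact (HasL2Deriv.unique hb).2

/-- `f ∈ W^{2,2}_T(ℝ₊, K)`, `g = -f'' + T f`, `f(0) = a` and `f'(0) = b`. -/
def HasSL (T : K →ₗ.[ℂ] K) (f g : L2 K) (a b : K) : Prop :=
  ∃ f' f'' τ : L2 K, HasL2Deriv f f' a ∧ HasL2Deriv f' f'' b ∧
    (∀ᵐ x ∂(volume.restrict (Ioi (0 : ℝ))), (f x, τ x) ∈ T.graph) ∧ g = -f'' + τ

variable {T : K →ₗ.[ℂ] K} {f g : L2 K}

theorem mem_graph_slExpr : (f, g) ∈ (slExpr T).graph ↔ ∃ a b, HasSL T f g a b := by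
  constructor
  · intro h
    obtain ⟨y, rfl, rfl⟩ := (LinearPMap.mem_graph_iff _).mp h
    obtain ⟨f', a, b, h1, h2⟩ := mem_graph_deriv2.mp ((deriv2 K).mem_graph ⟨y, y.2.1⟩)
    exact ⟨a, b, f', _, _, h1, h2,
      mem_graph_potential.mp ((potential T).mem_graph ⟨y, y.2.2⟩), rfl⟩
  · rintro ⟨a, b, f', f'', τ, h1, h2, h3, rfl⟩
    obtain ⟨y, hy, hy'⟩ := (LinearPMap.mem_graph_iff _).mp
      (mem_graph_deriv2.mpr ⟨f', a, b, h1, h2⟩)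
    obtain ⟨z, hz, hz'⟩ := (LinearPMap.mem_graph_iff _).mp (mem_graph_potential.mpr h3)
    dsimp only at hy hy' hz hz'
    subst hy
    rw [LinearPMap.mem_graph_iff]
    refine ⟨⟨y, y.2, hz ▸ z.2⟩, rfl, ?_⟩
    change -(deriv2 K y) + potential T ⟨y, _⟩ = _
    rw [hy', ← hz']
    congr 2
    exact Subtype.ext hz.symm

theorem mem_pker_trace0 : f ∈ pker (trace0 K) ↔ ∃ f', HasL2Deriv f f' 0 := by
  rw [mem_pker, mem_graph_trace0]

theorem mem_pker_trace1 :
    f ∈ pker (trace1 K) ↔ ∃ f' f'' a, HasL2Deriv f f' a ∧ HasL2Deriv f' f'' 0 := by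
  rw [mem_pker, mem_graph_trace1]

theorem HasSL.mem_pker_trace0_iff {a b : K} (h : HasSL T f g a b) :
    f ∈ pker (trace0 K) ↔ a = 0 := by
  obtain ⟨f', f'', τ, h1, h2, -⟩ := h
  rw [mem_pker_trace0]
  constructor
  · rintro ⟨k, hk⟩; exact (h1.unique_of_eq hk).2
  · rintro rfl; exact ⟨f', h1⟩

theorem HasSL.mem_pker_trace1_iff {a b : K} (h : HasSL T f g a b) :
    f ∈ pker (trace1 K) ↔ b = 0 := by
  obtain ⟨f', f'', τ, h1, h2, -⟩ := h
  rw [mem_pker_trace1]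
  constructor
  · rintro ⟨k, k', a', hk, hk'⟩
    obtain ⟨rfl, -⟩ := h1.unique_of_eq hk
    exact (h2.unique_of_eq hk').2
  · rintro rfl; exact ⟨f', f'', a, h1, h2⟩

theorem mem_graph_dirichlet : (f, g) ∈ (dirichlet T).graph ↔ ∃ b, HasSL T f g 0 b := by
  rw [dirichlet, mem_graph_domRestrict, mem_graph_slExpr]
  constructor
  · rintro ⟨h0, a, b, h⟩
    obtain rfl := h.mem_pker_trace0_iff.mp h0
    exact ⟨b, h⟩
  · rintro ⟨b, h⟩; exact ⟨h.mem_pker_trace0_iff.mpr rfl, 0, b, h⟩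

theorem mem_graph_neumann : (f, g) ∈ (neumann T).graph ↔ ∃ a, HasSL T f g a 0 := by
  rw [neumann, mem_graph_domRestrict, mem_graph_slExpr]
  constructor
  · rintro ⟨h0, a, b, h⟩
    obtain rfl := h.mem_pker_trace1_iff.mp h0
    exact ⟨a, h⟩
  · rintro ⟨a, h⟩; exact ⟨h.mem_pker_trace1_iff.mpr rfl, a, 0, h⟩

theorem mem_graph_minimalBdd : (f, g) ∈ (minimalBdd T).graph ↔ HasSL T f g 0 0 := by
  rw [minimalBdd, mem_graph_domRestrict, mem_graph_slExpr]
  constructor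
  · rintro ⟨⟨h0, h1⟩, a, b, h⟩
    obtain rfl := h.mem_pker_trace0_iff.mp h0
    obtain rfl := h.mem_pker_trace1_iff.mp h1
    exact h
  · intro h
    exact ⟨⟨h.mem_pker_trace0_iff.mpr rfl, h.mem_pker_trace1_iff.mpr rfl⟩, 0, 0, h⟩

theorem minimalBdd_le_dirichlet : minimalBdd T ≤ dirichlet T :=
  LinearPMap.le_of_le_graph fun ⟨_, _⟩ h => mem_graph_dirichlet.mpr ⟨0, mem_graph_minimalBdd.mp h⟩

end SLGraphs

/-! ### Bounded operator coefficients -/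

section Bounded

variable {K : Type*} [NormedAddCommGroup K] [InnerProductSpace ℂ K]

/-- The action `f ↦ R f(·)` of a bounded operator on `L²(ℝ₊, K)`. -/
def mulL2 {K' : Type*} [NormedAddCommGroup K'] [InnerProductSpace ℂ K'] (R : K →L[ℂ] K') :
    L2 K →L[ℂ] L2 K' := R.compLpL 2 (volume.restrict (Ioi (0 : ℝ)))

theorem coeFn_mulL2 {K' : Type*} [NormedAddCommGroup K'] [InnerProductSpace ℂ K']
    (R : K →L[ℂ] K') (f : L2 K) :
    mulL2 R f =ᵐ[volume.restrict (Ioi (0 : ℝ))] fun x => R (f x) := R.coeFn_compLpL f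

theorem HasL2Deriv.mulL2 [CompleteSpace K] {K' : Type*} [NormedAddCommGroup K']
    [InnerProductSpace ℂ K'] [CompleteSpace K'] (R : K →L[ℂ] K') {f g : L2 K} {a : K}
    (h : HasL2Deriv f g a) : HasL2Deriv (mulL2 R f) (mulL2 R g) (R a) := h.compLpL R

theorem inner_mulL2_left {K' : Type*} [NormedAddCommGroup K'] [InnerProductSpace ℂ K']
    {R : K →L[ℂ] K'} {S : K' →L[ℂ] K} (h : ∀ x y, ⟪R x, y⟫_ℂ = ⟪x, S y⟫_ℂ) (f : L2 K) (g : L2 K') :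
    ⟪mulL2 R f, g⟫_ℂ = ⟪f, mulL2 S g⟫_ℂ := by
  rw [L2.inner_def, L2.inner_def]
  refine integral_congr_ae ?_
  filter_upwards [coeFn_mulL2 R f, coeFn_mulL2 S g] with x h1 h2
  rw [h1, h2, h]

theorem mulL2_mulL2 {R S P : K →L[ℂ] K} (h : ∀ x, R (S x) = P x) (f : L2 K) :
    mulL2 R (mulL2 S f) = mulL2 P f := by
  refine Lp.ext ?_
  filter_upwards [coeFn_mulL2 R (mulL2 S f), coeFn_mulL2 S f, coeFn_mulL2 P f] with x h1 h2 h3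
  rw [h1, h2, h3, h]

theorem re_inner_mulL2_nonneg {R : K →L[ℂ] K} (h : ∀ x, 0 ≤ (⟪x, R x⟫_ℂ).re) (f : L2 K) :
    0 ≤ (⟪f, mulL2 R f⟫_ℂ).re := by
  rw [L2.inner_def, ← Complex.reCLM_apply,
    ← ContinuousLinearMap.integral_comp_comm _ (L2.integrable_inner _ _)]
  refine integral_nonneg_of_ae ?_
  filter_upwards [coeFn_mulL2 R f] with x hx
  rw [hx]
  exact h _

/-- An everywhere defined operator as a partially defined one. -/
def bddOp (R : K →L[ℂ] K) : K →ₗ.[ℂ] K := (R : K →ₗ[ℂ] K).toPMap ⊤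

theorem mem_graph_bddOp {R : K →L[ℂ] K} {u v : K} : (u, v) ∈ (bddOp R).graph ↔ R u = v := by
  rw [LinearPMap.mem_graph_iff]
  constructor
  · rintro ⟨y, rfl, rfl⟩; rfl
  · rintro rfl; exact ⟨⟨u, trivial⟩, rfl, rfl⟩

theorem hasSL_bddOp {R : K →L[ℂ] K} {f g : L2 K} {a b : K} :
    HasSL (bddOp R) f g a b ↔
      ∃ f' f'' : L2 K, HasL2Deriv f f' a ∧ HasL2Deriv f' f'' b ∧ g = -f'' + mulL2 R f := by
  have key : ∀ τ : L2 K, (∀ᵐ x ∂(volume.restrict (Ioi (0 : ℝ))), (f x, τ x) ∈ (bddOp R).graph) ↔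
      τ = mulL2 R f := by
    intro τ
    constructor
    · intro h
      refine Lp.ext ?_
      filter_upwards [h, coeFn_mulL2 R f] with x hx h2
      rw [h2, mem_graph_bddOp.mp hx]
    · rintro rfl
      filter_upwards [coeFn_mulL2 R f] with x hx
      exact mem_graph_bddOp.mpr hx.symm
  constructor
  · rintro ⟨f', f'', τ, h1, h2, h3, rfl⟩
    exact ⟨f', f'', h1, h2, by rw [(key τ).mp h3]⟩
  · rintro ⟨f', f'', h1, h2, rfl⟩
    exact ⟨f', f'', _, h1, h2, (key _).mpr rfl, rfl⟩

end Bounded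


/-! ### Bounded perturbations and a density criterion. -/

section Density

variable {E : Type*} [NormedAddCommGroup E] [InnerProductSpace ℂ E] [CompleteSpace E]

/-- A bounded symmetric perturbation of a self-adjoint operator is self-adjoint. -/
theorem isSelfAdjoint_of_add_bounded {A B : E →ₗ.[ℂ] E} (hA : IsSelfAdjoint A) (R : E →L[ℂ] E)
    (hR : ∀ x y, ⟪R x, y⟫_ℂ = ⟪x, R y⟫_ℂ)
    (h : ∀ f g, (f, g) ∈ B.graph ↔ (f, g - R f) ∈ A.graph) : IsSelfAdjoint B := by
  have hA' := isSymm_of_isSelfAdjoint hA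
  refine isSelfAdjoint_of_isSymm ?_ ?_ ?_
  · refine hA.dense_domain.mono fun u hu => ?_
    obtain ⟨v, hv⟩ := LinearPMap.mem_domain_iff.mp hu
    exact LinearPMap.mem_domain_of_mem_graph ((h u (v + R u)).mpr (by simpa using hv))
  · intro u v y z h1 h2
    have := hA' ((h _ _).mp h1) ((h _ _).mp h2)
    rw [inner_sub_left, inner_sub_right, hR] at this
    linear_combination this
  · intro y z hyz
    rw [h]
    refine mem_graph_of_isSelfAdjoint hA fun u v huv => ?_
    have := hyz u (v + R u) ((h _ _).mpr (by simpa using huv))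
    rw [inner_add_left, hR] at this
    rw [inner_sub_right]
    linear_combination this

/-- Density of a subspace of a closed subspace `N` of `E × F`, tested by orthogonality. -/
theorem mem_closure_of_orthogonal {F : Type*} [NormedAddCommGroup F] [InnerProductSpace ℂ F]
    [CompleteSpace F] {M N : Submodule ℂ (E × F)} (hMN : M ≤ N) (hN : IsClosed (N : Set (E × F)))
    (h : ∀ p ∈ N, (∀ q ∈ M, ⟪q.1, p.1⟫_ℂ + ⟪q.2, p.2⟫_ℂ = 0) → p = 0) {p : E × F} (hp : p ∈ N) :
    p ∈ closure (M : Set (E × F)) := by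
  let e := WithLp.linearEquiv 2 ℂ (E × F)
  let M' : Submodule ℂ (WithLp 2 (E × F)) := M.comap e.toLinearMap
  let N' : Submodule ℂ (WithLp 2 (E × F)) := N.comap e.toLinearMap
  have hN' : IsClosed (N' : Set (WithLp 2 (E × F))) :=
    hN.preimage (WithLp.prod_continuous_ofLp 2 E F)
  have hMN' : M' ≤ N' := Submodule.comap_mono hMN
  -- The difference between p and its projection onto the closure of M lies in N and is orthogonal
  -- to M, so it is zero by hypothesis.
  let C := M'.topologicalClosure
  have hCN : C ≤ N' := M'.topologicalClosure_minimal hMN' hN'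
  have : CompleteSpace C := M'.isClosed_topologicalClosure.completeSpace_coe
  let q : WithLp 2 (E × F) := WithLp.toLp 2 p
  have h1 : C.starProjection q ∈ C := Submodule.starProjection_apply_mem _ _
  have h2 : q - C.starProjection q ∈ Cᗮ := Submodule.sub_starProjection_mem_orthogonal q
  have h3 : e (q - C.starProjection q) = 0 := by
    refine h _ ?_ fun r hr => ?_
    · exact N'.sub_mem (show q ∈ N' from hp) (hCN h1)
    · have h4 := h2 (WithLp.toLp 2 r) (M'.le_topologicalClosure hr)
      rw [WithLp.prod_inner_apply] at h4
      exact h4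
  have h4 : q = C.starProjection q := by
    rw [← sub_eq_zero]
    exact (LinearEquiv.map_eq_zero_iff e).mp h3
  have h5 : q ∈ closure (M' : Set (WithLp 2 (E × F))) := by
    rw [h4]; exact h1
  exact (WithLp.prod_continuous_ofLp 2 E F).closure_preimage_subset _ h5

end Density

/-! ### Dirichlet and Neumann operators with a bounded coefficient. -/

section BoundedSL

set_option linter.unusedSectionVars false

variable {K : Type*} [NormedAddCommGroup K] [InnerProductSpace ℂ K] [CompleteSpace K]
  {R : K →L[ℂ] K}

theorem HasL2Deriv.inner_second {f f' f'' k k' : L2 K} {a b c : K} (_h1 : HasL2Deriv f f' a)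
    (h2 : HasL2Deriv f' f'' b) (h3 : HasL2Deriv k k' c) :
    ⟪k, -f''⟫_ℂ = ⟪k', f'⟫_ℂ + ⟪c, b⟫_ℂ := by
  have := h3.inner_add h2
  rw [inner_neg_right]
  linear_combination -this

theorem isSymm_dirichlet_bdd (hs : ∀ x y, ⟪R x, y⟫_ℂ = ⟪x, R y⟫_ℂ) :
    IsSymm (dirichlet (bddOp R)) := by
  intro u v y z h1 h2
  obtain ⟨b, hu⟩ := mem_graph_dirichlet.mp h1
  obtain ⟨d, hy⟩ := mem_graph_dirichlet.mp h2
  obtain ⟨u', u'', e1, e2, rfl⟩ := hasSL_bddOp.mp hu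
  obtain ⟨y', y'', e3, e4, rfl⟩ := hasSL_bddOp.mp hy
  have k1 := e2.inner_add e3
  have k2 := e1.inner_add e4
  rw [inner_add_left, inner_add_right, inner_mulL2_left hs, inner_neg_left, inner_neg_right]
  simp only [inner_zero_left, inner_zero_right] at k1 k2
  linear_combination k2 - k1

theorem isSymm_neumann_bdd (hs : ∀ x y, ⟪R x, y⟫_ℂ = ⟪x, R y⟫_ℂ) :
    IsSymm (neumann (bddOp R)) := by
  intro u v y z h1 h2
  obtain ⟨b, hu⟩ := mem_graph_neumann.mp h1
  obtain ⟨d, hy⟩ := mem_graph_neumann.mp h2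
  obtain ⟨u', u'', e1, e2, rfl⟩ := hasSL_bddOp.mp hu
  obtain ⟨y', y'', e3, e4, rfl⟩ := hasSL_bddOp.mp hy
  have k1 := e2.inner_add e3
  have k2 := e1.inner_add e4
  rw [inner_add_left, inner_add_right, inner_mulL2_left hs, inner_neg_left, inner_neg_right]
  simp only [inner_zero_left, inner_zero_right] at k1 k2
  linear_combination k2 - k1

/-- Moving R f to the right-hand side reduces self-adjointness to R = 0. -/
theorem hasSL_bddOp_iff_zero {f g : L2 K} {a b : K} :
    HasSL (bddOp R) f g a b ↔ HasSL (bddOp (0 : K →L[ℂ] K)) f (g - mulL2 R f) a b := by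
  have h0 : mulL2 (0 : K →L[ℂ] K) f = 0 := by
    refine Lp.ext ?_
    filter_upwards [coeFn_mulL2 (0 : K →L[ℂ] K) f,
      Lp.coeFn_zero K 2 (volume.restrict (Ioi (0 : ℝ)))] with x h1 h2
    rw [h1, h2]; rfl
  simp only [hasSL_bddOp, h0, add_zero, sub_eq_iff_eq_add]

/-- For R = 0 the operator has the form D*D with D the derivative with zero boundary value, so
adding 1 makes it onto; a general R is a bounded symmetric perturbation. -/
theorem isSelfAdjoint_dirichlet_bdd (hs : ∀ x y, ⟪R x, y⟫_ℂ = ⟪x, R y⟫_ℂ) :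
    IsSelfAdjoint (dirichlet (bddOp R)) := by
  have h0 : IsSelfAdjoint (dirichlet (bddOp (0 : K →L[ℂ] K))) := by
    refine isSelfAdjoint_of_surjective (isSymm_dirichlet_bdd (by simp)) fun g => ?_
    obtain ⟨u, v, h1, h2⟩ := exists_mem_adjoint (derivGraph0 K) isClosed_derivGraph0 g
    obtain ⟨b, hb⟩ := mem_adjoint_derivGraph0.mp h2
    refine ⟨u, mem_graph_dirichlet.mpr ⟨b, ?_⟩⟩
    have := (hasSL_bddOp_iff_zero (R := 0) (f := u) (g := g - u + mulL2 0 u) (a := 0) (b := b)).mp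
      (hasSL_bddOp.mpr ⟨v, _, h1, hb, by rw [neg_neg]⟩)
    simpa using this
  refine isSelfAdjoint_of_add_bounded h0 (mulL2 R) (inner_mulL2_left hs) fun f g => ?_
  rw [mem_graph_dirichlet, mem_graph_dirichlet]
  exact exists_congr fun b => hasSL_bddOp_iff_zero

/-- Now D is the derivative without boundary condition; it is the adjoint of D that puts the
condition f'(0) = 0 on the derivative. -/
theorem isSelfAdjoint_neumann_bdd (hs : ∀ x y, ⟪R x, y⟫_ℂ = ⟪x, R y⟫_ℂ) :
    IsSelfAdjoint (neumann (bddOp R)) := by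
  have h0 : IsSelfAdjoint (neumann (bddOp (0 : K →L[ℂ] K))) := by
    refine isSelfAdjoint_of_surjective (isSymm_neumann_bdd (by simp)) fun g => ?_
    obtain ⟨u, v, ⟨a, h1⟩, h2⟩ := exists_mem_adjoint (derivGraph K) isClosed_derivGraph g
    have hb := mem_adjoint_derivGraph.mp h2
    refine ⟨u, mem_graph_neumann.mpr ⟨a, ?_⟩⟩
    have := (hasSL_bddOp_iff_zero (R := 0) (f := u) (g := g - u + mulL2 0 u) (a := a) (b := 0)).mp
      (hasSL_bddOp.mpr ⟨v, _, h1, hb, by rw [neg_neg]⟩)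
    simpa using this
  refine isSelfAdjoint_of_add_bounded h0 (mulL2 R) (inner_mulL2_left hs) fun f g => ?_
  rw [mem_graph_neumann, mem_graph_neumann]
  exact exists_congr fun b => hasSL_bddOp_iff_zero

theorem re_inner_hasSL {f f' f'' : L2 K} {a b : K} (h1 : HasL2Deriv f f' a)
    (h2 : HasL2Deriv f' f'' b) (hab : a = 0 ∨ b = 0) :
    (⟪f, -f'' + mulL2 R f⟫_ℂ).re = ‖f'‖ ^ 2 + (⟪f, mulL2 R f⟫_ℂ).re := by
  rw [inner_add_right, h1.inner_second h2 h1, Complex.add_re, Complex.add_re,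
    show (⟪f', f'⟫_ℂ).re = ‖f'‖ ^ 2 from inner_self_eq_norm_sq (𝕜 := ℂ) f']
  rcases hab with rfl | rfl <;> simp

theorem isNonneg_dirichlet_bdd (h0 : ∀ x, 0 ≤ (⟪x, R x⟫_ℂ).re) :
    IsNonneg (dirichlet (bddOp R)) := by
  rw [isNonneg_iff_graph]
  intro u v h
  obtain ⟨b, hu⟩ := mem_graph_dirichlet.mp h
  obtain ⟨u', u'', e1, e2, rfl⟩ := hasSL_bddOp.mp hu
  rw [re_inner_hasSL e1 e2 (Or.inl rfl)]
  have := re_inner_mulL2_nonneg h0 u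
  positivity

/-- Integration by parts gives (f', Rf'); the boundary term (b, R a) vanishes under either
condition. This sign is the source of all graph norm estimates. -/
theorem re_inner_second_mulL2_nonneg (h0 : ∀ x, 0 ≤ (⟪x, R x⟫_ℂ).re) {f f' f'' : L2 K} {a b : K}
    (h1 : HasL2Deriv f f' a) (h2 : HasL2Deriv f' f'' b) (hab : a = 0 ∨ b = 0) :
    0 ≤ (⟪-f'', mulL2 R f⟫_ℂ).re := by
  have e := h2.inner_add (h1.mulL2 R)
  have e1 : ⟪b, R a⟫_ℂ = 0 := by rcases hab with rfl | rfl <;> simp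
  rw [e1, neg_zero] at e
  have e2 := re_inner_mulL2_nonneg h0 f'
  have e3 : ⟪-f'', mulL2 R f⟫_ℂ = ⟪f', mulL2 R f'⟫_ℂ := by
    rw [inner_neg_left]; linear_combination -e
  rwa [e3]

theorem norm_sq_add_eq {E : Type*} [NormedAddCommGroup E] [InnerProductSpace ℂ E] (x y : E) :
    ‖x + y‖ ^ 2 = ‖x‖ ^ 2 + ‖y‖ ^ 2 + 2 * (⟪x, y⟫_ℂ).re := by
  have := norm_add_sq (𝕜 := ℂ) x y
  simp only [RCLike.re_to_complex] at this
  linarith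

/-- The cross term in the expanded square is nonnegative. The bound does not involve ‖R‖, which lets
it be summed over infinitely many components. -/
theorem norm_sq_le_of_hasSL (h0 : ∀ x, 0 ≤ (⟪x, R x⟫_ℂ).re) {f f' f'' : L2 K} {a b : K}
    (h1 : HasL2Deriv f f' a) (h2 : HasL2Deriv f' f'' b) (hab : a = 0 ∨ b = 0) :
    ‖f''‖ ^ 2 + ‖mulL2 R f‖ ^ 2 ≤ ‖-f'' + mulL2 R f‖ ^ 2 := by
  have := re_inner_second_mulL2_nonneg h0 h1 h2 hab
  rw [norm_sq_add_eq, norm_neg]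
  linarith

/-- Either boundary condition gives ‖f'‖² = (f, -f''). The first derivative is thus controlled
without a term of its own in the norm. -/
theorem norm_sq_deriv_le {f f' f'' : L2 K} {a b : K} (h1 : HasL2Deriv f f' a)
    (h2 : HasL2Deriv f' f'' b) (hab : a = 0 ∨ b = 0) : ‖f'‖ ^ 2 ≤ ‖f‖ * ‖f''‖ := by
  have h3 := h1.inner_second h2 h1
  have e1 : ⟪a, b⟫_ℂ = 0 := by rcases hab with rfl | rfl <;> simp
  rw [e1, add_zero] at h3
  rw [show ‖f'‖ ^ 2 = (⟪f', f'⟫_ℂ).re from (inner_self_eq_norm_sq (𝕜 := ℂ) f').symm, ← h3]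
  have := re_inner_le_norm (𝕜 := ℂ) f (-f'')
  rwa [norm_neg] at this

/-! The domain of the minimal operator. -/

variable (K) in
/-- The graph of `f ↦ f''` on `{f ∈ W^{2,2}(ℝ₊, K) : f(0) = f'(0) = 0}`. -/
def deriv2Graph00 : Submodule ℂ (L2 K × L2 K) where
  carrier := {p | ∃ h, HasL2Deriv p.1 h 0 ∧ HasL2Deriv h p.2 0}
  zero_mem' := ⟨0, .zero, .zero⟩
  add_mem' := by
    rintro p q ⟨h, h1, h2⟩ ⟨k, k1, k2⟩
    exact ⟨h + k, by simpa using h1.add k1, by simpa using h2.add k2⟩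
  smul_mem' := by
    rintro c p ⟨h, h1, h2⟩
    exact ⟨c • h, by simpa using h1.smul c, by simpa using h2.smul c⟩

theorem mem_deriv2Graph00 {f g : L2 K} :
    (f, g) ∈ deriv2Graph00 K ↔ ∃ h, HasL2Deriv f h 0 ∧ HasL2Deriv h g 0 := Iff.rfl

/-- The interpolation inequality makes the first derivatives of a convergent sequence Cauchy. -/
theorem isClosed_deriv2Graph00 : IsClosed (deriv2Graph00 K : Set (L2 K × L2 K)) := by
  refine isClosed_of_closure_subset fun p hp => ?_
  obtain ⟨s, hs, hsp⟩ := mem_closure_iff_seq_limit.mp hp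
  choose h h1 h2 using hs
  have l1 : Tendsto (fun n => (s n).1) atTop (𝓝 p.1) := (continuous_fst.tendsto p).comp hsp
  have l2 : Tendsto (fun n => (s n).2) atTop (𝓝 p.2) := (continuous_snd.tendsto p).comp hsp
  have hc : CauchySeq h := by
    rw [Metric.cauchySeq_iff]
    intro ε hε
    obtain ⟨N1, hN1⟩ := Metric.cauchySeq_iff.mp l1.cauchySeq ε hε
    obtain ⟨N2, hN2⟩ := Metric.cauchySeq_iff.mp l2.cauchySeq ε hε
    refine ⟨max N1 N2, fun m hm n hn => ?_⟩
    have e1 := hN1 m (le_of_max_le_left hm) n (le_of_max_le_left hn)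
    have e2 := hN2 m (le_of_max_le_right hm) n (le_of_max_le_right hn)
    have e3 := norm_sq_deriv_le ((h1 m).sub (h1 n)) ((h2 m).sub (h2 n)) (Or.inl (sub_zero 0))
    rw [dist_eq_norm] at e1 e2 ⊢
    have e4 : ‖h m - h n‖ ^ 2 < ε ^ 2 := by
      refine e3.trans_lt ?_
      rw [sq]
      exact mul_lt_mul'' e1 e2 (norm_nonneg _) (norm_nonneg _)
    exact lt_of_pow_lt_pow_left₀ 2 hε.le e4
  obtain ⟨k, hk⟩ := cauchySeq_tendsto_of_complete hc
  exact ⟨k, isClosed_derivGraph0.mem_of_tendsto (l1.prodMk_nhds hk) (Eventually.of_forall h1),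
    isClosed_derivGraph0.mem_of_tendsto (hk.prodMk_nhds l2) (Eventually.of_forall h2)⟩

/-- The function `φ(x) h`. -/
def tensorL2 (φ : L2 ℂ) (h : K) : L2 K := mulL2 (ContinuousLinearMap.toSpanSingleton ℂ h) φ

theorem coeFn_tensorL2 (φ : L2 ℂ) (h : K) :
    tensorL2 φ h =ᵐ[volume.restrict (Ioi (0 : ℝ))] fun x => φ x • h :=
  coeFn_mulL2 _ φ

variable (K) in
/-- The span of the pairs `(φ h, φ'' h)`, where `φ(0) = φ'(0) = 0`. -/
def tensorGraph : Submodule ℂ (L2 K × L2 K) :=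
  Submodule.span ℂ {p | ∃ q ∈ deriv2Graph00 ℂ, ∃ h : K, p = (tensorL2 q.1 h, tensorL2 q.2 h)}

theorem tensorGraph_le : tensorGraph K ≤ deriv2Graph00 K := by
  refine Submodule.span_le.mpr ?_
  rintro _ ⟨q, ⟨k, h1, h2⟩, h, rfl⟩
  exact ⟨_, by simpa [tensorL2] using h1.mulL2 (ContinuousLinearMap.toSpanSingleton ℂ h),
    by simpa [tensorL2] using h2.mulL2 (ContinuousLinearMap.toSpanSingleton ℂ h)⟩

/-- If (u, v) is orthogonal to all tensors, test for each h with φ = (h, u(·)), which is itself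
admissible: its norm is 0, so u vanishes weakly. -/
theorem mem_closure_tensorGraph {p : L2 K × L2 K} (hp : p ∈ deriv2Graph00 K) :
    p ∈ closure (tensorGraph K : Set (L2 K × L2 K)) := by
  refine mem_closure_of_orthogonal (E := L2 K) (F := L2 K) (M := tensorGraph K)
    (N := deriv2Graph00 K) tensorGraph_le isClosed_deriv2Graph00 ?_ hp
  rintro ⟨u, v⟩ ⟨k, h1, h2⟩ horth
  dsimp only at h1 h2
  have hadj : ∀ (h : K) (φ : L2 ℂ) (f : L2 K),
      ⟪tensorL2 φ h, f⟫_ℂ = ⟪φ, mulL2 (innerSL ℂ h) f⟫_ℂ := fun h φ f =>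
    inner_mulL2_left (fun c y => by simp) φ f
  have hz : ∀ h : K, mulL2 (innerSL ℂ h) u = 0 := by
    intro h
    have h3 : (mulL2 (innerSL ℂ h) u, mulL2 (innerSL ℂ h) v) ∈ deriv2Graph00 ℂ :=
      ⟨_, by simpa using h1.mulL2 (innerSL ℂ h), by simpa using h2.mulL2 (innerSL ℂ h)⟩
    have h4 := horth _ (Submodule.subset_span ⟨_, h3, h, rfl⟩)
    rw [hadj, hadj] at h4
    have h5 := congrArg Complex.re h4
    rw [Complex.add_re,
      show ∀ x : L2 ℂ, (⟪x, x⟫_ℂ).re = ‖x‖ ^ 2 from fun x => inner_self_eq_norm_sq (𝕜 := ℂ) x,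
      show ∀ x : L2 ℂ, (⟪x, x⟫_ℂ).re = ‖x‖ ^ 2 from fun x => inner_self_eq_norm_sq (𝕜 := ℂ) x,
      Complex.zero_re] at h5
    have h6 : ‖mulL2 (innerSL ℂ h) u‖ ^ 2 = 0 :=
      le_antisymm (by nlinarith [sq_nonneg ‖mulL2 (innerSL ℂ h) v‖]) (sq_nonneg _)
    simpa using h6
  have hu : u = 0 := by
    rw [Lp.eq_zero_iff_ae_eq_zero]
    -- The exceptional null set depends on h; passing to the integrals over (0, x] avoids having to
    -- choose one for all h.
    refine ae_eq_zero_of_primitive (fun x hx => intervalIntegrable_L2 u hx) fun x hx => ?_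
    refine ext_inner_left ℂ fun h => ?_
    rw [inner_zero_right, intervalIntegral.integral_of_le hx.le, ← integral_inner
      (integrableOn_L2 u x)]
    rw [← integral_zero ℝ ℂ (μ := volume.restrict (Ioc 0 x))]
    refine integral_congr_ae (ae_restrict_of_ae_restrict_of_subset Ioc_subset_Ioi_self ?_)
    have h7 := coeFn_mulL2 (innerSL ℂ h) u
    rw [hz h] at h7
    filter_upwards [h7, Lp.coeFn_zero ℂ 2 (volume.restrict (Ioi (0 : ℝ)))] with t h8 h9
    rw [h9] at h8
    exact h8.symm
  subst hu
  obtain ⟨rfl, -⟩ := h1.unique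
  obtain ⟨rfl, -⟩ := h2.unique
  rfl

end BoundedSL


/-! ### The Friedrichs extension for a bounded coefficient. -/

section BoundedFriedrichs

variable {K : Type*} [NormedAddCommGroup K] [InnerProductSpace ℂ K]

theorem re_inner_self_eq {E : Type*} [NormedAddCommGroup E] [InnerProductSpace ℂ E] (x : E) :
    (⟪x, x⟫_ℂ).re = ‖x‖ ^ 2 := inner_self_eq_norm_sq (𝕜 := ℂ) x

theorem eq_zero_of_inner_add {E F : Type*} [NormedAddCommGroup E] [InnerProductSpace ℂ E]
    [NormedAddCommGroup F] [InnerProductSpace ℂ F] {x : E} {y : F}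
    (h : ⟪x, x⟫_ℂ + ⟪y, y⟫_ℂ = 0) : x = 0 ∧ y = 0 := by
  have h1 := congrArg Complex.re h
  rw [Complex.add_re, re_inner_self_eq, re_inner_self_eq, Complex.zero_re] at h1
  have h2 : ‖x‖ ^ 2 = 0 := by nlinarith [sq_nonneg ‖x‖, sq_nonneg ‖y‖]
  have h3 : ‖y‖ ^ 2 = 0 := by nlinarith [sq_nonneg ‖x‖, sq_nonneg ‖y‖]
  exact ⟨by simpa using h2, by simpa using h3⟩

variable (K) in
/-- The graph of `f ↦ f'` on `{f ∈ W^{2,2}(ℝ₊, K) : f(0) = f'(0) = 0}`. -/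
def deriv1Graph00 : Submodule ℂ (L2 K × L2 K) where
  carrier := {p | HasL2Deriv p.1 p.2 0 ∧ ∃ h, HasL2Deriv p.2 h 0}
  zero_mem' := ⟨.zero, 0, .zero⟩
  add_mem' := by
    rintro p q ⟨h1, h, h2⟩ ⟨k1, k, k2⟩
    exact ⟨by simpa using h1.add k1, h + k, by simpa using h2.add k2⟩
  smul_mem' := by
    rintro c p ⟨h1, h, h2⟩
    exact ⟨by simpa using h1.smul c, c • h, by simpa using h2.smul c⟩

variable [CompleteSpace K] {R : K →L[ℂ] K}

/-- An element (y, y') orthogonal to the smaller graph satisfies y'' = y by the second-order duality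
lemma. As y(0) = 0, integration by parts leaves ‖y'‖² + ‖y‖² = 0. -/
theorem mem_closure_deriv1Graph00 {p : L2 K × L2 K} (hp : p ∈ derivGraph0 K) :
    p ∈ closure (deriv1Graph00 K : Set (L2 K × L2 K)) := by
  refine mem_closure_of_orthogonal (E := L2 K) (F := L2 K) (M := deriv1Graph00 K)
    (N := derivGraph0 K) (fun p h => h.1) isClosed_derivGraph0 ?_ hp
  rintro ⟨y, y'⟩ hy horth
  have hy0 : HasL2Deriv y y' 0 := hy
  obtain ⟨f', a, b, h1, h2⟩ := exists_hasL2Deriv_two_of_inner (f := y) (g := y)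
    fun w w' w'' h1 h2 => by
      have e1 : ⟪w, y⟫_ℂ + ⟪w', y'⟫_ℂ = 0 := horth (w, w') ⟨h1, w'', h2⟩
      have e2 := h2.inner_add hy0
      rw [inner_zero_left, neg_zero] at e2
      linear_combination e2 - e1
  obtain ⟨rfl, rfl⟩ := hy0.unique_of_eq h1
  have e := h1.inner_add h2
  rw [inner_zero_left, neg_zero] at e
  obtain ⟨rfl, rfl⟩ := eq_zero_of_inner_add e
  rfl

/-- The form is ‖u'‖² + (u, Ru), which is continuous in the W^{1,2} norm because R is bounded; so
density in that norm is enough. -/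
theorem isFormCore_dirichlet_bdd :
    IsFormCore 1 0 (minimalBdd (bddOp R)) (dirichlet (bddOp R)) := by
  intro u v huv ε hε
  obtain ⟨b, hu⟩ := mem_graph_dirichlet.mp huv
  obtain ⟨u', u'', h1, h2, rfl⟩ := hasSL_bddOp.mp hu
  obtain ⟨s, hs, hsu⟩ := mem_closure_iff_seq_limit.mp
    (mem_closure_deriv1Graph00 (mem_derivGraph0.mpr h1))
  have l1 : Tendsto (fun n => u - (s n).1) atTop (𝓝 0) := by
    have := (tendsto_const_nhds (x := u)).sub ((continuous_fst.tendsto _).comp hsu)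
    simpa using this
  have l2 : Tendsto (fun n => u' - (s n).2) atTop (𝓝 0) := by
    have := (tendsto_const_nhds (x := u')).sub ((continuous_snd.tendsto _).comp hsu)
    simpa using this
  have l3 : Tendsto (fun n => ‖u' - (s n).2‖ ^ 2 +
      (⟪u - (s n).1, mulL2 R (u - (s n).1)⟫_ℂ).re) atTop (𝓝 0) := by
    have := (l2.norm.pow 2).add ((Complex.continuous_re.tendsto _).comp
      (l1.inner (((mulL2 R).continuous.tendsto _).comp l1) (𝕜 := ℂ)))
    simpa using this
  have l4 := l1.norm
  rw [norm_zero] at l4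
  obtain ⟨n, hn1, hn2⟩ := ((l4.eventually (gt_mem_nhds hε)).and
    (l3.eventually (gt_mem_nhds hε))).exists
  obtain ⟨k1, k, k2⟩ := hs n
  refine ⟨(s n).1, -k + mulL2 R (s n).1, mem_graph_minimalBdd.mpr
    (hasSL_bddOp.mpr ⟨_, _, k1, k2, rfl⟩), by simpa using hn1, ?_⟩
  have e := re_inner_hasSL (R := R) (h1.sub k1) (h2.sub k2) (Or.inl (sub_zero 0))
  rw [← e] at hn2
  have e' : (-u'' + mulL2 R u) - (-k + mulL2 R (s n).1) =
      -(u'' - k) + mulL2 R (u - (s n).1) := by rw [map_sub]; abel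
  rw [e']
  exact hn2

theorem isNonnegSAExtension_dirichlet_bdd (hs : ∀ x y, ⟪R x, y⟫_ℂ = ⟪x, R y⟫_ℂ)
    (h0 : ∀ x, 0 ≤ (⟪x, R x⟫_ℂ).re) :
    IsNonnegSAExtension (minimalBdd (bddOp R)) (dirichlet (bddOp R)) :=
  ⟨minimalBdd_le_dirichlet, isSelfAdjoint_dirichlet_bdd hs, isNonneg_dirichlet_bdd h0⟩

end BoundedFriedrichs

/-! ### The Krein extension for a bounded coefficient, by factorization. -/

section BoundedKrein

set_option linter.unusedSectionVars false

variable {K : Type*} [NormedAddCommGroup K] [InnerProductSpace ℂ K] [CompleteSpace K]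
  {R ρ : K →L[ℂ] K}

theorem HasL2Deriv.eq_zero_of_zero {p : L2 K} (h : HasL2Deriv p 0 0) : p = 0 := by
  rw [Lp.eq_zero_iff_ae_eq_zero]
  filter_upwards [h, HasL2Deriv.zero (H := K),
    Lp.coeFn_zero K 2 (volume.restrict (Ioi (0 : ℝ)))] with x h1 h2 h3
  rw [h1, ← h2, h3]

/-- If `ρ ≥ 0`, then `p' = ρ p` has no nontrivial solution in `L²(ℝ₊, K)`. -/
theorem eq_zero_of_hasL2Deriv_mulL2 (hs : ∀ x y, ⟪ρ x, y⟫_ℂ = ⟪x, ρ y⟫_ℂ)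
    (h0 : ∀ x, 0 ≤ (⟪x, ρ x⟫_ℂ).re) {p : L2 K} {c : K} (h : HasL2Deriv p (mulL2 ρ p) c) :
    p = 0 := by
  -- Integration by parts gives 2(p, ρp) = -‖c‖², so both sides vanish.
  have e1 := h.inner_add h
  rw [inner_mulL2_left hs] at e1
  have e2 := congrArg Complex.re e1
  rw [Complex.add_re, Complex.neg_re, re_inner_self_eq] at e2
  have e3 := re_inner_mulL2_nonneg h0 p
  have e4 : ‖c‖ ^ 2 = 0 := by nlinarith [sq_nonneg ‖c‖]
  have e5 : (⟪p, mulL2 ρ p⟫_ℂ).re = 0 := by nlinarith [sq_nonneg ‖c‖]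
  have hc : c = 0 := by simpa using e4
  have hA : IsNonneg (bddOp (mulL2 ρ)) := isNonneg_iff_graph.mpr fun u v huv => by
    rw [← mem_graph_bddOp.mp huv]
    exact re_inner_mulL2_nonneg h0 u
  have hA' : IsSymm (bddOp (mulL2 ρ)) := fun u v y z h1 h2 => by
    rw [← mem_graph_bddOp.mp h1, ← mem_graph_bddOp.mp h2]
    exact inner_mulL2_left hs u y
  -- Cauchy-Schwarz for the form of ρ upgrades (p, ρp) = 0 to ρp = 0, so p has zero derivative and
  -- zero initial value.
  have e6 := hA.sq_re_inner_le hA' (mem_graph_bddOp.mpr (rfl : mulL2 ρ p = mulL2 ρ p))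
    (mem_graph_bddOp.mpr (rfl : mulL2 ρ (mulL2 ρ p) = mulL2 ρ (mulL2 ρ p)))
  rw [e5, zero_mul, ← inner_mulL2_left hs, re_inner_self_eq] at e6
  have e7 : ‖mulL2 ρ p‖ ^ 2 = 0 := by
    have := le_antisymm e6 (sq_nonneg _)
    exact pow_eq_zero_iff two_ne_zero |>.mp this
  have e8 : mulL2 ρ p = 0 := by simpa using e7
  rw [e8, hc] at h
  exact h.eq_zero_of_zero

/-- The graph of `f ↦ f' + ρ f` on `W^{1,2}(ℝ₊, K)`. -/
def factorGraph (ρ : K →L[ℂ] K) : Submodule ℂ (L2 K × L2 K) where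
  carrier := {p | ∃ a, HasL2Deriv p.1 (p.2 - mulL2 ρ p.1) a}
  zero_mem' := ⟨0, by simpa using HasL2Deriv.zero⟩
  add_mem' := by
    rintro p q ⟨a, h⟩ ⟨b, k⟩
    have e : (p + q).2 - mulL2 ρ (p + q).1 = p.2 - mulL2 ρ p.1 + (q.2 - mulL2 ρ q.1) := by
      rw [Prod.fst_add, Prod.snd_add, map_add]; abel
    exact ⟨a + b, e ▸ h.add k⟩
  smul_mem' := by
    rintro c p ⟨a, h⟩
    have e : (c • p).2 - mulL2 ρ (c • p).1 = c • (p.2 - mulL2 ρ p.1) := by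
      rw [Prod.smul_fst, Prod.smul_snd, map_smul, smul_sub]
    exact ⟨c • a, e ▸ h.smul c⟩

theorem mem_factorGraph {f y : L2 K} :
    (f, y) ∈ factorGraph ρ ↔ ∃ a, HasL2Deriv f (y - mulL2 ρ f) a := Iff.rfl

theorem isClosed_factorGraph : IsClosed (factorGraph ρ : Set (L2 K × L2 K)) :=
  (isClosed_derivGraph (K := K)).preimage
    (f := fun p : L2 K × L2 K => (p.1, p.2 - mulL2 ρ p.1)) (by fun_prop)

/-- The bounded symmetric term ρ moves across the inner product and leaves the adjoint of the
derivative, which imposes the boundary condition. -/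
theorem mem_adjoint_factorGraph (hs : ∀ x y, ⟪ρ x, y⟫_ℂ = ⟪x, ρ y⟫_ℂ) {y z : L2 K} :
    (y, z) ∈ (factorGraph ρ).adjoint ↔ HasL2Deriv y (mulL2 ρ y - z) 0 := by
  rw [← neg_sub, ← mem_adjoint_derivGraph, Submodule.mem_adjoint_iff, Submodule.mem_adjoint_iff]
  constructor
  · rintro h f f' ⟨a, hf⟩
    have := h f (f' + mulL2 ρ f) ⟨a, by simpa using hf⟩
    rw [inner_add_left, inner_mulL2_left hs] at this
    rw [inner_sub_right]
    linear_combination this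
  · rintro h f y' ⟨a, hf⟩
    have := h f (y' - mulL2 ρ f) ⟨a, hf⟩
    rw [inner_sub_left, inner_mulL2_left hs, inner_sub_right] at this
    linear_combination this

theorem isClosed_adjoint_factorGraph :
    IsClosed ((factorGraph ρ).adjoint : Set (L2 K × L2 K)) := isClosed_adjoint _

/-- `L* L` with `L f = f' + ρ f` on `W^{1,2}(ℝ₊, K)`, i.e. `-f'' + ρ² f` with the boundary condition
`f'(0) + ρ f(0) = 0`. -/
def kreinBdd (ρ : K →L[ℂ] K) : L2 K →ₗ.[ℂ] L2 K :=
  Submodule.toLinearPMap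
    { carrier := {p | ∃ y, (p.1, y) ∈ factorGraph ρ ∧ (y, p.2) ∈ (factorGraph ρ).adjoint}
      zero_mem' := ⟨0, Submodule.zero_mem _, Submodule.zero_mem _⟩
      add_mem' := by
        rintro p q ⟨h, h1, h2⟩ ⟨k, k1, k2⟩
        exact ⟨h + k, Submodule.add_mem _ h1 k1, Submodule.add_mem _ h2 k2⟩
      smul_mem' := by
        rintro c p ⟨h, h1, h2⟩
        exact ⟨c • h, Submodule.smul_mem _ c h1, Submodule.smul_mem _ c h2⟩ }

theorem mem_graph_kreinBdd (hs : ∀ x y, ⟪ρ x, y⟫_ℂ = ⟪x, ρ y⟫_ℂ) {f g : L2 K} :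
    (f, g) ∈ (kreinBdd ρ).graph ↔
      ∃ y, (f, y) ∈ factorGraph ρ ∧ (y, g) ∈ (factorGraph ρ).adjoint := by
  rw [kreinBdd, Submodule.toLinearPMap_graph_eq]
  · rfl
  · rintro ⟨f, g⟩ ⟨y, ⟨a, h1⟩, h2⟩ (rfl : f = 0)
    dsimp only at h1 h2
    have h3 := h1.unique.1
    rw [map_zero, sub_zero] at h3
    subst h3
    rw [mem_adjoint_factorGraph hs] at h2
    have h4 := h2.unique.1
    rw [map_zero, zero_sub, neg_eq_zero] at h4
    exact h4

theorem inner_factorGraph {f y k l : L2 K} (h1 : (f, y) ∈ factorGraph ρ)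
    (h2 : (k, l) ∈ (factorGraph ρ).adjoint) : ⟪f, l⟫_ℂ = ⟪y, k⟫_ℂ := by
  have := (Submodule.mem_adjoint_iff _ _).mp h2 f y h1
  dsimp only at this
  linear_combination -this

theorem isSymm_kreinBdd (hs : ∀ x y, ⟪ρ x, y⟫_ℂ = ⟪x, ρ y⟫_ℂ) : IsSymm (kreinBdd ρ) := by
  intro u v y z h1 h2
  obtain ⟨p, p1, p2⟩ := (mem_graph_kreinBdd hs).mp h1
  obtain ⟨q, q1, q2⟩ := (mem_graph_kreinBdd hs).mp h2
  rw [inner_factorGraph p1 q2, ← inner_conj_symm, inner_factorGraph q1 p2, inner_conj_symm]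

/-- For f(0) = f'(0) = 0 the function f' + ρf vanishes at 0, and -(f' + ρf)' + ρ(f' + ρf) = -f'' +
ρ²f. Self-adjointness is von Neumann's theorem for L, and the form is ‖Lf‖². -/
theorem isNonnegSAExtension_kreinBdd (hs : ∀ x y, ⟪ρ x, y⟫_ℂ = ⟪x, ρ y⟫_ℂ)
    (hR : ∀ x, ρ (ρ x) = R x) : IsNonnegSAExtension (minimalBdd (bddOp R)) (kreinBdd ρ) where
  le := by
    refine LinearPMap.le_of_le_graph ?_
    rintro ⟨f, g⟩ h
    obtain ⟨f', f'', h1, h2, rfl⟩ := hasSL_bddOp.mp (mem_graph_minimalBdd.mp h)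
    refine (mem_graph_kreinBdd hs).mpr ⟨f' + mulL2 ρ f, ⟨0, by simpa using h1⟩, ?_⟩
    rw [mem_adjoint_factorGraph hs]
    convert h2.add (h1.mulL2 ρ) using 1
    · rw [map_add, mulL2_mulL2 hR]; abel
    · simp
  selfAdjoint := by
    refine isSelfAdjoint_of_surjective (isSymm_kreinBdd hs) fun g => ?_
    obtain ⟨u, v, h1, h2⟩ := exists_mem_adjoint (factorGraph ρ) isClosed_factorGraph g
    exact ⟨u, (mem_graph_kreinBdd hs).mpr ⟨v, h1, h2⟩⟩
  nonneg := by
    rw [isNonneg_iff_graph]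
    intro u v h
    obtain ⟨p, p1, p2⟩ := (mem_graph_kreinBdd hs).mp h
    rw [inner_factorGraph p1 p2, re_inner_self_eq]
    positivity

/-- The pairs `(w' + ρ w, -w'' + ρ² w)`, where `w(0) = w'(0) = 0`. -/
def factorCore (ρ : K →L[ℂ] K) : Submodule ℂ (L2 K × L2 K) where
  carrier := {p | ∃ w w' w'', HasL2Deriv w w' 0 ∧ HasL2Deriv w' w'' 0 ∧
    p.1 = w' + mulL2 ρ w ∧ p.2 = -w'' + mulL2 ρ (mulL2 ρ w)}
  zero_mem' := ⟨0, 0, 0, .zero, .zero, by simp, by simp⟩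
  add_mem' := by
    rintro p q ⟨w, w', w'', h1, h2, h3, h4⟩ ⟨k, k', k'', k1, k2, k3, k4⟩
    refine ⟨w + k, w' + k', w'' + k'', by simpa using h1.add k1, by simpa using h2.add k2, ?_, ?_⟩
    · rw [Prod.fst_add, h3, k3, map_add]; abel
    · rw [Prod.snd_add, h4, k4, map_add, map_add]; abel
  smul_mem' := by
    rintro c p ⟨w, w', w'', h1, h2, h3, h4⟩
    refine ⟨c • w, c • w', c • w'', by simpa using h1.smul c, by simpa using h2.smul c, ?_, ?_⟩
    · rw [Prod.smul_fst, h3, map_smul, smul_add]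
    · rw [Prod.smul_snd, h4, map_smul, map_smul, smul_add, smul_neg]

/-- Let (y, z) in the graph of L* be orthogonal to the core. Then z'' = z + ρ²z, and q = z' + ρz
satisfies q' = z + ρq, while y' = ρy - z. Hence y + q solves p' = ρp and vanishes. As y(0) = 0, also
q(0) = 0, and integrating by parts gives ‖z‖² + ‖q‖² = 0. -/
theorem mem_closure_factorCore (hs : ∀ x y, ⟪ρ x, y⟫_ℂ = ⟪x, ρ y⟫_ℂ)
    (h0 : ∀ x, 0 ≤ (⟪x, ρ x⟫_ℂ).re) {p : L2 K × L2 K} (hp : p ∈ (factorGraph ρ).adjoint) :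
    p ∈ closure (factorCore ρ : Set (L2 K × L2 K)) := by
  refine mem_closure_of_orthogonal (E := L2 K) (F := L2 K) (M := factorCore ρ)
    (N := (factorGraph ρ).adjoint) ?_ isClosed_adjoint_factorGraph ?_ hp
  · rintro ⟨y, z⟩ ⟨w, w', w'', h1, h2, h3, h4⟩
    dsimp only at h3 h4
    rw [mem_adjoint_factorGraph hs, h3, h4]
    convert h2.add (h1.mulL2 ρ) using 1
    · rw [map_add]; abel
    · simp
  · rintro ⟨y, z⟩ hyz horth
    have hy := (mem_adjoint_factorGraph hs).mp hyz
    obtain ⟨z', a, b, k1, k2⟩ := exists_hasL2Deriv_two_of_inner (f := z)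
      (g := z + mulL2 ρ (mulL2 ρ z)) fun w w' w'' h1 h2 => by
        have e1 : ⟪w' + mulL2 ρ w, y⟫_ℂ + ⟪-w'' + mulL2 ρ (mulL2 ρ w), z⟫_ℂ = 0 :=
          horth (_, _) ⟨w, w', w'', h1, h2, rfl, rfl⟩
        have e2 := inner_factorGraph
          (mem_factorGraph.mpr ⟨0, by simpa using h1⟩ : (w, w' + mulL2 ρ w) ∈ factorGraph ρ) hyz
        rw [← e2, inner_add_left, inner_neg_left, inner_mulL2_left hs, inner_mulL2_left hs] at e1
        rw [inner_add_right]
        linear_combination -e1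
    have hq := k2.add (k1.mulL2 ρ)
    have hp : HasL2Deriv (y + (z' + mulL2 ρ z)) (mulL2 ρ (y + (z' + mulL2 ρ z)))
        (0 + (b + ρ a)) := by
      convert hy.add hq using 1
      rw [map_add, map_add]; abel
    have hp0 := eq_zero_of_hasL2Deriv_mulL2 hs h0 hp
    rw [hp0] at hp
    have hb := hp.unique.2
    rw [zero_add] at hb
    rw [hb] at hq
    have e := k1.inner_add hq
    have i1 := inner_mulL2_left hs z (mulL2 ρ z)
    have i2 := inner_mulL2_left hs z z'
    rw [inner_zero_right, neg_zero] at e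
    simp only [inner_add_right] at e
    have e' : ⟪z, z⟫_ℂ + ⟪z' + mulL2 ρ z, z' + mulL2 ρ z⟫_ℂ = 0 := by
      simp only [inner_add_left, inner_add_right]
      linear_combination e + i1 + i2
    obtain ⟨hz, hq0⟩ := eq_zero_of_inner_add e'
    rw [hq0, add_zero] at hp0
    rw [hp0, hz]; rfl

/-- The form of L*L at u - w is ‖Lu - Lw‖², so what is needed is to approximate (Lu, L*Lu) by pairs
(Lw, L*Lw) in the graph of L*. -/
theorem isFormCore_kreinBdd (hs : ∀ x y, ⟪ρ x, y⟫_ℂ = ⟪x, ρ y⟫_ℂ)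
    (h0 : ∀ x, 0 ≤ (⟪x, ρ x⟫_ℂ).re) (hR : ∀ x, ρ (ρ x) = R x) :
    IsFormCore 0 1 (minimalBdd (bddOp R)) (kreinBdd ρ) := by
  intro u v huv ε hε
  obtain ⟨y, h1, h2⟩ := (mem_graph_kreinBdd hs).mp huv
  obtain ⟨s, hss, hsu⟩ := mem_closure_iff_seq_limit.mp (mem_closure_factorCore hs h0 h2)
  have l1 : Tendsto (fun n => ‖y - (s n).1‖ ^ 2) atTop (𝓝 0) := by
    have := (((tendsto_const_nhds (x := y)).sub ((continuous_fst.tendsto _).comp hsu)).norm).pow 2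
    simpa using this
  have l2 : Tendsto (fun n => ‖v - (s n).2‖) atTop (𝓝 0) := by
    have := ((tendsto_const_nhds (x := v)).sub ((continuous_snd.tendsto _).comp hsu)).norm
    simpa using this
  obtain ⟨n, hn1, hn2⟩ := ((l1.eventually (gt_mem_nhds hε)).and
    (l2.eventually (gt_mem_nhds hε))).exists
  obtain ⟨w, w', w'', k1, k2, k3, k4⟩ := hss n
  have hw : (w, (s n).2) ∈ (minimalBdd (bddOp R)).graph := by
    refine mem_graph_minimalBdd.mpr (hasSL_bddOp.mpr ⟨w', w'', k1, k2, ?_⟩)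
    rw [k4, mulL2_mulL2 hR]
  refine ⟨w, (s n).2, hw, by simpa using hn2, ?_⟩
  have hw1 : (w, (s n).1) ∈ factorGraph ρ := ⟨0, by simpa [k3] using k1⟩
  have hw2 : ((s n).1, (s n).2) ∈ (factorGraph ρ).adjoint := by
    rw [mem_adjoint_factorGraph hs, k3, k4]
    convert k2.add (k1.mulL2 ρ) using 1
    · rw [map_add]; abel
    · simp
  rw [inner_factorGraph (Submodule.sub_mem _ h1 hw1) (Submodule.sub_mem _ h2 hw2)]
  simpa only [re_inner_self_eq, Prod.mk_sub_mk] using hn1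

end BoundedKrein


/-! ### Spectral projections from a continuous functional calculus. -/

section FunctionalCalculus

set_option linter.unusedSectionVars false

variable {H : Type*} [NormedAddCommGroup H] [InnerProductSpace ℂ H] [CompleteSpace H]
  {X : Type*} [MetricSpace X] [CompactSpace X] [MeasurableSpace X] [BorelSpace X]
  (φ : C(X, ℝ) →⋆ₐ[ℝ] (H →L[ℂ] H))

theorem inner_fc_left (f : C(X, ℝ)) (h k : H) : ⟪φ f h, k⟫_ℂ = ⟪h, φ f k⟫_ℂ := by
  have h1 : IsSelfAdjoint (φ f) := by
    rw [IsSelfAdjoint, ← map_star]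
    congr 1
  exact ContinuousLinearMap.isSelfAdjoint_iff_isSymmetric.mp h1 h k

theorem re_inner_fc_nonneg {f : C(X, ℝ)} (hf : 0 ≤ f) (h : H) : 0 ≤ (⟪h, φ f h⟫_ℂ).re := by
  let s : C(X, ℝ) := ⟨fun x => √(f x), by fun_prop⟩
  have hs : s * s = f := by
    ext x
    exact Real.mul_self_sqrt (hf x)
  rw [← hs, map_mul]
  change 0 ≤ (⟪h, φ s (φ s h)⟫_ℂ).re
  rw [← inner_fc_left, re_inner_self_eq]
  positivity

/-- The positive functional `f ↦ (φ(f) h, h)`. -/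
def fcFunctional (h : H) : CompactlySupportedContinuousMap X ℝ →ₚ[ℝ] ℝ :=
  PositiveLinearMap.mk₀
    { toFun f := (⟪h, φ f h⟫_ℂ).re
      map_add' f g := by
        have : ((f + g : CompactlySupportedContinuousMap X ℝ) : C(X, ℝ)) = f + g := rfl
        rw [this, map_add, add_apply, inner_add_right, Complex.add_re]
      map_smul' c f := by
        have : ((c • f : CompactlySupportedContinuousMap X ℝ) : C(X, ℝ)) = c • (f : C(X, ℝ)) := rfl
        rw [this, map_smul, smul_apply, inner_smul_right_eq_smul]
        simp }
    fun f hf => re_inner_fc_nonneg φ (f := f) (fun x => hf x) h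

/-- The measure `μ_h` with `(φ(f) h, h) = ∫ f dμ_h`. -/
def fcMeasure (h : H) : Measure X := RealRMK.rieszMeasure (fcFunctional φ h)

instance (h : H) : IsFiniteMeasureOnCompacts (fcMeasure φ h) := by
  unfold fcMeasure; infer_instance

instance (h : H) : IsFiniteMeasure (fcMeasure φ h) := inferInstance

theorem integral_fcMeasure (h : H) (f : C(X, ℝ)) :
    ∫ x, f x ∂(fcMeasure φ h) = (⟪h, φ f h⟫_ℂ).re :=
  RealRMK.integral_rieszMeasure (fcFunctional φ h)
    (CompactlySupportedContinuousMap.continuousMapEquiv f)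

theorem inner_fc_self (h : H) (f : C(X, ℝ)) :
    ⟪h, φ f h⟫_ℂ = ((∫ x, f x ∂(fcMeasure φ h) : ℝ) : ℂ) := by
  rw [integral_fcMeasure]
  refine (Complex.conj_eq_iff_re.mp ?_).symm
  rw [inner_conj_symm, inner_fc_left]

theorem norm_fc_sq (h : H) (f : C(X, ℝ)) :
    ‖φ f h‖ ^ 2 = ∫ x, f x ^ 2 ∂(fcMeasure φ h) := by
  have := integral_fcMeasure φ h (f * f)
  rw [map_mul] at this
  change _ = (⟪h, φ f (φ f h)⟫_ℂ).re at this
  rw [← inner_fc_left, re_inner_self_eq] at this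
  rw [← this]
  exact integral_congr_ae (Eventually.of_forall fun x => (pow_two (f x)).symm)

/-- This isometry extends f ↦ φ(f)h from C(X) to L²(μ_h), in particular to indicator functions. -/
theorem norm_fc (h : H) (f : C(X, ℝ)) :
    ‖φ f h‖ = ‖ContinuousMap.toLp (E := ℝ) 2 (fcMeasure φ h) ℝ f‖ := by
  rw [← sq_eq_sq₀ (norm_nonneg _) (norm_nonneg _), norm_fc_sq,
    ← real_inner_self_eq_norm_sq, L2.inner_def]
  refine integral_congr_ae ?_
  filter_upwards [ContinuousMap.coeFn_toLp (E := ℝ) (p := 2) (𝕜 := ℝ) (fcMeasure φ h) f] with x hx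
  rw [hx]
  simp [pow_two]

/-- The map `f ↦ φ(f) h`. -/
def fcLin (h : H) : C(X, ℝ) →ₗ[ℝ] H where
  toFun f := φ f h
  map_add' f g := by rw [map_add]; rfl
  map_smul' c f := by rw [map_smul]; rfl

/-- The isometric extension of `f ↦ φ(f) h` to `L²(μ_h)`. -/
def fcMap (h : H) : Lp ℝ 2 (fcMeasure φ h) →L[ℝ] H :=
  (fcLin φ h).extendOfNorm (ContinuousMap.toLp (E := ℝ) 2 (fcMeasure φ h) ℝ).toLinearMap

theorem fcMap_toLp (h : H) (f : C(X, ℝ)) :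
    fcMap φ h (ContinuousMap.toLp (E := ℝ) 2 (fcMeasure φ h) ℝ f) = φ f h := by
  have h1 : ∀ f, ‖fcLin φ h f‖ ≤
      1 * ‖(ContinuousMap.toLp (E := ℝ) 2 (fcMeasure φ h) ℝ).toLinearMap f‖ := fun f => by
    rw [one_mul]; exact (norm_fc φ h f).le
  have h2 : DenseRange (ContinuousMap.toLp (E := ℝ) 2 (fcMeasure φ h) ℝ).toLinearMap :=
    ContinuousMap.toLp_denseRange ℝ _ ℝ (by simp)
  exact LinearMap.extendOfNorm_eq h2 ⟨1, h1⟩ f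

theorem norm_fcMap (h : H) (g : Lp ℝ 2 (fcMeasure φ h)) : ‖fcMap φ h g‖ = ‖g‖ := by
  refine DenseRange.induction_on (ContinuousMap.toLp_denseRange ℝ (fcMeasure φ h) ℝ
    (p := 2) (by simp)) g ?_ fun f => ?_
  · exact isClosed_eq (fcMap φ h).continuous.norm continuous_norm
  · rw [fcMap_toLp, norm_fc]

theorem norm_fcMap_toLp_sq {h : H} {g : X → ℝ} (hg : MemLp g 2 (fcMeasure φ h)) :
    ‖fcMap φ h (hg.toLp g)‖ ^ 2 = ∫ x, g x ^ 2 ∂(fcMeasure φ h) := by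
  rw [norm_fcMap, ← real_inner_self_eq_norm_sq, L2.inner_def]
  refine integral_congr_ae ?_
  filter_upwards [hg.coeFn_toLp] with x hx
  rw [hx]
  simp [pow_two]

theorem exists_continuousMap_tendsto {ν : Measure X} [IsFiniteMeasure ν] {g : X → ℝ}
    (hg : MemLp g 2 ν) :
    ∃ f : ℕ → C(X, ℝ), Tendsto (fun n => eLpNorm (⇑(f n) - g) 2 ν) atTop (𝓝 0) := by
  have hd := ContinuousMap.toLp_denseRange ℝ ν ℝ (p := 2) (by simp)
  obtain ⟨s, hs, hsg⟩ := mem_closure_iff_seq_limit.mp (hd (hg.toLp g))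
  choose f hf using hs
  refine ⟨f, ?_⟩
  rw [Lp.tendsto_Lp_iff_tendsto_eLpNorm'] at hsg
  refine hsg.congr fun n => eLpNorm_congr_ae ?_
  rw [← hf n]
  filter_upwards [hg.coeFn_toLp,
    ContinuousMap.coeFn_toLp (E := ℝ) (p := 2) (𝕜 := ℝ) ν (f n)] with x h1 h2
  rw [Pi.sub_apply, Pi.sub_apply, h1]
  exact congrArg (· - g x) h2

/-- The larger measure ν lets one approximating sequence serve several vectors h. -/
theorem tendsto_fc {h : H} {ν : Measure X} (hν : fcMeasure φ h ≤ ν) {g : X → ℝ}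
    (hg : MemLp g 2 (fcMeasure φ h)) {f : ℕ → C(X, ℝ)}
    (hf : Tendsto (fun n => eLpNorm (⇑(f n) - g) 2 ν) atTop (𝓝 0)) :
    Tendsto (fun n => φ (f n) h) atTop (𝓝 (fcMap φ h (hg.toLp g))) := by
  have h1 : Tendsto (fun n => ContinuousMap.toLp (E := ℝ) 2 (fcMeasure φ h) ℝ (f n)) atTop
      (𝓝 (hg.toLp g)) := by
    rw [Lp.tendsto_Lp_iff_tendsto_eLpNorm']
    refine tendsto_of_tendsto_of_tendsto_of_le_of_le tendsto_const_nhds hf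
      (fun n => zero_le) fun n => ?_
    refine (eLpNorm_congr_ae ?_).trans_le (eLpNorm_mono_measure _ hν)
    filter_upwards [hg.coeFn_toLp,
      ContinuousMap.coeFn_toLp (E := ℝ) (p := 2) (𝕜 := ℝ) (fcMeasure φ h) (f n)] with x h1 h2
    rw [Pi.sub_apply, Pi.sub_apply, h1]
    exact congrArg (· - g x) h2
  have h2 := ((fcMap φ h).continuous.tendsto _).comp h1
  refine h2.congr fun n => ?_
  exact fcMap_toLp φ h (f n)

theorem memLp_indicator_one {B : Set X} (hB : MeasurableSet B) (ν : Measure X)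
    [IsFiniteMeasure ν] : MemLp (B.indicator fun _ => (1 : ℝ)) 2 ν :=
  memLp_indicator_const 2 hB 1 (Or.inr (measure_ne_top _ _))

/-- The vector `E(B) h`. -/
def fcInd {B : Set X} (hB : MeasurableSet B) (h : H) : H :=
  fcMap φ h ((memLp_indicator_one hB (fcMeasure φ h)).toLp _)

theorem norm_fcInd_sq {B : Set X} (hB : MeasurableSet B) (h : H) :
    ‖fcInd φ hB h‖ ^ 2 = (fcMeasure φ h).real B := by
  rw [fcInd, norm_fcMap_toLp_sq]
  have : (fun x => B.indicator (fun _ => (1 : ℝ)) x ^ 2) = B.indicator fun _ => (1 : ℝ) := by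
    ext x
    by_cases hx : x ∈ B <;> simp [hx]
  rw [this, integral_indicator_const _ hB]
  simp

theorem tendsto_fcInd {B : Set X} (hB : MeasurableSet B) {h : H} {ν : Measure X}
    (hν : fcMeasure φ h ≤ ν) {f : ℕ → C(X, ℝ)}
    (hf : Tendsto (fun n => eLpNorm (⇑(f n) - B.indicator fun _ => (1 : ℝ)) 2 ν) atTop (𝓝 0)) :
    Tendsto (fun n => φ (f n) h) atTop (𝓝 (fcInd φ hB h)) :=
  tendsto_fc φ hν _ hf

/-- Approximation in L² of the sum of the three measures. With a common sequence, algebraic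
identities for φ(f) pass to the limit. -/
theorem exists_tendsto_fcInd {B : Set X} (hB : MeasurableSet B) (h₁ h₂ h₃ : H) :
    ∃ f : ℕ → C(X, ℝ), Tendsto (fun n => φ (f n) h₁) atTop (𝓝 (fcInd φ hB h₁)) ∧
      Tendsto (fun n => φ (f n) h₂) atTop (𝓝 (fcInd φ hB h₂)) ∧
      Tendsto (fun n => φ (f n) h₃) atTop (𝓝 (fcInd φ hB h₃)) := by
  obtain ⟨f, hf⟩ := exists_continuousMap_tendsto
    (memLp_indicator_one hB (fcMeasure φ h₁ + fcMeasure φ h₂ + fcMeasure φ h₃))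
  exact ⟨f, tendsto_fcInd φ hB (Measure.le_add_right (Measure.le_add_right le_rfl)) hf,
    tendsto_fcInd φ hB (Measure.le_add_right (Measure.le_add_left le_rfl)) hf,
    tendsto_fcInd φ hB (Measure.le_add_left le_rfl) hf⟩

theorem fcInd_add {B : Set X} (hB : MeasurableSet B) (h k : H) :
    fcInd φ hB (h + k) = fcInd φ hB h + fcInd φ hB k := by
  obtain ⟨f, h1, h2, h3⟩ := exists_tendsto_fcInd φ hB h k (h + k)
  refine tendsto_nhds_unique h3 ((h1.add h2).congr fun n => ?_)
  rw [map_add]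

theorem fcInd_smul {B : Set X} (hB : MeasurableSet B) (c : ℂ) (h : H) :
    fcInd φ hB (c • h) = c • fcInd φ hB h := by
  obtain ⟨f, h1, h2, -⟩ := exists_tendsto_fcInd φ hB h (c • h) 0
  refine tendsto_nhds_unique h2 ((h1.const_smul c).congr fun n => ?_)
  rw [map_smul]

theorem inner_fcInd_left {B : Set X} (hB : MeasurableSet B) (h k : H) :
    ⟪fcInd φ hB h, k⟫_ℂ = ⟪h, fcInd φ hB k⟫_ℂ := by
  obtain ⟨f, h1, h2, -⟩ := exists_tendsto_fcInd φ hB h k 0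
  refine tendsto_nhds_unique (h1.inner (tendsto_const_nhds (x := k)))
    (((tendsto_const_nhds (x := h)).inner h2).congr fun n => ?_)
  rw [inner_fc_left]

theorem measureReal_fcMeasure_univ (h : H) : (fcMeasure φ h).real univ = ‖h‖ ^ 2 := by
  have := integral_fcMeasure φ h 1
  rw [map_one] at this
  change _ = (⟪h, h⟫_ℂ).re at this
  rw [re_inner_self_eq] at this
  simpa using this

theorem fcInd_union {B C : Set X} (hB : MeasurableSet B) (hC : MeasurableSet C)
    (hd : Disjoint B C) (h : H) :
    fcInd φ (hB.union hC) h = fcInd φ hB h + fcInd φ hC h := by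
  unfold fcInd
  rw [← map_add, ← MemLp.toLp_add]
  congr 1
  refine MemLp.toLp_congr _ _ (Eventually.of_forall fun x => ?_)
  rw [indicator_union_of_disjoint hd]
  rfl

theorem fcInd_univ (h : H) : fcInd φ MeasurableSet.univ h = h := by
  have h1 : Tendsto (fun _ : ℕ => φ 1 h) atTop (𝓝 (fcInd φ MeasurableSet.univ h)) := by
    refine tendsto_fcInd φ MeasurableSet.univ (ν := fcMeasure φ h) le_rfl
      (tendsto_const_nhds.congr fun n => ?_)
    rw [indicator_univ, show (⇑(1 : C(X, ℝ)) - fun _ => (1 : ℝ)) = 0 from sub_self _, eLpNorm_zero]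
  rw [map_one] at h1
  exact tendsto_nhds_unique h1 tendsto_const_nhds

theorem inner_fcInd_self {B : Set X} (hB : MeasurableSet B) (h : H) :
    ⟪h, fcInd φ hB h⟫_ℂ = ((fcMeasure φ h).real B : ℂ) := by
  obtain ⟨f, hf⟩ := exists_continuousMap_tendsto (memLp_indicator_one hB (fcMeasure φ h))
  have h1 := (tendsto_const_nhds (x := h)).inner (tendsto_fcInd φ hB le_rfl hf) (𝕜 := ℂ)
  refine tendsto_nhds_unique h1 ?_
  -- Convergence in L² implies convergence in L¹, since μ_h is finite; thus the integrals converge.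
  have h2 : Tendsto (fun n => eLpNorm (⇑(f n) - B.indicator fun _ => (1 : ℝ)) 1 (fcMeasure φ h))
      atTop (𝓝 0) := by
    have h3 := ENNReal.Tendsto.mul_const
      (b := fcMeasure φ h univ ^ (1 / (1 : ℝ≥0∞).toReal - 1 / (2 : ℝ≥0∞).toReal))
      hf (Or.inr (ENNReal.rpow_ne_top_of_nonneg (by norm_num) (measure_ne_top _ _)))
    rw [zero_mul] at h3
    refine tendsto_of_tendsto_of_tendsto_of_le_of_le tendsto_const_nhds h3
      (fun n => zero_le) fun n => ?_
    exact eLpNorm_le_eLpNorm_mul_rpow_measure_univ (by norm_num)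
      (((f n).continuous.aestronglyMeasurable).sub
        (memLp_indicator_one hB (fcMeasure φ h)).aestronglyMeasurable)
  have h4 := tendsto_integral_of_L1' (μ := fcMeasure φ h) (B.indicator fun _ => (1 : ℝ))
    (memLp_indicator_one hB (fcMeasure φ h)).aestronglyMeasurable
    (Eventually.of_forall fun n => (f n).continuous.integrable_of_hasCompactSupport
      (HasCompactSupport.of_compactSpace _)) h2
  rw [integral_indicator_const _ hB] at h4
  simp only [smul_eq_mul, mul_one] at h4
  refine ((Complex.continuous_ofReal.tendsto _).comp h4).congr fun n => ?_
  exact (inner_fc_self φ h (f n)).symm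

/-- The projection `E(B)`. -/
def fcProj {B : Set X} (hB : MeasurableSet B) : H →L[ℂ] H :=
  LinearMap.mkContinuous
    { toFun h := fcInd φ hB h
      map_add' := fcInd_add φ hB
      map_smul' := fcInd_smul φ hB } 1 fun h => by
    rw [one_mul]
    refine (sq_le_sq₀ (norm_nonneg _) (norm_nonneg _)).mp ?_
    rw [← measureReal_fcMeasure_univ φ h]
    exact (norm_fcInd_sq φ hB h).trans_le (measureReal_mono (subset_univ _))

theorem fcProj_apply {B : Set X} (hB : MeasurableSet B) (h : H) :
    fcProj φ hB h = fcInd φ hB h := rfl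

/-- Both (E h, E h) and (h, E h) equal μ_h(B); on a complex space the quadratic form determines the
operator, so E² = E. -/
theorem isStarProjection_fcProj {B : Set X} (hB : MeasurableSet B) :
    IsStarProjection (fcProj φ hB) where
  isSelfAdjoint := ContinuousLinearMap.isSelfAdjoint_iff_isSymmetric.mpr
    (inner_fcInd_left φ hB)
  isIdempotentElem := by
    rw [IsIdempotentElem, ← sub_eq_zero]
    rw [← ContinuousLinearMap.coe_inj]
    refine inner_map_self_eq_zero _ |>.mp fun h => ?_
    change ⟪fcInd φ hB (fcInd φ hB h) - fcInd φ hB h, h⟫_ℂ = 0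
    rw [inner_sub_left, inner_fcInd_left φ hB h h, inner_fcInd_left φ hB (fcInd φ hB h) h, inner_fcInd_self,
      inner_self_eq_norm_sq_to_K, ← norm_fcInd_sq φ hB]
    simp

/-- The remainder after finitely many terms has norm equal to the square root of the μ_h-measure of
what is left of the union. -/
theorem hasSum_fcInd {B : ℕ → Set X} (hB : ∀ i, MeasurableSet (B i))
    (hd : Pairwise (Function.onFun Disjoint B)) (h : H) :
    HasSum (fun i => fcInd φ (hB i) h) (fcInd φ (MeasurableSet.iUnion hB) h) := by
  have hfin : ∀ s : Finset ℕ, ∑ i ∈ s, fcInd φ (hB i) h =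
      fcInd φ (s.measurableSet_biUnion fun i _ => hB i) h := by
    classical
    intro s
    induction s using Finset.induction_on with
    | empty =>
      have := norm_fcInd_sq φ (MeasurableSet.empty (α := X)) h
      simp only [measureReal_empty, ne_eq, OfNat.ofNat_ne_zero, not_false_eq_true,
        pow_eq_zero_iff, norm_eq_zero] at this
      simp [this]
    | insert a s ha ih =>
      rw [Finset.sum_insert ha, ih, ← fcInd_union]
      · congr 1
        simp
      · rw [Set.disjoint_iUnion₂_right]
        intro i hi
        exact hd fun hai => ha (hai ▸ hi)
  have hμ : HasSum (fun i => (fcMeasure φ h).real (B i)) ((fcMeasure φ h).real (⋃ i, B i)) := by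
    have := (ENNReal.hasSum_toReal (f := fun i => fcMeasure φ h (B i)) ?_)
    · rwa [← ENNReal.tsum_toReal_eq (fun i => measure_ne_top _ _), ← measure_iUnion hd hB] at this
    · rw [← measure_iUnion hd hB]; exact measure_ne_top _ _
  rw [HasSum, SummationFilter.unconditional_filter, tendsto_iff_norm_sub_tendsto_zero]
  rw [HasSum, SummationFilter.unconditional_filter] at hμ
  have hμ' := (hμ.const_sub ((fcMeasure φ h).real (⋃ i, B i)))
  rw [sub_self] at hμ'
  have hμ'' := hμ'.sqrt
  rw [Real.sqrt_zero] at hμ''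
  refine hμ''.congr fun s => ?_
  have hm := s.measurableSet_biUnion fun i _ => hB i
  have hsub : (⋃ i ∈ s, B i) ⊆ ⋃ i, B i := iUnion₂_subset fun i _ => subset_iUnion B i
  have e1 := fcInd_union φ hm ((MeasurableSet.iUnion hB).diff hm) disjoint_sdiff_right h
  have e2 : fcInd φ (MeasurableSet.iUnion hB) h =
      fcInd φ (hm.union ((MeasurableSet.iUnion hB).diff hm)) h := by
    congr 1
    exact (union_sdiff_cancel hsub).symm
  rw [hfin, norm_sub_rev, e2, e1, add_sub_cancel_left, Real.sqrt_eq_iff_mul_self_eq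
    (sub_nonneg.mpr ?_) (norm_nonneg _), ← pow_two, norm_fcInd_sq, measureReal_sdiff hsub hm,
    measureReal_biUnion_finset (fun i _ j _ hij => hd hij) fun i _ => hB i]
  rw [← measureReal_biUnion_finset (fun i _ j _ hij => hd hij) fun i _ => hB i]
  exact measureReal_mono hsub

end FunctionalCalculus


/-! ### Multiplication by continuous functions and the range of φ(c). -/

section FunctionalCalculus

set_option linter.unusedSectionVars false

variable {H : Type*} [NormedAddCommGroup H] [InnerProductSpace ℂ H] [CompleteSpace H]
  {X : Type*} [MetricSpace X] [CompactSpace X] [MeasurableSpace X] [BorelSpace X]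
  (φ : C(X, ℝ) →⋆ₐ[ℝ] (H →L[ℂ] H))

theorem memLp_continuousMap_mul {ν : Measure X} {g : X → ℝ} (c : C(X, ℝ)) (hg : MemLp g 2 ν) :
    MemLp (⇑c * g) 2 ν :=
  hg.of_le_mul (c := ‖c‖) (c.continuous.aestronglyMeasurable.mul hg.aestronglyMeasurable)
    (Eventually.of_forall fun x => by
      rw [Pi.mul_apply, norm_mul]
      exact mul_le_mul_of_nonneg_right (c.norm_coe_le_norm x) (norm_nonneg _))

/-- In the L²(μ_h) picture φ(c) is multiplication by c; this holds for continuous functions and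
extends by approximation. -/
theorem fc_fcMap {h : H} {g : X → ℝ} (c : C(X, ℝ)) (hg : MemLp g 2 (fcMeasure φ h)) :
    φ c (fcMap φ h (hg.toLp g)) = fcMap φ h ((memLp_continuousMap_mul c hg).toLp _) := by
  obtain ⟨f, hf⟩ := exists_continuousMap_tendsto hg
  have h1 := ((φ c).continuous.tendsto _).comp (tendsto_fc φ le_rfl hg hf)
  have h2 : Tendsto (fun n => eLpNorm (⇑(c * f n) - ⇑c * g) 2 (fcMeasure φ h)) atTop (𝓝 0) := by
    have h3 := ENNReal.Tendsto.const_mul (a := ENNReal.ofReal ‖c‖) hf (Or.inr (by simp))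
    rw [mul_zero] at h3
    refine tendsto_of_tendsto_of_tendsto_of_le_of_le tendsto_const_nhds h3
      (fun n => zero_le) fun n => ?_
    refine eLpNorm_le_mul_eLpNorm_of_ae_le_mul (Eventually.of_forall fun x => ?_) 2
    rw [ContinuousMap.coe_mul, ← mul_sub, Pi.mul_apply, norm_mul]
    exact mul_le_mul_of_nonneg_right (c.norm_coe_le_norm x) (norm_nonneg _)
  refine tendsto_nhds_unique h1 ((tendsto_fc φ le_rfl (memLp_continuousMap_mul c hg) h2).congr
    fun n => ?_)
  rw [map_mul]; rfl

/-- Because (φ(f)φ(c)k, φ(c)k) = (φ(c f c)k, k), the measure acquires the density c². -/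
theorem fcMeasure_fc (c : C(X, ℝ)) (k : H) :
    fcMeasure φ (φ c k) = (fcMeasure φ k).withDensity fun x => ENNReal.ofReal (c x ^ 2) := by
  have hi : Integrable (fun x => c x ^ 2) (fcMeasure φ k) :=
    (c * c).continuous.integrable_of_hasCompactSupport (HasCompactSupport.of_compactSpace _) |>.congr
      (Eventually.of_forall fun x => (pow_two (c x)).symm)
  have hm : Measurable fun x => ENNReal.ofReal (c x ^ 2) := by fun_prop
  have : IsFiniteMeasure ((fcMeasure φ k).withDensity fun x => ENNReal.ofReal (c x ^ 2)) :=
    isFiniteMeasure_withDensity_ofReal hi.2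
  refine ext_of_forall_integral_eq_of_IsFiniteMeasure fun f => ?_
  have e1 := integral_fcMeasure φ (φ c k) f.toContinuousMap
  have e2 := integral_fcMeasure φ k (c * (f.toContinuousMap * c))
  rw [map_mul, map_mul] at e2
  change _ = (⟪k, φ c (φ f.toContinuousMap (φ c k))⟫_ℂ).re at e2
  rw [← inner_fc_left, ← e1] at e2
  refine e2.symm.trans ?_
  rw [integral_withDensity_eq_integral_toReal_smul hm
    (Eventually.of_forall fun x => ENNReal.ofReal_lt_top)]
  refine integral_congr_ae (Eventually.of_forall fun x => ?_)
  change c x * (f x * c x) = (ENNReal.ofReal (c x ^ 2)).toReal * f x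
  rw [ENNReal.toReal_ofReal (sq_nonneg _)]
  ring

theorem fcInd_congr {B C : Set X} (hB : MeasurableSet B) (hC : MeasurableSet C) (h : B = C)
    (k : H) : fcInd φ hB k = fcInd φ hC k := by
  subst h; rfl

/-- The vector is annihilated by φ(c), since c vanishes on the set, and φ(c) is injective. -/
theorem fcInd_zero_set {c : C(X, ℝ)} (hc : Function.Injective (φ c)) (h : H) :
    fcInd φ (measurableSet_eq_fun c.continuous.measurable measurable_const :
      MeasurableSet {x | c x = 0}) h = 0 := by
  refine hc ?_
  rw [map_zero, fcInd, fc_fcMap, ← norm_eq_zero, ← pow_eq_zero_iff two_ne_zero, norm_fcMap_toLp_sq]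
  refine integral_eq_zero_of_ae (Eventually.of_forall fun x => ?_)
  by_cases hx : c x = 0 <;> simp [hx]

/-- If `∫ c⁻² dμ_h < ∞`, then `h` is in the range of `φ(c)`. -/
theorem exists_fc_eq {c : C(X, ℝ)} (hc : Function.Injective (φ c)) {h : H}
    (hg : MemLp (fun x => (c x)⁻¹) 2 (fcMeasure φ h)) : ∃ k, φ c k = h := by
  refine ⟨fcMap φ h (hg.toLp _), ?_⟩
  have hm : MeasurableSet {x | c x = 0} :=
    measurableSet_eq_fun c.continuous.measurable measurable_const
  have h1 := fcInd_union φ hm hm.compl disjoint_compl_right h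
  rw [fcInd_zero_set φ hc, zero_add] at h1
  rw [fcInd_congr φ _ MeasurableSet.univ (union_compl_self _), fcInd_univ] at h1
  rw [fc_fcMap]
  refine Eq.trans ?_ h1.symm
  rw [fcInd]
  refine congrArg (fcMap φ h) (MemLp.toLp_congr _ _ (Eventually.of_forall fun x => ?_))
  -- With the default value 0⁻¹ = 0, the product c · c⁻¹ is exactly the indicator of {c ≠ 0}.
  by_cases hx : c x = 0 <;> simp [hx]

end FunctionalCalculus

/-! ### The spectral theorem for nonnegative self-adjoint operators. -/

section SpectralTheorem

set_option linter.unusedSectionVars false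

variable {H : Type*} [NormedAddCommGroup H] [InnerProductSpace ℂ H] [CompleteSpace H]
  {T : H →ₗ.[ℂ] H}

theorem eq_zero_of_mem_graph_neg (hT0 : IsNonneg T) {w : H} (h : (w, -w) ∈ T.graph) : w = 0 := by
  have := isNonneg_iff_graph.mp hT0 _ _ h
  rw [inner_neg_right, Complex.neg_re, re_inner_self_eq] at this
  have h2 : ‖w‖ ^ 2 = 0 := le_antisymm (by linarith) (sq_nonneg _)
  simpa using h2

/-- The resolvent `(1 + T)⁻¹`. -/
theorem exists_resolvent_clm (hT : IsSelfAdjoint T) (hT0 : IsNonneg T) :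
    ∃ R : H →L[ℂ] H, (∀ g, (R g, g - R g) ∈ T.graph) ∧ (∀ u v, (u, v) ∈ T.graph → R (u + v) = u) ∧
      IsSelfAdjoint R := by
  choose R hR using fun g : H => exists_resolvent hT hT0 one_pos g
  simp only [Complex.ofReal_one, one_smul] at hR
  have huniq : ∀ u v, (u, v) ∈ T.graph → R (u + v) = u := by
    intro u v huv
    have h1 := T.graph.sub_mem (hR (u + v)) huv
    rw [Prod.mk_sub_mk, show u + v - R (u + v) - v = -(R (u + v) - u) by abel] at h1
    exact sub_eq_zero.mp (eq_zero_of_mem_graph_neg hT0 h1)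
  let R' : H →L[ℂ] H := LinearMap.mkContinuous
    { toFun := R
      map_add' := fun a b => by
        have h1 := huniq _ _ (T.graph.add_mem (hR a) (hR b))
        refine Eq.trans (congrArg R ?_) h1
        dsimp only
        abel
      map_smul' := fun c a => by
        have h1 := huniq _ _ (T.graph.smul_mem c (hR a))
        rw [RingHom.id_apply]
        refine Eq.trans (congrArg R ?_) h1
        dsimp only
        rw [← smul_add]; congr 1; abel } 1 fun g => by
    have := norm_le_of_mem_graph (x := 1) hT0 (u := R g) (g := g) (by simpa using hR g)
    simpa using this
  refine ⟨R', hR, huniq, ContinuousLinearMap.isSelfAdjoint_iff_isSymmetric.mpr fun g k => ?_⟩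
  have := isSymm_of_isSelfAdjoint hT (hR g) (hR k)
  rw [inner_sub_left, inner_sub_right] at this
  change ⟪R g, k⟫_ℂ = ⟪g, R k⟫_ℂ
  linear_combination -this

/-- The spectral measure of `T`, transported from the functional calculus `φ` of `c = (1 + T)⁻¹`. -/
def projMeasureOfFC {X : Type*} [MetricSpace X] [CompactSpace X] [MeasurableSpace X] [BorelSpace X]
    (φ : C(X, ℝ) →⋆ₐ[ℝ] (H →L[ℂ] H)) {θ : X → ℝ} (hθ : Measurable θ) : ProjMeasure H := by
  classical
  exact
  { proj B := if hB : MeasurableSet B then fcProj φ (hθ hB) else 0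
    isStarProjection B hB := by
      rw [dif_pos hB]; exact isStarProjection_fcProj φ _
    univ := by
      rw [dif_pos MeasurableSet.univ]
      ext h
      exact fcInd_univ φ h
    iUnion B hB hd h := by
      simp only [dif_pos (MeasurableSet.iUnion hB), dif_pos (hB _)]
      have := hasSum_fcInd φ (fun i => hθ (hB i))
        (fun i j hij => (hd hij).preimage θ) h
      rw [fcInd_congr φ _ (hθ (MeasurableSet.iUnion hB)) (preimage_iUnion).symm] at this
      exact this }

theorem scalar_projMeasureOfFC {X : Type*} [MetricSpace X] [CompactSpace X] [MeasurableSpace X]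
    [BorelSpace X] (φ : C(X, ℝ) →⋆ₐ[ℝ] (H →L[ℂ] H)) {θ : X → ℝ} (hθ : Measurable θ) (h : H) :
    (projMeasureOfFC φ hθ).scalar h = (fcMeasure φ h).map θ := by
  ext B hB
  rw [ProjMeasure.scalar, Measure.ofMeasurable_apply _ hB, Measure.map_apply hθ hB]
  simp only [projMeasureOfFC, dif_pos hB]
  rw [fcProj_apply, inner_fcInd_self, Complex.ofReal_re, ofReal_measureReal]

/-- The spectral theorem for nonnegative self-adjoint operators. -/
theorem exists_isSpectralMeasure (hT : IsSelfAdjoint T) (hT0 : IsNonneg T) :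
    ∃ P, IsSpectralMeasure P T := by
  obtain ⟨R, hR, hu, hs⟩ := exists_resolvent_clm hT hT0
  let φ := cfcHom (R := ℝ) hs
  let c : C(spectrum ℝ R, ℝ) := (ContinuousMap.id ℝ).restrict _
  have hc : φ c = R := cfcHom_id hs
  have hinj : Function.Injective (φ c) := by
    rw [hc, injective_iff_map_eq_zero]
    intro g hg
    have := hR g
    rw [hg, sub_zero] at this
    exact T.graph_fst_eq_zero_snd this rfl
  -- The solution l of c = 1/(1 + l). The spurious value -1 at c = 0 is harmless: φ(c) is injective,
  -- so the set {c = 0} carries no spectral mass.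
  let θ : spectrum ℝ R → ℝ := fun x => (c x)⁻¹ - 1
  have hθ : Measurable θ := by fun_prop
  -- Since u = φ(c)(u + v), the measure of u has density c² with respect to that of u + v. The
  -- factor tames θ: c²θ² is at most (1 - c)², and c²θ = c(1 - c).
  have key : ∀ u v, (u, v) ∈ T.graph → fcMeasure φ u =
      (fcMeasure φ (u + v)).withDensity fun x => ENNReal.ofReal (c x ^ 2) := by
    intro u v huv
    rw [← fcMeasure_fc, hc, hu u v huv]
  have hm : Measurable fun x => ENNReal.ofReal (c x ^ 2) := by fun_prop
  refine ⟨projMeasureOfFC φ hθ, ?_, ?_⟩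
  · intro h
    rw [scalar_projMeasureOfFC, lintegral_map (by fun_prop) hθ]
    constructor
    · intro hh
      rw [key h _ (T.mem_graph ⟨h, hh⟩), lintegral_withDensity_eq_lintegral_mul _ hm (by fun_prop)]
      have hi : Integrable (fun x => (1 - c x) ^ 2) (fcMeasure φ (h + T ⟨h, hh⟩)) :=
        (by fun_prop : Continuous fun x => (1 - c x) ^ 2).integrable_of_hasCompactSupport
          (HasCompactSupport.of_compactSpace _)
      refine lt_of_le_of_lt (lintegral_mono fun x => ?_) hi.lintegral_lt_top
      rw [Pi.mul_apply, ← ENNReal.ofReal_mul (sq_nonneg _)]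
      refine ENNReal.ofReal_le_ofReal ?_
      by_cases hx : c x = 0
      · rw [hx]; norm_num
      · refine le_of_eq ?_
        change c x ^ 2 * ((c x)⁻¹ - 1) ^ 2 = _
        field_simp
    · intro hh
      have h1 : MemLp θ 2 (fcMeasure φ h) := by
        rw [memLp_two_iff_integrable_sq hθ.aestronglyMeasurable]
        refine ⟨by fun_prop, ?_⟩
        rw [hasFiniteIntegral_iff_ofReal (Eventually.of_forall fun x => sq_nonneg _)]
        exact hh
      have h2 : MemLp (fun x => (c x)⁻¹) 2 (fcMeasure φ h) := by
        convert h1.add (memLp_const (1 : ℝ)) using 1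
        ext x
        simp [θ]
      obtain ⟨k, rfl⟩ := exists_fc_eq φ hinj h2
      rw [hc]
      exact LinearPMap.mem_domain_of_mem_graph (hR k)
  · intro h
    have hg := T.mem_graph h
    set v := T h
    rw [scalar_projMeasureOfFC, integral_map hθ.aemeasurable (by fun_prop), key _ _ hg,
      integral_withDensity_eq_integral_toReal_smul hm
        (Eventually.of_forall fun x => ENNReal.ofReal_lt_top)]
    have e1 := hu _ _ hg
    set k := (h : H) + v
    have e2 := inner_fc_self φ k (c * (1 - c))
    have e3 : ⟪k, φ (c * (1 - c)) k⟫_ℂ = ⟪(h : H), v⟫_ℂ := by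
      rw [map_mul, map_sub, map_one]
      change ⟪k, φ c (k - φ c k)⟫_ℂ = _
      rw [← inner_fc_left, hc, e1]
      simp [k]
    rw [← e3, e2]
    congr 1
    refine integral_congr_ae (Eventually.of_forall fun x => ?_)
    change c x * (1 - c x) = (ENNReal.ofReal (c x ^ 2)).toReal * ((c x)⁻¹ - 1)
    rw [ENNReal.toReal_ofReal (sq_nonneg _)]
    by_cases hx : c x = 0
    · rw [hx]; norm_num
    · field_simp

end SpectralTheorem


/-! ### Projection-valued measures and the invariance of their ranges. -/

section ProjMeasure

set_option linter.unusedSectionVars false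

variable {H : Type*} [NormedAddCommGroup H] [InnerProductSpace ℂ H] [CompleteSpace H]

namespace ProjMeasure

variable (P : ProjMeasure H)

theorem proj_proj {B : Set ℝ} (hB : MeasurableSet B) (h : H) : P.proj B (P.proj B h) = P.proj B h :=
  congrArg (fun A : H →L[ℂ] H => A h) (P.isStarProjection B hB).isIdempotentElem.eq

theorem inner_proj_left {B : Set ℝ} (hB : MeasurableSet B) (h k : H) :
    ⟪P.proj B h, k⟫_ℂ = ⟪h, P.proj B k⟫_ℂ :=
  ContinuousLinearMap.isSelfAdjoint_iff_isSymmetric.mp (P.isStarProjection B hB).isSelfAdjoint h k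

theorem inner_proj_self {B : Set ℝ} (hB : MeasurableSet B) (h : H) :
    ⟪h, P.proj B h⟫_ℂ = ((‖P.proj B h‖ ^ 2 : ℝ) : ℂ) := by
  rw [← P.proj_proj hB, ← P.inner_proj_left hB, inner_self_eq_norm_sq_to_K, P.proj_proj hB]
  simp

theorem scalar_apply {B : Set ℝ} (hB : MeasurableSet B) (h : H) :
    P.scalar h B = ENNReal.ofReal (‖P.proj B h‖ ^ 2) := by
  rw [scalar, Measure.ofMeasurable_apply _ hB, P.inner_proj_self hB, Complex.ofReal_re]

instance (h : H) : IsFiniteMeasure (P.scalar h) :=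
  ⟨by rw [P.scalar_apply MeasurableSet.univ]; exact ENNReal.ofReal_lt_top⟩

theorem norm_proj_sq {B : Set ℝ} (hB : MeasurableSet B) (h : H) :
    ‖P.proj B h‖ ^ 2 = (P.scalar h).real B := by
  rw [Measure.real, P.scalar_apply hB, ENNReal.toReal_ofReal (sq_nonneg _)]

theorem proj_eq_zero_iff {B : Set ℝ} (hB : MeasurableSet B) (h : H) :
    P.proj B h = 0 ↔ P.scalar h B = 0 := by
  rw [P.scalar_apply hB, ENNReal.ofReal_eq_zero]
  constructor
  · rintro h; simp [h]
  · intro h1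
    have := le_antisymm h1 (sq_nonneg _)
    simpa using this

/-- Additivity is read off from the scalar measures, because the quadratic form determines a bounded
operator on a complex space. -/
theorem proj_union {B C : Set ℝ} (hB : MeasurableSet B) (hC : MeasurableSet C) (hd : Disjoint B C) :
    P.proj (B ∪ C) = P.proj B + P.proj C := by
  rw [← sub_eq_zero, ← ContinuousLinearMap.coe_inj]
  refine (inner_map_self_eq_zero _).mp fun h => ?_
  change ⟪P.proj (B ∪ C) h - (P.proj B h + P.proj C h), h⟫_ℂ = 0
  rw [inner_sub_left, inner_add_left, P.inner_proj_left hB, P.inner_proj_left hC,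
    P.inner_proj_left (hB.union hC), P.inner_proj_self hB, P.inner_proj_self hC,
    P.inner_proj_self (hB.union hC), P.norm_proj_sq hB, P.norm_proj_sq hC,
    P.norm_proj_sq (hB.union hC), measureReal_union hd hC]
  push_cast
  ring

theorem scalar_compl_of_proj_eq {B : Set ℝ} (hB : MeasurableSet B) {h : H} (hh : P.proj B h = h) :
    P.scalar h Bᶜ = 0 := by
  rw [← P.proj_eq_zero_iff hB.compl]
  have h1 := congrArg (fun A : H →L[ℂ] H => A h) (P.proj_union hB hB.compl disjoint_compl_right)
  rw [union_compl_self, P.univ] at h1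
  change h = P.proj B h + P.proj Bᶜ h at h1
  rw [hh] at h1
  exact left_eq_add.mp h1

theorem proj_eq_zero_of_subset {B C : Set ℝ} (hB : MeasurableSet B) (hC : MeasurableSet C)
    (hBC : B ⊆ C) {h : H} (hh : P.proj C h = 0) : P.proj B h = 0 := by
  rw [P.proj_eq_zero_iff hB]
  rw [P.proj_eq_zero_iff hC] at hh
  exact measure_mono_null hBC hh

/-- The vectors `P(I) h` and `k - P(I) k` are orthogonal in the sense of all spectral projections. -/
theorem inner_proj_eq_zero {I B : Set ℝ} (hI : MeasurableSet I) (hB : MeasurableSet B) {h k : H}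
    (hh : P.proj I h = h) (hk : P.proj I k = 0) : ⟪P.proj B h, k⟫_ℂ = 0 := by
  have h1 := congrArg (fun A : H →L[ℂ] H => A h)
    (P.proj_union (hB.inter hI) (hB.diff hI) disjoint_inf_sdiff)
  rw [inter_union_sdiff] at h1
  change P.proj B h = P.proj (B ∩ I) h + P.proj (B \ I) h at h1
  have h2 : P.proj (B \ I) h = 0 := P.proj_eq_zero_of_subset (hB.diff hI) hI.compl
    (fun x hx => hx.2) ((P.proj_eq_zero_iff hI.compl h).mpr (P.scalar_compl_of_proj_eq hI hh))
  rw [h1, h2, add_zero, P.inner_proj_left (hB.inter hI),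
    P.proj_eq_zero_of_subset (hB.inter hI) hI inter_subset_right hk, inner_zero_right]

theorem scalar_add {I : Set ℝ} (hI : MeasurableSet I) {h k : H}
    (hh : P.proj I h = h) (hk : P.proj I k = 0) :
    P.scalar (h + k) = P.scalar h + P.scalar k := by
  ext B hB
  rw [Measure.add_apply, P.scalar_apply hB, P.scalar_apply hB, P.scalar_apply hB,
    ← ENNReal.ofReal_add (sq_nonneg _) (sq_nonneg _), map_add]
  congr 1
  have := norm_add_sq_eq_norm_sq_add_norm_sq_of_inner_eq_zero (𝕜 := ℂ) (P.proj B h)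
    (P.proj B k) (by
      rw [← P.inner_proj_left hB, P.proj_proj hB]
      exact P.inner_proj_eq_zero hI hB hh hk)
  rw [pow_two, pow_two, pow_two]
  exact this

end ProjMeasure

variable {T : H →ₗ.[ℂ] H} {P : ProjMeasure H}

namespace IsSpectralMeasure

theorem integrable (hP : IsSpectralMeasure P T) {h : H} (hh : h ∈ T.domain) :
    Integrable (fun l : ℝ => l) (P.scalar h) := by
  have h1 : MemLp (fun l : ℝ => l) 2 (P.scalar h) := by
    rw [memLp_two_iff_integrable_sq (by fun_prop)]
    refine ⟨by fun_prop, ?_⟩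
    rw [hasFiniteIntegral_iff_ofReal (Eventually.of_forall fun x => sq_nonneg _)]
    exact (hP.mem_domain h).mp hh
  exact h1.integrable (by norm_num)

theorem mem_domain_of_bounded (hP : IsSpectralMeasure P T) {I : Set ℝ} (hI : MeasurableSet I)
    {m : ℝ} (hm : ∀ x ∈ I, |x| ≤ m) {h : H} (hh : P.proj I h = h) : h ∈ T.domain := by
  rw [hP.mem_domain]
  have h0 := P.scalar_compl_of_proj_eq hI hh
  have h1 : ∀ᵐ x ∂(P.scalar h), ENNReal.ofReal (x ^ 2) ≤ ENNReal.ofReal (m ^ 2) := by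
    have : ∀ᵐ x ∂(P.scalar h), x ∈ I := h0
    filter_upwards [this] with x hx
    refine ENNReal.ofReal_le_ofReal ?_
    rw [← sq_abs]
    exact pow_le_pow_left₀ (abs_nonneg _) (hm x hx) 2
  refine lt_of_le_of_lt (lintegral_mono_ae h1) ?_
  rw [lintegral_const]
  exact ENNReal.mul_lt_top ENNReal.ofReal_lt_top (measure_lt_top _ _)

/-- A vector k in the range of the projection of [-m, 0) lies in dom T, and (k, Tk) is the integral
of a negative function against its scalar measure; nonnegativity forces that measure to vanish. -/
theorem scalar_Iio_zero (hP : IsSpectralMeasure P T) (hT0 : IsNonneg T) (h : H) :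
    P.scalar h (Iio 0) = 0 := by
  have key : ∀ m : ℕ, P.scalar h (Ico (-(m : ℝ)) 0) = 0 := by
    intro m
    rw [← P.proj_eq_zero_iff measurableSet_Ico]
    set k := P.proj (Ico (-(m : ℝ)) 0) h
    have hk : P.proj (Ico (-(m : ℝ)) 0) k = k := P.proj_proj measurableSet_Ico h
    have hd := hP.mem_domain_of_bounded (m := m) measurableSet_Ico
      (fun x hx => abs_le.mpr ⟨hx.1, hx.2.le.trans (Nat.cast_nonneg m)⟩) hk
    have h1 := hT0 ⟨k, hd⟩
    rw [hP.inner_apply, Complex.ofReal_re] at h1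
    have hae : ∀ᵐ x ∂(P.scalar k), x ∈ Ico (-(m : ℝ)) 0 :=
      P.scalar_compl_of_proj_eq measurableSet_Ico hk
    have h2 : (fun l : ℝ => -l) =ᵐ[P.scalar k] 0 := by
      refine (integral_eq_zero_iff_of_nonneg_ae ?_ (hP.integrable hd).neg).mp ?_
      · filter_upwards [hae] with x hx
        exact neg_nonneg.mpr hx.2.le
      · refine le_antisymm ?_ (integral_nonneg_of_ae ?_)
        · change ∫ l, -l ∂(P.scalar k) ≤ 0
          rw [integral_neg]
          exact neg_nonpos.mpr h1
        · filter_upwards [hae] with x hx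
          exact neg_nonneg.mpr hx.2.le
    have h3 : P.scalar k univ = 0 := by
      refine measure_mono_null (t := {x | ¬ False}) (fun _ _ => not_false) ?_
      change ∀ᵐ _ ∂(P.scalar k), False
      filter_upwards [hae, h2] with x hx hx'
      exact hx.2.ne (neg_eq_zero.mp hx')
    rw [← P.proj_eq_zero_iff MeasurableSet.univ, P.univ] at h3
    exact h3
  have : Iio (0 : ℝ) = ⋃ m : ℕ, Ico (-(m : ℝ)) 0 := by
    ext x
    simp only [mem_Iio, mem_iUnion, mem_Ico]
    constructor
    · intro hx
      obtain ⟨m, hm⟩ := exists_nat_ge (-x)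
      exact ⟨m, by linarith, hx⟩
    · rintro ⟨m, -, hx⟩; exact hx
  rw [this]
  exact measure_iUnion_null key

theorem hasSum_proj (hP : IsSpectralMeasure P T) (hT0 : IsNonneg T) (h : H) :
    HasSum (fun n : ℕ => P.proj (Ico (n : ℝ) (n + 1)) h) h := by
  have hd : Pairwise (Function.onFun Disjoint fun n : ℕ => Ico (n : ℝ) (n + 1)) := by
    intro i j hij
    have := pairwise_disjoint_Ico_intCast ℝ (Nat.cast_injective (R := ℤ) |>.ne hij)
    simpa [Function.onFun] using this
  have h1 := P.iUnion _ (fun n => measurableSet_Ico) hd h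
  have h2 : (⋃ n : ℕ, Ico (n : ℝ) (n + 1)) = Ici 0 := by
    ext x
    simp only [mem_iUnion, mem_Ico, mem_Ici]
    constructor
    · rintro ⟨n, hn, -⟩; exact (Nat.cast_nonneg n).trans hn
    · intro hx
      exact ⟨⌊x⌋₊, Nat.floor_le hx, Nat.lt_floor_add_one x⟩
  rw [h2] at h1
  have h3 := congrArg (fun A : H →L[ℂ] H => A h)
    (P.proj_union measurableSet_Iio measurableSet_Ici (Iio_disjoint_Ici (le_refl (0 : ℝ))))
  rw [Iio_union_Ici, P.univ] at h3
  change h = P.proj (Iio 0) h + P.proj (Ici 0) h at h3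
  rw [(P.proj_eq_zero_iff measurableSet_Iio h).mpr (hP.scalar_Iio_zero hT0 h), zero_add] at h3
  rwa [← h3] at h1

/-- The operator `T` leaves the ranges of its spectral projections invariant. -/
theorem proj_apply (hP : IsSpectralMeasure P T) (hT : IsSelfAdjoint T) {I : Set ℝ}
    (hI : MeasurableSet I) {m : ℝ} (hm : ∀ x ∈ I, |x| ≤ m) {u v : H} (huv : (u, v) ∈ T.graph)
    (hu : P.proj I u = u) : P.proj I v = v := by
  have hs := isSymm_of_isSelfAdjoint hT
  -- Only the quadratic form of T is known from P. If P(I)u = u and P(I)k = 0, the scalar measures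
  -- add, so the quadratic form does too and its cross term is zero.
  have key : ∀ k l, (k, l) ∈ T.graph → P.proj I k = 0 → (⟪k, v⟫_ℂ).re = 0 := by
    intro k l hkl hk
    have quad : ∀ x y, (x, y) ∈ T.graph → ⟪x, y⟫_ℂ = ((∫ l, l ∂(P.scalar x) : ℝ) : ℂ) := by
      intro x y hxy
      obtain ⟨z, rfl, rfl⟩ := T.mem_graph_iff.mp hxy
      exact hP.inner_apply z
    have e1 := quad _ _ (T.graph.add_mem huv hkl)
    change ⟪u + k, v + l⟫_ℂ = _ at e1
    rw [P.scalar_add hI hu hk, integral_add_measure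
      (hP.integrable (LinearPMap.mem_domain_of_mem_graph huv))
      (hP.integrable (LinearPMap.mem_domain_of_mem_graph hkl)), Complex.ofReal_add,
      ← quad _ _ huv, ← quad _ _ hkl, inner_add_left, inner_add_right, inner_add_right,
      ← hs huv hkl, ← inner_conj_symm v k] at e1
    have e2 := congrArg Complex.re e1
    simp only [Complex.add_re, Complex.conj_re] at e2
    linarith
  have key' : ∀ k l, (k, l) ∈ T.graph → ⟪k - P.proj I k, v⟫_ℂ = 0 := by
    intro k l hkl
    have hd := hP.mem_domain_of_bounded hI hm (P.proj_proj hI k)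
    have h1 := T.graph.sub_mem hkl (T.mem_graph ⟨_, hd⟩)
    rw [Prod.mk_sub_mk] at h1
    have hz : P.proj I (k - P.proj I k) = 0 := by rw [map_sub, P.proj_proj hI, sub_self]
    have r1 := key _ _ h1 hz
    -- Multiplying by i recovers the imaginary part.
    have r2 := key _ _ (T.graph.smul_mem Complex.I h1) (by
      change P.proj I (Complex.I • (k - P.proj I k)) = 0
      rw [map_smul, hz, smul_zero])
    change (⟪Complex.I • (k - P.proj I k), v⟫_ℂ).re = 0 at r2
    rw [inner_smul_left] at r2
    generalize ⟪k - P.proj I k, v⟫_ℂ = z at r1 r2 ⊢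
    refine Complex.ext r1 ?_
    simpa using r2
  have hd := hT.dense_domain
  have h2 : P.proj I v - v = 0 := by
    refine hd.eq_zero_of_inner_right ℂ fun k hk => ?_
    have := key' _ _ (T.mem_graph ⟨k, hk⟩)
    rw [inner_sub_left, P.inner_proj_left hI] at this
    rw [inner_sub_right]
    linear_combination -this
  exact sub_eq_zero.mp h2

end IsSpectralMeasure

end ProjMeasure

/-! ### The decomposition of `T` by its spectral subspaces. -/

section SpecSubspace

variable {H : Type*} [NormedAddCommGroup H] [InnerProductSpace ℂ H] [CompleteSpace H]
  {T : H →ₗ.[ℂ] H}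

theorem mem_graph_part {E : Type*} [NormedAddCommGroup E] [InnerProductSpace ℂ E]
    {T : E →ₗ.[ℂ] E} {K : Submodule ℂ E} {u v : K} :
    (u, v) ∈ (part T K).graph ↔ ((u : E), (v : E)) ∈ T.graph := by
  rw [part, Submodule.toLinearPMap_graph_eq]
  · rfl
  · rintro ⟨x, y⟩ hx (rfl : x = 0)
    exact Subtype.ext (T.graph_fst_eq_zero_snd (x := 0) hx rfl)

theorem isSpectralMeasure_spectralMeasure (hT : IsSelfAdjoint T) (hT0 : IsNonneg T) :
    IsSpectralMeasure (spectralMeasure T) T := by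
  have h := exists_isSpectralMeasure hT hT0
  rw [spectralMeasure, dif_pos h]
  exact h.choose_spec

theorem mem_specSubspace {n : ℕ} {h : H} :
    h ∈ specSubspace T n ↔ (spectralMeasure T).proj (Ico (n : ℝ) (n + 1)) h = h := by
  constructor
  · rintro ⟨k, rfl⟩
    exact (spectralMeasure T).proj_proj measurableSet_Ico k
  · intro hh
    exact ⟨h, hh⟩

theorem proj_mem_specSubspace (n : ℕ) (h : H) :
    (spectralMeasure T).proj (Ico (n : ℝ) (n + 1)) h ∈ specSubspace T n := ⟨h, rfl⟩

theorem isHilbertSum_specSubspace (hT : IsSelfAdjoint T) (hT0 : IsNonneg T) :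
    IsHilbertSum ℂ (fun n => specSubspace T n) (fun n => (specSubspace T n).subtypeₗᵢ) := by
  have hP := isSpectralMeasure_spectralMeasure hT hT0
  refine IsHilbertSum.mkInternal _ ?_ ?_
  · intro i j hij x y
    change ⟪(x : H), (y : H)⟫_ℂ = 0
    have hx := mem_specSubspace.mp x.2
    have hy := mem_specSubspace.mp y.2
    have hd : Disjoint (Ico (j : ℝ) (j + 1)) (Ico (i : ℝ) (i + 1)) := by
      have := pairwise_disjoint_Ico_intCast ℝ (Nat.cast_injective (R := ℤ) |>.ne hij.symm)
      simpa [Function.onFun] using this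
    rw [← hx, (spectralMeasure T).inner_proj_left measurableSet_Ico,
      (spectralMeasure T).proj_eq_zero_of_subset measurableSet_Ico
        (measurableSet_Ico (a := (j : ℝ)) (b := j + 1)).compl hd.symm.subset_compl_right
        (((spectralMeasure T).proj_eq_zero_iff measurableSet_Ico.compl _).mpr
          ((spectralMeasure T).scalar_compl_of_proj_eq measurableSet_Ico hy)), inner_zero_right]
  · intro h _
    refine mem_closure_of_tendsto (hP.hasSum_proj hT0 h) (Eventually.of_forall fun s => ?_)
    exact Submodule.sum_mem _ fun n _ =>
      Submodule.mem_iSup_of_mem n (proj_mem_specSubspace n h)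

theorem coe_coord_specSubspace (n : ℕ) (h : H) :
    ((coord (fun n => (specSubspace T n).subtypeₗᵢ) n h : specSubspace T n) : H) =
      (spectralMeasure T).proj (Ico (n : ℝ) (n + 1)) h := by
  suffices coord (fun n => (specSubspace T n).subtypeₗᵢ) n h =
      ⟨_, proj_mem_specSubspace n h⟩ from congrArg Subtype.val this
  refine ext_inner_left ℂ fun x => ?_
  refine (inner_coord_right (J := fun n => (specSubspace T n).subtypeₗᵢ) n x h).trans ?_
  change ⟪(x : H), h⟫_ℂ = ⟪(x : H), (spectralMeasure T).proj (Ico (n : ℝ) (n + 1)) h⟫_ℂ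
  rw [← (spectralMeasure T).inner_proj_left measurableSet_Ico, mem_specSubspace.mp x.2]

theorem abs_le_of_mem_Ico {n : ℕ} {x : ℝ} (hx : x ∈ Ico (n : ℝ) (n + 1)) : |x| ≤ n + 1 := by
  rw [abs_of_nonneg ((Nat.cast_nonneg n).trans hx.1)]
  exact hx.2.le

/-- The parts of `T` in its spectral subspaces are bounded. -/
theorem exists_specPart_eq_bddOp (hT : IsSelfAdjoint T) (hT0 : IsNonneg T) (n : ℕ) :
    ∃ R : specSubspace T n →L[ℂ] specSubspace T n, specPart T n = bddOp R ∧
      (∀ x y, ⟪R x, y⟫_ℂ = ⟪x, R y⟫_ℂ) ∧ ∀ x, 0 ≤ (⟪x, R x⟫_ℂ).re := by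
  have hP := isSpectralMeasure_spectralMeasure hT hT0
  have hd : ∀ x : specSubspace T n, (x : H) ∈ T.domain := fun x =>
    hP.mem_domain_of_bounded measurableSet_Ico (fun _ => abs_le_of_mem_Ico)
      (mem_specSubspace.mp x.2)
  have hm : ∀ x : specSubspace T n, T ⟨x, hd x⟩ ∈ specSubspace T n := fun x =>
    mem_specSubspace.mpr (hP.proj_apply hT measurableSet_Ico (fun _ => abs_le_of_mem_Ico)
      (T.mem_graph ⟨x, hd x⟩) (mem_specSubspace.mp x.2))
  let R₀ : specSubspace T n →ₗ[ℂ] specSubspace T n :=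
    { toFun x := ⟨T ⟨x, hd x⟩, hm x⟩
      map_add' x y := Subtype.ext (T.map_add ⟨x, hd x⟩ ⟨y, hd y⟩)
      map_smul' c x := Subtype.ext (T.map_smul c ⟨x, hd x⟩) }
  have hs : R₀.IsSymmetric := fun x y =>
    isSymm_of_isSelfAdjoint hT (T.mem_graph ⟨x, hd x⟩) (T.mem_graph ⟨y, hd y⟩)
  -- Hellinger-Toeplitz: a symmetric operator defined on the whole Hilbert space is bounded.
  refine ⟨⟨R₀, hs.continuous⟩, ?_, hs, fun x => hT0 ⟨x, hd x⟩⟩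
  refine LinearPMap.eq_of_eq_graph ?_
  ext ⟨u, v⟩
  rw [specPart, mem_graph_part, mem_graph_bddOp]
  constructor
  · intro h
    obtain ⟨z, hz, hz'⟩ := T.mem_graph_iff.mp h
    refine Subtype.ext (Eq.trans ?_ hz')
    change T ⟨u, hd u⟩ = T z
    congr 1
    exact Subtype.ext hz.symm
  · rintro rfl
    exact T.mem_graph ⟨u, hd u⟩

/-- The projections commute with T in one direction; conversely, finite partial sums lie in the
graph, which is closed. -/
theorem eq_directSum_specPart (hT : IsSelfAdjoint T) (hT0 : IsNonneg T) :
    T = directSum (fun n => (specSubspace T n).subtypeₗᵢ) (fun n => specPart T n) := by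
  have hP := isSpectralMeasure_spectralMeasure hT hT0
  refine eq_directSum_of_graph (isHilbertSum_specSubspace hT hT0) fun f g => ?_
  simp only [specPart, mem_graph_part, coe_coord_specSubspace]
  constructor
  · intro h n
    have hd := hP.mem_domain_of_bounded (T := T) (measurableSet_Ico (a := (n : ℝ)) (b := n + 1))
      (fun _ => abs_le_of_mem_Ico) ((spectralMeasure T).proj_proj measurableSet_Ico f)
    have h1 := T.mem_graph ⟨_, hd⟩
    have h2 := hP.proj_apply hT measurableSet_Ico (fun _ => abs_le_of_mem_Ico) h1
      ((spectralMeasure T).proj_proj measurableSet_Ico f)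
    set w := T ⟨_, hd⟩
    -- This is T P f = P T f: pair with k, insert P, and move T between f and P k, which also lies
    -- in dom T.
    have h3 : w = (spectralMeasure T).proj (Ico (n : ℝ) (n + 1)) g := by
      refine ext_inner_left ℂ fun k => ?_
      rw [← h2, ← (spectralMeasure T).inner_proj_left measurableSet_Ico,
        ← (spectralMeasure T).inner_proj_left measurableSet_Ico]
      have hk := (spectralMeasure T).proj_proj (measurableSet_Ico (a := (n : ℝ)) (b := n + 1)) k
      have hd' := hP.mem_domain_of_bounded measurableSet_Ico (fun _ => abs_le_of_mem_Ico) hk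
      have k1 := T.mem_graph ⟨_, hd'⟩
      have k2 := hP.proj_apply hT measurableSet_Ico (fun _ => abs_le_of_mem_Ico) k1 hk
      have hs := isSymm_of_isSelfAdjoint hT
      rw [← hs k1 h1, ← hs k1 h, ← (spectralMeasure T).inner_proj_left measurableSet_Ico, k2]
    rwa [← h3]
  · intro h
    refine isClosed_graph_of_isSelfAdjoint hT |>.mem_of_tendsto
      ((hP.hasSum_proj hT0 f).prodMk (hP.hasSum_proj hT0 g)) (Eventually.of_forall fun s => ?_)
    exact T.graph.sum_mem fun n _ => h n

end SpecSubspace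


/-! ### Bounded operators and their square roots. -/

section BoundedSqrt

set_option linter.unusedSectionVars false

variable {K : Type*} [NormedAddCommGroup K] [InnerProductSpace ℂ K] [CompleteSpace K]
  {R : K →L[ℂ] K}

theorem isSelfAdjoint_bddOp (hs : ∀ x y, ⟪R x, y⟫_ℂ = ⟪x, R y⟫_ℂ) : IsSelfAdjoint (bddOp R) := by
  refine isSelfAdjoint_of_isSymm ?_ ?_ ?_
  · exact dense_univ
  · intro u v y z h1 h2
    rw [← mem_graph_bddOp.mp h1, ← mem_graph_bddOp.mp h2, hs]
  · intro y z h
    rw [mem_graph_bddOp]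
    refine ext_inner_left ℂ fun u => ?_
    rw [← hs, h u (R u) (mem_graph_bddOp.mpr rfl)]

theorem isNonneg_bddOp (h0 : ∀ x, 0 ≤ (⟪x, R x⟫_ℂ).re) : IsNonneg (bddOp R) := by
  rw [isNonneg_iff_graph]
  intro u v h
  rw [← mem_graph_bddOp.mp h]
  exact h0 u

theorem exists_sqrt_bdd (hs : ∀ x y, ⟪R x, y⟫_ℂ = ⟪x, R y⟫_ℂ) (h0 : ∀ x, 0 ≤ (⟪x, R x⟫_ℂ).re) :
    ∃ ρ : K →L[ℂ] K, (∀ x y, ⟪ρ x, y⟫_ℂ = ⟪x, ρ y⟫_ℂ) ∧ (∀ x, 0 ≤ (⟪x, ρ x⟫_ℂ).re) ∧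
      ∀ x, ρ (ρ x) = R x := by
  have hR : 0 ≤ R := by
    rw [ContinuousLinearMap.nonneg_iff_isPositive, ContinuousLinearMap.isPositive_def']
    refine ⟨ContinuousLinearMap.isSelfAdjoint_iff_isSymmetric.mpr hs, fun x => ?_⟩
    rw [ContinuousLinearMap.reApplyInnerSelf_apply, hs]
    exact h0 x
  have hρ := (ContinuousLinearMap.nonneg_iff_isPositive _).mp (CFC.sqrt_nonneg R)
  refine ⟨CFC.sqrt R, ContinuousLinearMap.isSelfAdjoint_iff_isSymmetric.mp hρ.isSelfAdjoint,
    fun x => (Complex.nonneg_iff.mp (hρ.inner_nonneg_right x)).1, fun x => ?_⟩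
  exact congrArg (fun A : K →L[ℂ] K => A x) (CFC.sqrt_mul_sqrt_self R hR)

end BoundedSqrt

/-! ### Orthogonal sums of bounded nonnegative operators, on H and on L²(ℝ₊, H). -/

section Decomposition

set_option linter.unusedSectionVars false

variable {H : Type*} [NormedAddCommGroup H] [InnerProductSpace ℂ H] [CompleteSpace H]

/-- `T` is the orthogonal sum of the bounded nonnegative operators `Rₙ` in the subspaces `Kₙ`. -/
structure IsBddDecomposition (T : H →ₗ.[ℂ] H) (K : ℕ → Submodule ℂ H)
    (R : ∀ n, K n →L[ℂ] K n) : Prop where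
  isHilbertSum : IsHilbertSum ℂ (fun n => K n) (fun n => (K n).subtypeₗᵢ)
  eq_sum : T = directSum (fun n => (K n).subtypeₗᵢ) (fun n => bddOp (R n))
  symm : ∀ n x y, ⟪R n x, y⟫_ℂ = ⟪x, R n y⟫_ℂ
  nonneg : ∀ n x, 0 ≤ (⟪x, R n x⟫_ℂ).re

variable {T : H →ₗ.[ℂ] H} {K : ℕ → Submodule ℂ H} [∀ n, CompleteSpace (K n)]
  {R : ∀ n, K n →L[ℂ] K n}

variable (K) in
/-- The orthogonal projection onto `Kₙ`. -/
def projOn (n : ℕ) : H →L[ℂ] K n := coord (fun n => (K n).subtypeₗᵢ) n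

theorem inner_projOn_left (n : ℕ) (h : H) (x : K n) : ⟪projOn K n h, x⟫_ℂ = ⟪h, (x : H)⟫_ℂ :=
  inner_coord_left (J := fun n => (K n).subtypeₗᵢ) n x h

theorem IsBddDecomposition.mem_graph (h : IsBddDecomposition T K R) {u v : H} :
    (u, v) ∈ T.graph ↔ ∀ n, R n (projOn K n u) = projOn K n v := by
  have := mem_graph_directSum h.isHilbertSum (S := fun n => bddOp (R n)) (f := u) (g := v)
  rw [← h.eq_sum] at this
  simp only [mem_graph_bddOp] at this
  exact this

/-- The root is taken in each summand. For (u, v) in the graph of T the intermediate vector exists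
because ‖ρ_n u_n‖² = (u_n, v_n) is summable. -/
theorem IsBddDecomposition.exists_isNonnegSqrt (h : IsBddDecomposition T K R) :
    ∃ S, IsNonnegSqrt S T := by
  choose ρ hs h0 hR using fun n => exists_sqrt_bdd (h.symm n) (h.nonneg n)
  have hS : IsBddDecomposition (directSum (fun n => (K n).subtypeₗᵢ) (fun n => bddOp (ρ n))) K ρ :=
    ⟨h.isHilbertSum, rfl, hs, h0⟩
  refine ⟨directSum (fun n => (K n).subtypeₗᵢ) (fun n => bddOp (ρ n)),
    isSelfAdjoint_directSum h.isHilbertSum fun n => isSelfAdjoint_bddOp (hs n),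
    isNonneg_directSum h.isHilbertSum fun n => isNonneg_bddOp (h0 n), fun u v => ?_⟩
  simp only [hS.mem_graph]
  rw [h.mem_graph]
  constructor
  · intro huv
    have hsum : Summable fun n => ‖ρ n (projOn K n u)‖ ^ 2 := by
      have h1 := Complex.reCLM.hasSum (hasSum_inner_coord h.isHilbertSum u v)
      refine h1.summable.congr fun n => ?_
      change (⟪projOn K n u, projOn K n v⟫_ℂ).re = _
      rw [← huv, ← hR, ← hs, re_inner_self_eq]
    obtain ⟨w, -, hw⟩ := exists_coord_eq h.isHilbertSum.OrthogonalFamily hsum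
    have hw' : ∀ n, projOn K n w = ρ n (projOn K n u) := hw
    exact ⟨w, fun n => (hw' n).symm, fun n => by rw [hw', hR, huv]⟩
  · rintro ⟨w, h1, h2⟩ n
    rw [← hR, h1, h2]

theorem exists_isBddDecomposition (hT : IsSelfAdjoint T) (hT0 : IsNonneg T) :
    ∃ R : ∀ n, specSubspace T n →L[ℂ] specSubspace T n,
      IsBddDecomposition T (fun n => specSubspace T n) R ∧ ∀ n, specPart T n = bddOp (R n) := by
  choose R hR hs h0 using exists_specPart_eq_bddOp hT hT0
  refine ⟨R, ⟨isHilbertSum_specSubspace hT hT0, ?_, hs, h0⟩, hR⟩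
  conv_lhs => rw [eq_directSum_specPart hT hT0]
  simp only [hR]

/-- A root exists, so `opSqrt` does not take its default value; uniqueness of the root is not
needed. -/
theorem isNonnegSqrt_opSqrt (hT : IsSelfAdjoint T) (hT0 : IsNonneg T) :
    IsNonnegSqrt (opSqrt T) T := by
  obtain ⟨R, h, -⟩ := exists_isBddDecomposition hT hT0
  have hS := h.exists_isNonnegSqrt
  rw [opSqrt, dif_pos hS]
  exact hS.choose_spec

/-! The decomposition of `L²(ℝ₊, H)`. -/

variable (K) in
/-- The orthogonal projection onto `L²(ℝ₊, Kₙ)`. -/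
def projL2 (n : ℕ) : L2 H →L[ℂ] L2 (K n) := mulL2 (projOn K n)

theorem coeFn_projL2 (n : ℕ) (f : L2 H) :
    projL2 K n f =ᵐ[volume.restrict (Ioi (0 : ℝ))] fun x => projOn K n (f x) := coeFn_mulL2 _ f

theorem inclL2_eq_mulL2 (n : ℕ) (f : L2 (K n)) : inclL2 (K n) f = mulL2 (K n).subtypeL f := rfl

theorem coord_inclL2 (n : ℕ) : coord (fun n => inclL2 (K n)) n = projL2 K n := by
  ext1 f
  refine ext_inner_right ℂ fun x => ?_
  rw [inner_coord_left (J := fun n => inclL2 (K n)), projL2,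
    inner_mulL2_left (S := (K n).subtypeL) (inner_projOn_left n)]
  rfl

/-- If all components of f vanish, then f vanishes outside one null set, as there are only countably
many components. -/
theorem isHilbertSum_inclL2 (hK : IsHilbertSum ℂ (fun n => K n) (fun n => (K n).subtypeₗᵢ)) :
    IsHilbertSum ℂ (fun n => L2 (K n)) (fun n => inclL2 (K n)) := by
  refine IsHilbertSum.mk ?_ ?_
  · intro i j hij f g
    rw [L2.inner_def, integral_eq_zero_of_ae]
    filter_upwards [coeFn_mulL2 (K i).subtypeL f, coeFn_mulL2 (K j).subtypeL g] with x h1 h2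
    rw [inclL2_eq_mulL2, inclL2_eq_mulL2, h1, h2]
    exact hK.OrthogonalFamily hij (f x) (g x)
  · rw [top_le_iff, Submodule.topologicalClosure_eq_top_iff, Submodule.eq_bot_iff]
    intro f hf
    have h1 : ∀ n, projL2 K n f = 0 := by
      intro n
      rw [← coord_inclL2]
      refine ext_inner_left ℂ fun x => ?_
      rw [inner_coord_right (J := fun n => inclL2 (K n)), inner_zero_right]
      exact (Submodule.mem_orthogonal _ _).mp hf _ (Submodule.mem_iSup_of_mem n ⟨x, rfl⟩)
    rw [Lp.eq_zero_iff_ae_eq_zero]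
    have h2 : ∀ᵐ x ∂(volume.restrict (Ioi (0 : ℝ))), ∀ n, projOn K n (f x) = 0 := by
      rw [ae_all_iff]
      intro n
      filter_upwards [coeFn_projL2 (K := K) n f, Lp.coeFn_zero (K n) 2 (volume.restrict (Ioi (0 : ℝ)))]
        with x h3 h4
      rw [← h3, h1 n, h4]; rfl
    filter_upwards [h2] with x hx
    refine coord_ext hK fun n => ?_
    rw [Pi.zero_apply, map_zero]
    exact hx n

theorem projL2_ext (hK : IsHilbertSum ℂ (fun n => K n) (fun n => (K n).subtypeₗᵢ)) {f g : L2 H}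
    (h : ∀ n, projL2 K n f = projL2 K n g) : f = g :=
  coord_ext (isHilbertSum_inclL2 hK) fun n => by rw [coord_inclL2]; exact h n

/-! The decomposition of the differential operators. -/

theorem HasSL.unique {K : Type*} [NormedAddCommGroup K] [InnerProductSpace ℂ K] [CompleteSpace K]
    {T : K →ₗ.[ℂ] K} {f g g' : L2 K} {a b a' b' : K} (h : HasSL T f g a b)
    (h' : HasSL T f g' a' b') : a = a' ∧ b = b' := by
  obtain ⟨f', f'', τ, h1, h2, -⟩ := h
  obtain ⟨k', k'', σ, k1, k2, -⟩ := h'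
  obtain ⟨rfl, rfl⟩ := h1.unique_of_eq k1
  exact ⟨rfl, (h2.unique_of_eq k2).2⟩

namespace IsBddDecomposition

theorem mem_graph_ae (h : IsBddDecomposition T K R) {f τ : L2 H} :
    (∀ᵐ x ∂(volume.restrict (Ioi (0 : ℝ))), (f x, τ x) ∈ T.graph) ↔
      ∀ n, projL2 K n τ = mulL2 (R n) (projL2 K n f) := by
  simp only [h.mem_graph]
  rw [ae_all_iff]
  refine forall_congr' fun n => ?_
  constructor
  · intro h1
    refine Lp.ext ?_
    filter_upwards [h1, coeFn_projL2 (K := K) n f, coeFn_projL2 (K := K) n τ, coeFn_mulL2 (R n) (projL2 K n f)]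
      with x e1 e2 e3 e4
    rw [e3, e4, e2, e1]
  · intro h1
    filter_upwards [coeFn_projL2 (K := K) n f, coeFn_projL2 (K := K) n τ, coeFn_mulL2 (R n) (projL2 K n f)]
      with x e2 e3 e4
    rw [← e2, ← e3, ← e4, h1]

theorem hasSL_projL2 (h : IsBddDecomposition T K R) {f g : L2 H} {a b : H} (hf : HasSL T f g a b)
    (n : ℕ) : HasSL (bddOp (R n)) (projL2 K n f) (projL2 K n g) (projOn K n a) (projOn K n b) := by
  obtain ⟨f', f'', τ, h1, h2, h3, rfl⟩ := hf
  refine hasSL_bddOp.mpr ⟨projL2 K n f', projL2 K n f'', h1.mulL2 _, h2.mulL2 _, ?_⟩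
  rw [map_add, map_neg, h.mem_graph_ae.mp h3 n]

/-- The estimates for bounded coefficients are uniform in n, so the first and second derivatives and
the potential terms are square summable and define elements of L²(ℝ₊, H). Closedness of the
derivative shows that they belong to f. The boundary values of f are identified later by projecting.
-/
theorem exists_hasSL (h : IsBddDecomposition T K R) {f g : L2 H} {a b : ∀ n, K n}
    (hf : ∀ n, HasSL (bddOp (R n)) (projL2 K n f) (projL2 K n g) (a n) (b n))
    (hab : ∀ n, a n = 0 ∨ b n = 0) : ∃ a₀ b₀, HasSL T f g a₀ b₀ := by
  choose f' f'' h1 h2 h3 using fun n => hasSL_bddOp.mp (hf n)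
  have hJ := isHilbertSum_inclL2 h.isHilbertSum
  have s0 : ∀ k : L2 H, Summable fun n => ‖projL2 K n k‖ ^ 2 := fun k =>
    (hasSum_norm_sq_coord hJ k).summable.congr fun n => by rw [coord_inclL2]
  have e : ∀ n, ‖f'' n‖ ^ 2 + ‖mulL2 (R n) (projL2 K n f)‖ ^ 2 ≤ ‖projL2 K n g‖ ^ 2 := fun n => by
    rw [h3 n]
    exact norm_sq_le_of_hasSL (h.nonneg n) (h1 n) (h2 n) (hab n)
  have s2 : Summable fun n => ‖f'' n‖ ^ 2 := (s0 g).of_nonneg_of_le (fun n => sq_nonneg _)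
    fun n => le_trans (le_add_of_nonneg_right (sq_nonneg _)) (e n)
  have s3 : Summable fun n => ‖mulL2 (R n) (projL2 K n f)‖ ^ 2 :=
    (s0 g).of_nonneg_of_le (fun n => sq_nonneg _)
      fun n => le_trans (le_add_of_nonneg_left (sq_nonneg _)) (e n)
  have s1 : Summable fun n => ‖f' n‖ ^ 2 := ((s0 f).add s2).of_nonneg_of_le (fun n => sq_nonneg _)
    fun n => by
      have := norm_sq_deriv_le (h1 n) (h2 n) (hab n)
      nlinarith [sq_nonneg (‖projL2 K n f‖ - ‖f'' n‖), sq_nonneg ‖projL2 K n f‖,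
        sq_nonneg ‖f'' n‖]
  obtain ⟨F', hF', cF'⟩ := exists_coord_eq hJ.OrthogonalFamily s1
  obtain ⟨F'', hF'', cF''⟩ := exists_coord_eq hJ.OrthogonalFamily s2
  obtain ⟨τ, hτ, cτ⟩ := exists_coord_eq hJ.OrthogonalFamily s3
  have hf0 := hasSum_coord hJ f
  simp only [coord_inclL2] at cF' cF'' cτ hf0
  have key : ∀ {u v : ∀ n, L2 (K n)} {c : ∀ n, K n} {U V : L2 H},
      (∀ n, HasL2Deriv (u n) (v n) (c n)) → HasSum (fun n => inclL2 (K n) (u n)) U →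
      HasSum (fun n => inclL2 (K n) (v n)) V → ∃ c₀, HasL2Deriv U V c₀ := by
    intro u v c U V h1 hU hV
    refine (isClosed_derivGraph (K := H)).mem_of_tendsto (hU.prodMk hV)
      (Eventually.of_forall fun s => ?_)
    exact (derivGraph H).sum_mem fun n _ => ⟨_, (h1 n).mulL2 (K n).subtypeL⟩
  obtain ⟨a₀, k1⟩ := key h1 hf0 hF'
  obtain ⟨b₀, k2⟩ := key h2 hF' hF''
  refine ⟨a₀, b₀, F', F'', τ, k1, k2, h.mem_graph_ae.mpr cτ, ?_⟩
  refine projL2_ext h.isHilbertSum fun n => ?_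
  rw [map_add, map_neg, cF'', cτ, h3 n]

theorem dirichlet_eq (h : IsBddDecomposition T K R) :
    dirichlet T = directSum (fun n => inclL2 (K n)) (fun n => dirichlet (bddOp (R n))) := by
  refine eq_directSum_of_graph (isHilbertSum_inclL2 h.isHilbertSum) fun f g => ?_
  simp only [mem_graph_dirichlet, coord_inclL2]
  constructor
  · rintro ⟨b, hb⟩ n
    have := h.hasSL_projL2 hb n
    rw [map_zero] at this
    exact ⟨_, this⟩
  · intro hf
    choose b hb using hf
    obtain ⟨a₀, b₀, h0⟩ := h.exists_hasSL hb fun n => Or.inl rfl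
    have : a₀ = 0 := coord_ext h.isHilbertSum fun n => by
      rw [map_zero]
      exact ((h.hasSL_projL2 h0 n).unique (hb n)).1
    exact ⟨b₀, this ▸ h0⟩

theorem neumann_eq (h : IsBddDecomposition T K R) :
    neumann T = directSum (fun n => inclL2 (K n)) (fun n => neumann (bddOp (R n))) := by
  refine eq_directSum_of_graph (isHilbertSum_inclL2 h.isHilbertSum) fun f g => ?_
  simp only [mem_graph_neumann, coord_inclL2]
  constructor
  · rintro ⟨b, hb⟩ n
    have := h.hasSL_projL2 hb n
    rw [map_zero] at this
    exact ⟨_, this⟩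
  · intro hf
    choose a ha using hf
    obtain ⟨a₀, b₀, h0⟩ := h.exists_hasSL ha fun n => Or.inr rfl
    have : b₀ = 0 := coord_ext h.isHilbertSum fun n => by
      rw [map_zero]
      exact ((h.hasSL_projL2 h0 n).unique (ha n)).2
    exact ⟨a₀, this ▸ h0⟩

theorem minimalBdd_eq (h : IsBddDecomposition T K R) :
    minimalBdd T = directSum (fun n => inclL2 (K n)) (fun n => minimalBdd (bddOp (R n))) := by
  refine eq_directSum_of_graph (isHilbertSum_inclL2 h.isHilbertSum) fun f g => ?_
  simp only [mem_graph_minimalBdd, coord_inclL2]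
  constructor
  · intro hf n
    have := h.hasSL_projL2 hf n
    rwa [map_zero] at this
  · intro hf
    obtain ⟨a₀, b₀, h0⟩ := h.exists_hasSL hf fun n => Or.inl rfl
    have ha : a₀ = 0 := coord_ext h.isHilbertSum fun n => by
      rw [map_zero]
      exact ((h.hasSL_projL2 h0 n).unique (hf n)).1
    have hb : b₀ = 0 := coord_ext h.isHilbertSum fun n => by
      rw [map_zero]
      exact ((h.hasSL_projL2 h0 n).unique (hf n)).2
    rwa [ha, hb] at h0

theorem isSelfAdjoint_dirichlet (h : IsBddDecomposition T K R) : IsSelfAdjoint (dirichlet T) := by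
  rw [h.dirichlet_eq]
  exact isSelfAdjoint_directSum (isHilbertSum_inclL2 h.isHilbertSum)
    fun n => isSelfAdjoint_dirichlet_bdd (h.symm n)

theorem isSelfAdjoint_neumann (h : IsBddDecomposition T K R) : IsSelfAdjoint (neumann T) := by
  rw [h.neumann_eq]
  exact isSelfAdjoint_directSum (isHilbertSum_inclL2 h.isHilbertSum)
    fun n => isSelfAdjoint_neumann_bdd (h.symm n)

end IsBddDecomposition

end Decomposition


/-! ### The minimal operator and its Friedrichs and Krein extensions. -/

section MinimalOperator

set_option linter.unusedSectionVars false

variable {H : Type*} [NormedAddCommGroup H] [InnerProductSpace ℂ H] [CompleteSpace H]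
  {T : H →ₗ.[ℂ] H} {K : ℕ → Submodule ℂ H} [∀ n, CompleteSpace (K n)] {R : ∀ n, K n →L[ℂ] K n}

theorem isClosed_graph_minimalBdd_bdd (R : H →L[ℂ] H) :
    IsClosed ((minimalBdd (bddOp R)).graph : Set (L2 H × L2 H)) := by
  have : ((minimalBdd (bddOp R)).graph : Set (L2 H × L2 H)) =
      (fun p : L2 H × L2 H => (p.1, mulL2 R p.1 - p.2)) ⁻¹' (deriv2Graph00 H) := by
    ext ⟨f, g⟩
    rw [SetLike.mem_coe, mem_graph_minimalBdd, hasSL_bddOp, mem_preimage, SetLike.mem_coe,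
      mem_deriv2Graph00]
    constructor
    · rintro ⟨f', f'', h1, h2, rfl⟩
      exact ⟨f', h1, by simpa using h2⟩
    · rintro ⟨f', h1, h2⟩
      exact ⟨f', _, h1, h2, by simp⟩
  rw [this]
  exact isClosed_deriv2Graph00.preimage (by fun_prop)

theorem IsBddDecomposition.isClosed_graph_minimalBdd (h : IsBddDecomposition T K R) :
    IsClosed ((minimalBdd T).graph : Set (L2 H × L2 H)) := by
  have hJ := isHilbertSum_inclL2 h.isHilbertSum
  have : ((minimalBdd T).graph : Set (L2 H × L2 H)) = ⋂ n,
      (fun p : L2 H × L2 H => (projL2 K n p.1, projL2 K n p.2)) ⁻¹'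
        (minimalBdd (bddOp (R n))).graph := by
    ext ⟨f, g⟩
    rw [SetLike.mem_coe, h.minimalBdd_eq, mem_graph_directSum hJ]
    simp only [coord_inclL2, mem_iInter, mem_preimage, SetLike.mem_coe]
  rw [this]
  exact isClosed_iInter fun n => (isClosed_graph_minimalBdd_bdd (R n)).preimage (by fun_prop)

theorem eq_tensorL2 {f : L2 H} {φ : L2 ℂ} {h : H}
    (hf : ∀ᵐ x ∂(volume.restrict (Ioi (0 : ℝ))), f x = φ x • h) : f = tensorL2 φ h := by
  refine Lp.ext ?_
  filter_upwards [hf, coeFn_tensorL2 φ h] with x h1 h2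
  rw [h1, h2]

theorem HasL2Deriv.tensorL2 {φ φ' : L2 ℂ} {c : ℂ} (h : HasL2Deriv φ φ' c) (x : H) :
    HasL2Deriv (tensorL2 φ x) (SturmLiouville.tensorL2 φ' x) (c • x) := by
  have := h.mulL2 (ContinuousLinearMap.toSpanSingleton ℂ x)
  rwa [ContinuousLinearMap.toSpanSingleton_apply] at this

theorem coreD0_le : coreD0 T ≤ pker (trace0 H) ⊓ pker (trace1 H) := by
  refine Submodule.span_le.mpr ?_
  rintro f ⟨φ, ⟨⟨-, h1⟩, h2⟩, h, -, hf⟩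
  rw [eq_tensorL2 hf]
  obtain ⟨φ₀, k0⟩ := mem_pker_trace0.mp h1
  obtain ⟨φ', φ'', a, k1, k2⟩ := mem_pker_trace1.mp h2
  obtain ⟨rfl, rfl⟩ := k0.unique_of_eq k1
  refine ⟨mem_pker_trace0.mpr ⟨_, by simpa using k1.tensorL2 h⟩,
    mem_pker_trace1.mpr ⟨_, _, 0, by simpa using k1.tensorL2 h, by simpa using k2.tensorL2 h⟩⟩

theorem tensorL2_mem_graph_core {q : L2 ℂ × L2 ℂ} (hq : q ∈ deriv2Graph00 ℂ) {h v : H}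
    (hv : (h, v) ∈ T.graph) : (tensorL2 q.1 h, -tensorL2 q.2 h + tensorL2 q.1 v) ∈
      ((slExpr T).domRestrict (coreD0 T)).graph := by
  obtain ⟨φ', h1, h2⟩ := hq
  refine mem_graph_domRestrict.mpr ⟨Submodule.subset_span ⟨q.1, ⟨⟨?_, ?_⟩, ?_⟩, h,
    LinearPMap.mem_domain_of_mem_graph hv, coeFn_tensorL2 _ _⟩, mem_graph_slExpr.mpr ⟨0, 0, ?_⟩⟩
  · exact LinearPMap.mem_domain_of_mem_graph (mem_graph_deriv2.mpr ⟨φ', 0, 0, h1, h2⟩)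
  · exact mem_pker_trace0.mpr ⟨φ', h1⟩
  · exact mem_pker_trace1.mpr ⟨φ', _, 0, h1, h2⟩
  · refine ⟨_, _, _, by simpa using h1.tensorL2 h, by simpa using h2.tensorL2 h, ?_, rfl⟩
    filter_upwards [coeFn_tensorL2 q.1 h, coeFn_tensorL2 q.1 v] with x e1 e2
    rw [e1, e2]
    exact T.graph.smul_mem _ hv

theorem domRestrict_coreD0_le : (slExpr T).domRestrict (coreD0 T) ≤ minimalBdd T := by
  refine LinearPMap.le_of_le_graph ?_
  rintro ⟨f, g⟩ hf
  obtain ⟨h1, h2⟩ := mem_graph_domRestrict.mp hf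
  exact mem_graph_domRestrict.mpr ⟨coreD0_le h1, h2⟩

namespace IsBddDecomposition

theorem mem_graph_subtype (h : IsBddDecomposition T K R) (n : ℕ) (x : K n) :
    ((x : H), (R n x : H)) ∈ T.graph := by
  rw [h.eq_sum]
  exact map_mem_graph_directSum h.isHilbertSum (S := fun n => bddOp (R n))
    (mem_graph_bddOp.mpr rfl)

theorem inclL2_tensorL2 (n : ℕ) (φ : L2 ℂ) (x : K n) :
    inclL2 (K n) (tensorL2 φ x) = tensorL2 φ (x : H) := by
  refine Lp.ext ?_
  rw [inclL2_eq_mulL2]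
  filter_upwards [coeFn_mulL2 (K n).subtypeL (tensorL2 φ x), coeFn_tensorL2 φ x,
    coeFn_tensorL2 φ (x : H)] with t h1 h2 h3
  rw [h1, h2, h3]; rfl

/-- In one summand the coefficient is bounded, so density of tensors with respect to (f, f'') gives
density in the graph. The vectors of the summand lie in dom T, so the embedded tensors belong to the
core. -/
theorem inclL2_mem_closure (h : IsBddDecomposition T K R) {n : ℕ} {f g : L2 (K n)}
    (hf : (f, g) ∈ (minimalBdd (bddOp (R n))).graph) : (inclL2 (K n) f, inclL2 (K n) g) ∈
      ((slExpr T).domRestrict (coreD0 T)).graph.topologicalClosure := by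
  obtain ⟨f', f'', h1, h2, rfl⟩ := hasSL_bddOp.mp (mem_graph_minimalBdd.mp hf)
  have hp := mem_closure_tensorGraph (mem_deriv2Graph00.mpr ⟨f', h1, h2⟩)
  let Φ : L2 (K n) × L2 (K n) →ₗ[ℂ] L2 H × L2 H :=
    ((inclL2 (K n)).toLinearMap ∘ₗ LinearMap.fst ℂ _ _).prod
      ((inclL2 (K n)).toLinearMap ∘ₗ
        (-LinearMap.snd ℂ _ _ + (mulL2 (R n)).toLinearMap ∘ₗ LinearMap.fst ℂ _ _))
  have hΦ : Continuous Φ := by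
    refine ((inclL2 (K n)).continuous.comp continuous_fst).prodMk
      ((inclL2 (K n)).continuous.comp ?_)
    exact continuous_snd.neg.add ((mulL2 (R n)).continuous.comp continuous_fst)
  have hmap : tensorGraph (K n) ≤ ((slExpr T).domRestrict (coreD0 T)).graph.comap Φ := by
    refine Submodule.span_le.mpr ?_
    rintro _ ⟨q, hq, x, rfl⟩
    have h3 := tensorL2_mem_graph_core hq (h.mem_graph_subtype n x)
    have h4 : mulL2 (R n) (tensorL2 q.1 x) = tensorL2 q.1 (R n x) := by
      refine Lp.ext ?_
      filter_upwards [coeFn_mulL2 (R n) (tensorL2 q.1 x), coeFn_tensorL2 q.1 x,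
        coeFn_tensorL2 q.1 (R n x)] with t e1 e2 e3
      rw [e1, e2, e3, map_smul]
    change (inclL2 (K n) (tensorL2 q.1 x), inclL2 (K n) (-tensorL2 q.2 x +
      mulL2 (R n) (tensorL2 q.1 x))) ∈ ((slExpr T).domRestrict (coreD0 T)).graph
    rw [h4, map_add, map_neg, inclL2_tensorL2, inclL2_tensorL2, inclL2_tensorL2]
    exact h3
  have := map_mem_closure (f := Φ) (t := ((slExpr T).domRestrict (coreD0 T)).graph) hΦ hp
    fun p hp => hmap hp
  exact this

/-- The operator on all functions with zero boundary data is closed and contains the core operator;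
conversely each element of its graph is a limit of finite sums of components, each in the closure of
the core graph. -/
theorem minimalOp_eq (h : IsBddDecomposition T K R) : minimalOp T = minimalBdd T := by
  have hcl : (minimalBdd T).IsClosed := h.isClosed_graph_minimalBdd
  have hcl' := hcl.isClosable.leIsClosable domRestrict_coreD0_le
  refine LinearPMap.eq_of_eq_graph ?_
  rw [minimalOp, ← hcl'.graph_closure_eq_closure_graph]
  refine le_antisymm (Submodule.topologicalClosure_minimal _
    (LinearPMap.le_graph_of_le domRestrict_coreD0_le) hcl) ?_
  rintro ⟨f, g⟩ hf
  have hJ := isHilbertSum_inclL2 h.isHilbertSum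
  rw [h.minimalBdd_eq, mem_graph_directSum hJ] at hf
  refine (Submodule.isClosed_topologicalClosure _).mem_of_tendsto
    ((hasSum_coord hJ f).prodMk (hasSum_coord hJ g)) (Eventually.of_forall fun s => ?_)
  exact Submodule.sum_mem _ fun n _ => h.inclL2_mem_closure (hf n)

/-- The form core property of each component passes to the orthogonal sum. -/
theorem friedrichs_minimalOp (h : IsBddDecomposition T K R) :
    friedrichs (minimalOp T) = dirichlet T := by
  have hJ := isHilbertSum_inclL2 h.isHilbertSum
  have h0 : ∀ n, IsNonneg (dirichlet (bddOp (R n))) := fun n => isNonneg_dirichlet_bdd (h.nonneg n)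
  rw [h.minimalOp_eq]
  refine friedrichs_eq_of_isFormCore ⟨minimalBdd_le_dirichlet, h.isSelfAdjoint_dirichlet, ?_⟩ ?_
  · rw [h.dirichlet_eq]; exact isNonneg_directSum hJ h0
  · rw [h.dirichlet_eq, h.minimalBdd_eq]
    exact isFormCore_directSum hJ (fun n => minimalBdd_le_dirichlet) h0
      fun n => isFormCore_dirichlet_bdd

/-- The Krein extension of the minimal operator is the orthogonal sum of the Krein extensions of the
summands. -/
theorem exists_krein (h : IsBddDecomposition T K R) : ∃ B : ∀ n, L2 (K n) →ₗ.[ℂ] L2 (K n),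
    (∀ n, IsKreinExtension (minimalBdd (bddOp (R n))) (B n)) ∧
      IsKreinExtension (minimalOp T) (directSum (fun n => inclL2 (K n)) B) := by
  have hJ := isHilbertSum_inclL2 h.isHilbertSum
  choose ρ hs h0 hR using fun n => exists_sqrt_bdd (h.symm n) (h.nonneg n)
  have hB := fun n => isNonnegSAExtension_kreinBdd (hs n) (hR n)
  have hc := fun n => isFormCore_kreinBdd (hs n) (h0 n) (hR n)
  refine ⟨fun n => kreinBdd (ρ n), fun n => isKreinExtension_of_isFormCore (hB n) (hc n), ?_⟩
  rw [h.minimalOp_eq, h.minimalBdd_eq]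
  exact isKreinExtension_of_isFormCore ⟨directSum_mono hJ fun n => (hB n).le,
    isSelfAdjoint_directSum hJ fun n => (hB n).selfAdjoint,
    isNonneg_directSum hJ fun n => (hB n).nonneg⟩
    (isFormCore_directSum hJ (fun n => (hB n).le) (fun n => (hB n).nonneg) hc)

end IsBddDecomposition

end MinimalOperator


/-! ### Operators associated with densely defined forms. -/

section FormOperator

variable {E : Type*} [NormedAddCommGroup E] [InnerProductSpace ℂ E]

theorem mem_graph_formOperator {D : Submodule ℂ E} (hD : Dense (D : Set E))
    {t : D →ₗ⋆[ℂ] D →ₗ[ℂ] ℂ} {f g : E} : (f, g) ∈ (formOperator D t).graph ↔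
      ∃ hf : f ∈ D, ∀ k : D, t k ⟨f, hf⟩ = ⟪(k : E), g⟫_ℂ := by
  rw [formOperator, Submodule.toLinearPMap_graph_eq]
  · rfl
  · rintro ⟨f, g⟩ ⟨hf, h⟩ (rfl : f = 0)
    refine hD.eq_zero_of_inner_right ℂ fun k hk => ?_
    rw [← h ⟨k, hk⟩]
    exact map_zero (t ⟨k, hk⟩)

theorem isSymm_formOperator {D : Submodule ℂ E} (hD : Dense (D : Set E))
    {t : D →ₗ⋆[ℂ] D →ₗ[ℂ] ℂ} (ht : ∀ k f, starRingEnd ℂ (t k f) = t f k) :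
    IsSymm (formOperator D t) := by
  intro u v y z h1 h2
  obtain ⟨hu, h1⟩ := (mem_graph_formOperator hD).mp h1
  obtain ⟨hy, h2⟩ := (mem_graph_formOperator hD).mp h2
  rw [← h2 ⟨u, hu⟩, ← inner_conj_symm, ← h1 ⟨y, hy⟩, ht]

end FormOperator

/-! ### The operator of the energy form is the Neumann realization. -/

section Neumann

variable {H : Type*} [NormedAddCommGroup H] [InnerProductSpace ℂ H] {S T : H →ₗ.[ℂ] H}

theorem conj_energyForm (k f : W12 S) :
    starRingEnd ℂ (energyForm S k f) = energyForm S f k := by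
  simp only [energyForm, LinearMap.mk₂'ₛₗ_apply, map_add, inner_conj_symm]

variable [CompleteSpace H]

theorem mem_W12_iff {f : L2 H} : f ∈ W12 S ↔ (∃ f' a, HasL2Deriv f f' a) ∧
    ∃ σ : L2 H, ∀ᵐ x ∂(volume.restrict (Ioi (0 : ℝ))), (f x, σ x) ∈ S.graph := by
  rw [W12, Submodule.mem_inf, LinearPMap.mem_domain_iff, LinearPMap.mem_domain_iff]
  simp only [mem_graph_deriv1, mem_graph_potential]

theorem energyForm_eq {k f : W12 S} {k' f' κ σ : L2 H} {a c : H} (hk : HasL2Deriv (k : L2 H) k' c)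
    (hf : HasL2Deriv (f : L2 H) f' a)
    (hκ : ∀ᵐ x ∂(volume.restrict (Ioi (0 : ℝ))), ((k : L2 H) x, κ x) ∈ S.graph)
    (hσ : ∀ᵐ x ∂(volume.restrict (Ioi (0 : ℝ))), ((f : L2 H) x, σ x) ∈ S.graph) :
    energyForm S k f = ⟪k', f'⟫_ℂ + ⟪κ, σ⟫_ℂ := by
  have e1 : ∀ {g : W12 S} {g' : L2 H} {b : H}, HasL2Deriv (g : L2 H) g' b →
      deriv1 H ⟨g, g.2.1⟩ = g' := fun {g g' b} h =>
    (LinearPMap.mem_graph_snd_inj _ (mem_graph_deriv1.mpr ⟨b, h⟩)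
      ((deriv1 H).mem_graph ⟨g, g.2.1⟩) rfl).symm
  have e2 : ∀ {g : W12 S} {g' : L2 H},
      (∀ᵐ x ∂(volume.restrict (Ioi (0 : ℝ))), ((g : L2 H) x, g' x) ∈ S.graph) →
      potential S ⟨g, g.2.2⟩ = g' := fun {g g'} h =>
    (LinearPMap.mem_graph_snd_inj _ (mem_graph_potential.mpr h)
      ((potential S).mem_graph ⟨g, g.2.2⟩) rfl).symm
  simp only [energyForm, LinearMap.mk₂'ₛₗ_apply]
  rw [e1 hk, e1 hf, e2 hκ, e2 hσ]

/-- If `S² = T`, then `S (1 + T)⁻¹` is bounded. -/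
theorem IsNonnegSqrt.exists_clm (hS : IsNonnegSqrt S T) (hT : IsSelfAdjoint T)
    (hT0 : IsNonneg T) : ∃ B : H →L[ℂ] H, ∀ u v, (u, v) ∈ T.graph → (u, B (u + v)) ∈ S.graph := by
  obtain ⟨R, hR, hu, -⟩ := exists_resolvent_clm hT hT0
  choose w hw hw' using fun g => (hS.sq _ _).mp (hR g)
  have huniq : ∀ {g x}, (R g, x) ∈ S.graph → w g = x := fun {g x} hx =>
    LinearPMap.mem_graph_snd_inj _ (hw g) hx rfl
  have hs := isSymm_of_isSelfAdjoint hS.selfAdjoint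
  let B : H →L[ℂ] H := LinearMap.mkContinuous
    { toFun := w
      map_add' a b := huniq (by rw [map_add]; exact S.graph.add_mem (hw a) (hw b))
      map_smul' c a := huniq (by rw [map_smul]; exact S.graph.smul_mem c (hw a)) } 1 fun g => by
    rw [one_mul]
    change ‖w g‖ ≤ ‖g‖
    refine (sq_le_sq₀ (norm_nonneg _) (norm_nonneg _)).mp ?_
    have h1 := norm_le_of_mem_graph (x := 1) hT0 (u := R g) (g := g) (by simpa using hR g)
    -- With R = (1 + T)⁻¹: ‖S R g‖² = (R g, T R g) = (R g, g - R g) ≤ ‖g‖².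
    rw [← re_inner_self_eq, hs (hw g) (hw' g), inner_sub_right, Complex.sub_re, re_inner_self_eq]
    have h2 : (⟪R g, g⟫_ℂ).re ≤ ‖R g‖ * ‖g‖ := re_inner_le_norm (𝕜 := ℂ) _ _
    nlinarith [norm_nonneg (R g), norm_nonneg g, sq_nonneg ‖R g‖]
  refine ⟨B, fun u v huv => ?_⟩
  have h1 := hw (u + v)
  rwa [hu u v huv] at h1

/-- Only one inclusion is computed: integration by parts and (Sk, Sf) = (k, Tf) put the Neumann
realization inside the form operator. The reverse inclusion is free, since the form operator is
symmetric. -/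
theorem formOperator_energyForm_eq (hT : IsSelfAdjoint T) (hT0 : IsNonneg T)
    (hN : IsSelfAdjoint (neumann T)) (hS : IsNonnegSqrt S T) :
    formOperator (W12 S) (energyForm S) = neumann T := by
  obtain ⟨B, hB⟩ := hS.exists_clm hT hT0
  have hs := isSymm_of_isSelfAdjoint hS.selfAdjoint
  -- The bounded operator B recovers S f from f + T f pointwise, so S f(·) is measurable and square
  -- integrable.
  have hpot : ∀ {f τ : L2 H}, (∀ᵐ x ∂(volume.restrict (Ioi (0 : ℝ))), (f x, τ x) ∈ T.graph) →
      ∀ᵐ x ∂(volume.restrict (Ioi (0 : ℝ))), (f x, mulL2 B (f + τ) x) ∈ S.graph := by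
    intro f τ h
    filter_upwards [h, coeFn_mulL2 B (f + τ), Lp.coeFn_add f τ] with x h1 h2 h3
    rw [h2, h3]
    exact hB _ _ h1
  have hmem : ∀ {f g : L2 H}, (f, g) ∈ (neumann T).graph → f ∈ W12 S := by
    intro f g h
    obtain ⟨a, f', f'', τ, h1, -, h3, -⟩ := mem_graph_neumann.mp h
    exact mem_W12_iff.mpr ⟨⟨f', a, h1⟩, _, hpot h3⟩
  have hD : Dense (W12 S : Set (L2 H)) := hN.dense_domain.mono fun f hf =>
    hmem ((neumann T).mem_graph ⟨f, hf⟩)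
  refine eq_of_le_of_isSymm hN (LinearPMap.le_of_le_graph ?_)
    (isSymm_formOperator hD conj_energyForm)
  rintro ⟨f, g⟩ h
  refine (mem_graph_formOperator hD).mpr ⟨hmem h, fun k => ?_⟩
  obtain ⟨a, f', f'', τ, h1, h2, h3, rfl⟩ := mem_graph_neumann.mp h
  obtain ⟨⟨k', c, k1⟩, κ, k2⟩ := mem_W12_iff.mp k.2
  rw [energyForm_eq k1 h1 k2 (hpot h3), inner_add_right, h1.inner_second h2 k1, inner_zero_right,
    add_zero]
  congr 1
  rw [L2.inner_def, L2.inner_def]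
  refine integral_congr_ae ?_
  filter_upwards [h3, k2, hpot h3] with x e1 e2 e3
  obtain ⟨w, w1, w2⟩ := (hS.sq _ _).mp e1
  rw [LinearPMap.mem_graph_snd_inj _ e3 w1 rfl]
  exact hs e2 w2

theorem neumannOp_eq (hT : IsSelfAdjoint T) (hT0 : IsNonneg T) (hN : IsSelfAdjoint (neumann T)) :
    neumannOp T = neumann T :=
  formOperator_energyForm_eq hT hT0 hN (isNonnegSqrt_opSqrt hT hT0)

end Neumann

/-! ### Graph norms and closedness of the domains. -/

section GraphNorm

set_option linter.unusedSectionVars false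

variable {H : Type*} [NormedAddCommGroup H] [InnerProductSpace ℂ H] [CompleteSpace H]
  {T : H →ₗ.[ℂ] H} {K : ℕ → Submodule ℂ H} [∀ n, CompleteSpace (K n)] {R : ∀ n, K n →L[ℂ] K n}

/-- The bounded case in each component, summed. -/
theorem IsBddDecomposition.re_inner_nonneg (h : IsBddDecomposition T K R) {f f' f'' τ : L2 H}
    {a b : H} (h1 : HasL2Deriv f f' a) (h2 : HasL2Deriv f' f'' b)
    (h3 : ∀ᵐ x ∂(volume.restrict (Ioi (0 : ℝ))), (f x, τ x) ∈ T.graph) (hab : a = 0 ∨ b = 0) :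
    0 ≤ (⟪-f'', τ⟫_ℂ).re := by
  have hsum := Complex.reCLM.hasSum
    (hasSum_inner_coord (isHilbertSum_inclL2 h.isHilbertSum) (-f'') τ)
  refine hsum.nonneg fun n => ?_
  rw [coord_inclL2, map_neg, h.mem_graph_ae.mp h3 n]
  refine re_inner_second_mulL2_nonneg (h.nonneg n) (h1.mulL2 (projOn K n))
    (h2.mulL2 (projOn K n)) ?_
  rcases hab with rfl | rfl
  · exact Or.inl (map_zero _)
  · exact Or.inr (map_zero _)

theorem normW22_sq (f : W22 T) : normW22 T f ^ 2 =
    ‖deriv2 H ⟨f, f.2.1⟩‖ ^ 2 + ‖(f : L2 H)‖ ^ 2 + ‖potential T ⟨f, f.2.2⟩‖ ^ 2 :=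
  Real.sq_sqrt (by positivity)

theorem slExpr_apply (f : W22 T) :
    slExpr T ⟨f, f.2⟩ = -deriv2 H ⟨f, f.2.1⟩ + potential T ⟨f, f.2.2⟩ := rfl

theorem norm_slExpr_sq_le (f : W22 T) :
    ‖slExpr T ⟨f, f.2⟩‖ ^ 2 + ‖(f : L2 H)‖ ^ 2 ≤ 2 * normW22 T f ^ 2 := by
  rw [normW22_sq, slExpr_apply]
  have h1 := norm_add_le (-deriv2 H ⟨f, f.2.1⟩) (potential T ⟨f, f.2.2⟩)
  rw [norm_neg] at h1
  have h2 := pow_le_pow_left₀ (norm_nonneg _) h1 2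
  nlinarith [sq_nonneg (‖deriv2 H ⟨f, f.2.1⟩‖ - ‖potential T ⟨f, f.2.2⟩‖), sq_nonneg ‖(f : L2 H)‖]

/-- The two sides differ by twice the cross term Re(-f'', Tf), which is nonnegative. -/
theorem IsBddDecomposition.normW22_sq_le (h : IsBddDecomposition T K R) {f : W22 T}
    (hf : (f : L2 H) ∈ pker (trace0 H) ∨ (f : L2 H) ∈ pker (trace1 H)) :
    normW22 T f ^ 2 ≤ ‖slExpr T ⟨f, f.2⟩‖ ^ 2 + ‖(f : L2 H)‖ ^ 2 := by
  rw [normW22_sq, slExpr_apply, norm_sq_add_eq, norm_neg]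
  obtain ⟨f', a, b, h1, h2⟩ := mem_graph_deriv2.mp ((deriv2 H).mem_graph ⟨f, f.2.1⟩)
  have h3 := mem_graph_potential.mp ((potential T).mem_graph ⟨f, f.2.2⟩)
  have hsl : HasSL T f _ a b := ⟨f', _, _, h1, h2, h3, rfl⟩
  have := h.re_inner_nonneg h1 h2 h3 (hf.imp hsl.mem_pker_trace0_iff.mp hsl.mem_pker_trace1_iff.mp)
  linarith

/-- The domain of a closed restriction of `-d²/dx² + T` is closed in `W^{2,2}_T(ℝ₊, H)`. -/
theorem mem_domain_of_tendsto_normW22 {D : Submodule ℂ (L2 H)}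
    (hcl : IsClosed (((slExpr T).domRestrict D).graph : Set (L2 H × L2 H))) {u : ℕ → W22 T}
    {f : W22 T} (hu : ∀ k, (u k : L2 H) ∈ ((slExpr T).domRestrict D).domain)
    (h : Tendsto (fun k => normW22 T (u k - f)) atTop (𝓝 0)) :
    (f : L2 H) ∈ ((slExpr T).domRestrict D).domain := by
  have h1 : Tendsto (fun k => (u k : L2 H)) atTop (𝓝 f) := by
    rw [tendsto_iff_norm_sub_tendsto_zero]
    refine squeeze_zero (fun k => norm_nonneg _) (fun k => ?_) h
    refine Real.le_sqrt_of_sq_le ?_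
    change ‖(u k : L2 H) - f‖ ^ 2 ≤ _ + ‖(u k : L2 H) - f‖ ^ 2 + _
    nlinarith [sq_nonneg ‖deriv2 H ⟨(u k - f : W22 T), (u k - f).2.1⟩‖,
      sq_nonneg ‖potential T ⟨(u k - f : W22 T), (u k - f).2.2⟩‖]
  have h2 : Tendsto (fun k => slExpr T ⟨u k, (u k).2⟩) atTop (𝓝 (slExpr T ⟨f, f.2⟩)) := by
    rw [tendsto_iff_norm_sub_tendsto_zero]
    have h' := h.const_mul 2
    rw [mul_zero] at h'
    refine squeeze_zero (fun k => norm_nonneg _) (fun k => ?_) h'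
    have e : slExpr T ⟨u k, (u k).2⟩ - slExpr T ⟨f, f.2⟩ =
        slExpr T ⟨(u k - f : W22 T), (u k - f).2⟩ :=
      ((slExpr T).map_sub ⟨u k, (u k).2⟩ ⟨f, f.2⟩).symm
    rw [e]
    have h0 : 0 ≤ normW22 T (u k - f) := Real.sqrt_nonneg _
    refine (abs_le_of_sq_le_sq' ?_ (mul_nonneg zero_le_two h0)).2
    have := norm_slExpr_sq_le (u k - f)
    nlinarith [sq_nonneg ‖((u k - f : W22 T) : L2 H)‖, sq_nonneg (normW22 T (u k - f))]
  -- Convergence in the norm of W^{2,2}_T implies convergence in the graph, which is closed.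
  have h3 := hcl.mem_of_tendsto (h1.prodMk_nhds h2) (Eventually.of_forall fun k =>
    mem_graph_domRestrict.mpr ⟨(hu k).1, (slExpr T).mem_graph ⟨u k, (u k).2⟩⟩)
  exact LinearPMap.mem_domain_of_mem_graph h3

theorem domain_slExpr_domRestrict (D : Submodule ℂ (L2 H)) :
    ((slExpr T).domRestrict D).domain = W22 T ⊓ D := inf_comm _ _

theorem IsBddDecomposition.normW22_equiv (h : IsBddDecomposition T K R) {D : Submodule ℂ (L2 H)}
    (hD : ∀ f ∈ D, f ∈ pker (trace0 H) ∨ f ∈ pker (trace1 H)) (f : L2 H)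
    (hf : f ∈ ((slExpr T).domRestrict D).domain) (hW : f ∈ W22 T) :
    normW22 T ⟨f, hW⟩ ^ 2 ≤ ‖(slExpr T).domRestrict D ⟨f, hf⟩‖ ^ 2 + ‖f‖ ^ 2 ∧
      ‖(slExpr T).domRestrict D ⟨f, hf⟩‖ ^ 2 + ‖f‖ ^ 2 ≤ 2 * normW22 T ⟨f, hW⟩ ^ 2 := by
  have e : (slExpr T).domRestrict D ⟨f, hf⟩ = slExpr T ⟨f, hW⟩ :=
    LinearPMap.domRestrict_apply rfl
  rw [e]
  exact ⟨h.normW22_sq_le (f := ⟨f, hW⟩) (hD f hf.1), norm_slExpr_sq_le ⟨f, hW⟩⟩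

/-- A self-adjoint restriction of `-d²/dx² + T` by a Dirichlet or Neumann condition: its domain is
closed in `W^{2,2}_T(ℝ₊, H)`, where the graph norm is equivalent to the norm of that space. -/
theorem IsBddDecomposition.domain_properties (h : IsBddDecomposition T K R)
    {D : Submodule ℂ (L2 H)} (hD : ∀ f ∈ D, f ∈ pker (trace0 H) ∨ f ∈ pker (trace1 H))
    {A : L2 H →ₗ.[ℂ] L2 H} (hA : A = (slExpr T).domRestrict D) (hs : IsSelfAdjoint A) :
    A.domain = W22 T ⊓ D ∧
      (∀ (f : L2 H) (hF : f ∈ A.domain) (hW : f ∈ W22 T),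
        normW22 T ⟨f, hW⟩ ^ 2 ≤ ‖A ⟨f, hF⟩‖ ^ 2 + ‖f‖ ^ 2 ∧
        ‖A ⟨f, hF⟩‖ ^ 2 + ‖f‖ ^ 2 ≤ 2 * normW22 T ⟨f, hW⟩ ^ 2) ∧
      (∀ (u : ℕ → W22 T) (f : W22 T), (∀ k, (u k : L2 H) ∈ A.domain) →
        Tendsto (fun k => normW22 T (u k - f)) atTop (𝓝 0) → (f : L2 H) ∈ A.domain) := by
  subst hA
  have hcl : IsClosed (((slExpr T).domRestrict D).graph : Set (L2 H × L2 H)) :=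
    isClosed_graph_of_isSelfAdjoint hs
  exact ⟨domain_slExpr_domRestrict D, h.normW22_equiv hD, fun u f hu hf =>
    mem_domain_of_tendsto_normW22 (D := D) hcl (u := u) (f := f) hu hf⟩

end GraphNorm

end SturmLiouville

end

/-! ### Assembly of the results. -/

theorem proposition5p2 {H : Type*} [NormedAddCommGroup H] [InnerProductSpace ℂ H]
    [CompleteSpace H] [TopologicalSpace.SeparableSpace H]
    (T : H →ₗ.[ℂ] H) (hT : IsSelfAdjoint T) (hT0 : IsNonneg T) :
    -- (i) the decompositions with respect to `L²(ℝ₊, H) = ⨁ L²(ℝ₊, Hₙ)`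
    (IsHilbertSum ℂ (fun n => L2 (specSubspace T n)) (fun n => inclL2 (specSubspace T n)) ∧
      minimalOp T =
        directSum (fun n => inclL2 (specSubspace T n)) (fun n => minimalBdd (specPart T n)) ∧
      friedrichs (minimalOp T) =
        directSum (fun n => inclL2 (specSubspace T n))
          (fun n => friedrichs (minimalBdd (specPart T n))) ∧
      (IsKreinExtension (minimalOp T) (krein (minimalOp T)) ∧
        (∀ n, IsKreinExtension (minimalBdd (specPart T n)) (krein (minimalBdd (specPart T n)))) ∧
        krein (minimalOp T) =
          directSum (fun n => inclL2 (specSubspace T n))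
            (fun n => krein (minimalBdd (specPart T n)))) ∧
      neumannOp T =
        directSum (fun n => inclL2 (specSubspace T n)) (fun n => neumannOp (specPart T n))) ∧
    -- (ii) the domain of the Friedrichs extension
    ((friedrichs (minimalOp T)).domain = W22 T ⊓ pker (trace0 H) ∧
      (∀ (f : L2 H) (hF : f ∈ (friedrichs (minimalOp T)).domain) (hW : f ∈ W22 T),
        normW22 T ⟨f, hW⟩ ^ 2 ≤ ‖friedrichs (minimalOp T) ⟨f, hF⟩‖ ^ 2 + ‖f‖ ^ 2 ∧
        ‖friedrichs (minimalOp T) ⟨f, hF⟩‖ ^ 2 + ‖f‖ ^ 2 ≤ 2 * normW22 T ⟨f, hW⟩ ^ 2) ∧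
      (∀ (u : ℕ → W22 T) (f : W22 T), (∀ k, (u k : L2 H) ∈ (friedrichs (minimalOp T)).domain) →
        Tendsto (fun k => normW22 T (u k - f)) atTop (𝓝 0) →
        (f : L2 H) ∈ (friedrichs (minimalOp T)).domain)) ∧
    -- (iii) the domain of the Neumann realization
    ((neumannOp T).domain = W22 T ⊓ pker (trace1 H) ∧
      (∀ (f : L2 H) (hN : f ∈ (neumannOp T).domain) (hW : f ∈ W22 T),
        normW22 T ⟨f, hW⟩ ^ 2 ≤ ‖neumannOp T ⟨f, hN⟩‖ ^ 2 + ‖f‖ ^ 2 ∧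
        ‖neumannOp T ⟨f, hN⟩‖ ^ 2 + ‖f‖ ^ 2 ≤ 2 * normW22 T ⟨f, hW⟩ ^ 2) ∧
      (∀ (u : ℕ → W22 T) (f : W22 T), (∀ k, (u k : L2 H) ∈ (neumannOp T).domain) →
        Tendsto (fun k => normW22 T (u k - f)) atTop (𝓝 0) →
        (f : L2 H) ∈ (neumannOp T).domain)) ∧
    -- the Dirichlet and Neumann realizations are the operators above and are self-adjoint
    (friedrichs (minimalOp T) = dirichlet T ∧ IsSelfAdjoint (dirichlet T) ∧
      neumannOp T = neumann T ∧ IsSelfAdjoint (neumann T)) := by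
  obtain ⟨R, h, hR⟩ := exists_isBddDecomposition hT hT0
  have hF := h.friedrichs_minimalOp
  have hN := neumannOp_eq hT hT0 h.isSelfAdjoint_neumann
  have hFn : ∀ n, friedrichs (minimalBdd (specPart T n)) = dirichlet (bddOp (R n)) := fun n => by
    rw [hR n]
    exact friedrichs_eq_of_isFormCore (isNonnegSAExtension_dirichlet_bdd (h.symm n) (h.nonneg n))
      isFormCore_dirichlet_bdd
  have hNn : ∀ n, neumannOp (specPart T n) = neumann (bddOp (R n)) := fun n => by
    rw [hR n]
    exact neumannOp_eq (isSelfAdjoint_bddOp (h.symm n)) (isNonneg_bddOp (h.nonneg n))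
      (isSelfAdjoint_neumann_bdd (h.symm n))
  -- The operators B n are Krein extensions of the summands and their sum is one of the minimal
  -- operator; uniqueness replaces both by `krein`.
  obtain ⟨B, hB, hK⟩ := h.exists_krein
  have hKn : ∀ n, krein (minimalBdd (specPart T n)) = B n := fun n => by
    rw [hR n]; exact krein_eq (hB n)
  refine ⟨⟨isHilbertSum_inclL2 h.isHilbertSum, ?_, ?_, ⟨?_, ?_, ?_⟩, ?_⟩,
    h.domain_properties (fun _ => Or.inl) hF (hF ▸ h.isSelfAdjoint_dirichlet),
    h.domain_properties (fun _ => Or.inr) hN (hN ▸ h.isSelfAdjoint_neumann),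
    hF, h.isSelfAdjoint_dirichlet, hN, h.isSelfAdjoint_neumann⟩
  · simp only [hR]
    rw [h.minimalOp_eq, h.minimalBdd_eq]
  · simp only [hFn]
    rw [hF, h.dirichlet_eq]
  · rw [krein_eq hK]; exact hK
  · intro n
    rw [hKn, hR n]; exact hB n
  · simp only [hKn]
    exact krein_eq hK
  · simp only [hNn]
    rw [hN, h.neumann_eq]
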